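/- A digital search tree (DST) is built by inserting data one after the other into a binary tree: the first datum is placed in the root, and each later datum moves down from the root until it reaches an empty position, where it becomes a new node. In a random DST every decision whether to go left or right is made by an independent fair coin. A node is 2-protected if its distance to every leaf (node without children) is at least 2. Let $l_N$ be the average number of 2-protected nodes in a random DST of size $N$. Put $L=\log 2$, $Q_m=\prod_{k=1}^m(1-2^{-k})$, $Q_\infty=\prod_{k\ge1}(1-2^{-k})$, $Q(x)=\prod_{k\ge1}(1-x2^{-k})=\sum_{m\ge0}a_{m+1}x^m$ with $a_{m+1}=(-1)^m2^{-\binom{m+1}{2}}/Q_m$. For $m\ge0$ let $S_m(z)$ be the extension to complex $z$ of $$\sum_{n=1}^{z-2}\Big[1-(n+1)2^{-n}-\tfrac{n(n+1)}4\Big]2^{-nm}$$ given by the usual closed forms of the (differentiated) geometric sums $\sum_{n=1}^M w^n$, $\sum_{n=1}^M (n+1)w^n$, $\sum_{n=1}^M n(n+1)w^n$ (with $w^M=2^{-jM}$ for $w=2^{-j}$, and the polynomials in $M$ when $w=1$), and let $$\psi(z)=\frac{Q_\infty}{Q(2^{2-z})}\cdot\frac1{Q_\infty}\sum_{m\ge0}a_{m+1}S_m(z).$$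 Let $b_0=\frac{37}{12L}-4$ and, for $m\ge1$, $$b_m=\frac1{4L}\,\frac{B(2^{-m})}{(2^{-m}-1)^3(2^{-m}-2)^2},$$ where $B(x)=16L-48xL+48x^2L-16x^3L-20+60x-69x^2+36x^3-7x^4-8x\log x+12x^2\log x-10x^3\log x+4x^4\log x$. Then $b_m=\lim_{z\to1}\frac{Q_\infty/Q(2^{1-z})}{1-2^{1-z}}S_m(z)$ for all $m\ge0$, the series $\sum_{m\ge0}a_{m+1}b_m$ converges, and, as $N\to\infty$, $$l_N=N\cdot\frac1{Q_\infty}\sum_{m\ge0}a_{m+1}b_m+N\cdot\delta(\log_2N)+O(1),$$ where the constant $\frac1{Q_\infty}\sum_{m\ge0}a_{m+1}b_m$ equals $0.30707981393605921828549\dots$, and $\delta:\mathbb R\to\mathbb R$ is a function of period $1$ with the absolutely convergent, mean-zero Fourier expansion $\delta(x)=\sum_{k\ne0}c_ke^{2\pi ikx}$. Here, with $\chi_k=\frac{2\pi ik}{L}$, the coefficient $c_k=\lim_{z\to1+\chi_k}(z-1-\chi_k)\,\Gamma(-z)\psi(z)$ is the residue of $\Gamma(-z)\psi(z)$ at its (at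 most simple) pole $1+\chi_k$. The function $\delta$ is tiny: $|\delta(x)|<5\cdot10^{-5}$ for all $x$. -/

import Mathlib

open Filter Topology Asymptotics

noncomputable section

namespace DST

/-! ### Random digital search trees

Only the shape of a digital search tree matters for counting nodes, so it is a binary tree without
labels: `nil` is the empty tree and each `node` holds one datum. -/

/-- One fair coin toss. -/
def coin : PMF Bool := PMF.uniformOfFintype Bool

/-- Insertion of one further datum. It is placed at the root of an empty tree; at an occupied node
a fair coin (the next bit of the datum) decides whether it goes down to the left or to the right,
where the procedure is repeated. -/
def insertRandom : BinaryTree Unit → PMF (BinaryTree Unit)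
  | .nil => PMF.pure (.node () .nil .nil)
  | .node _ l r => coin.bind fun bit =>
      if bit then (insertRandom r).map fun r' => .node () l r'
      else (insertRandom l).map fun l' => .node () l' r

/-- The random digital search tree built from `n` data, inserted one after the other. -/
def randomTree : ℕ → PMF (BinaryTree Unit)
  | 0 => PMF.pure .nil
  | n + 1 => (randomTree n).bind insertRandom

/-- The distance from the root of a tree to the nearest leaf (a node without children);
it is `⊤` for the empty tree, which has no leaf. -/
def leafDist : BinaryTree Unit → ℕ∞
  | .nil => ⊤
  | .node _ l r => if l = .nil ∧ r = .nil then 0 else 1 + min (leafDist l) (leafDist r)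

/-- The number of 2-protected nodes: those at distance at least 2 from every leaf. (A neighbour of
a node that is a leaf is one of its children, so only leaves below the node matter.) -/
def protectedCount : BinaryTree Unit → ℕ
  | .nil => 0
  | .node v l r =>
      (if 2 ≤ leafDist (.node v l r) then 1 else 0) + protectedCount l + protectedCount r

/-- `l_N`, the average number of 2-protected nodes in a random digital search tree of size `N`. -/
def averageProtected (N : ℕ) : ℝ :=
  (∑' t : BinaryTree Unit, randomTree N t * (protectedCount t : ENNReal)).toReal

/-! ### The `q`-series quantities, for `q = 1/2` -/

/-- `Q_m = ∏_{k=1}^m (1 - 2^{-k})`. -/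
def Q (m : ℕ) : ℝ := ∏ k ∈ Finset.Icc 1 m, (1 - 1 / 2 ^ k)

/-- `Q_∞ = ∏_{k ≥ 1} (1 - 2^{-k})`. -/
def QInf : ℝ := ∏' k : ℕ, (1 - 1 / 2 ^ (k + 1))

/-- `Q(x) = ∏_{k ≥ 1} (1 - x 2^{-k})`. -/
def QFun (x : ℂ) : ℂ := ∏' k : ℕ, (1 - x / 2 ^ (k + 1))

/-- `eulerCoeff m` is `a_{m+1} = (-1)^m 2^{-binom(m+1,2)} / Q_m`, the coefficient of `x^m`
in `Q(x)`. -/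
def eulerCoeff (m : ℕ) : ℝ := (-1) ^ m / (2 ^ ((m + 1).choose 2) * Q m)

/-- The numerator `B(x)` of the numbers `b_m`. -/
def B (x : ℝ) : ℝ :=
  16 * Real.log 2 - 48 * x * Real.log 2 + 48 * x ^ 2 * Real.log 2 - 16 * x ^ 3 * Real.log 2
    - 20 + 60 * x - 69 * x ^ 2 + 36 * x ^ 3 - 7 * x ^ 4
    - 8 * x * Real.log x + 12 * x ^ 2 * Real.log x - 10 * x ^ 3 * Real.log x
    + 4 * x ^ 4 * Real.log x

/-- The numbers `b_m`. -/
def b (m : ℕ) : ℝ :=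
  if m = 0 then 37 / (12 * Real.log 2) - 4
  else 1 / (4 * Real.log 2) *
    (B ((1 / 2) ^ m) / (((1 / 2) ^ m - 1) ^ 3 * ((1 / 2) ^ m - 2) ^ 2))

/-- The constant `(1 / Q_∞) ∑_{m ≥ 0} a_{m+1} b_m`. -/
def leadingConstant : ℝ := 1 / QInf * ∑' m : ℕ, eulerCoeff m * b m

/-! ### The extension of the inner sums to complex arguments -/

/-- Closed form of `∑_{n=1}^M w^n` for `w = 2^{-j}`, with `M` complex. -/
def geom0 (j : ℕ) (M : ℂ) : ℂ :=
  if j = 0 then M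
  else
    let w : ℂ := (1 / 2) ^ j
    let r : ℂ := 2 ^ (-(j * M))
    w * (1 - r) / (1 - w)

/-- Closed form of `∑_{n=1}^M (n+1) w^n` for `w = 2^{-j}`, with `M` complex. -/
def geom1 (j : ℕ) (M : ℂ) : ℂ :=
  if j = 0 then M * (M + 3) / 2
  else
    let w : ℂ := (1 / 2) ^ j
    let r : ℂ := 2 ^ (-(j * M))
    (2 * w - (M + 2) * w * r) / (1 - w) + w ^ 2 * (1 - r) / (1 - w) ^ 2

/-- Closed form of `∑_{n=1}^M n(n+1) w^n` for `w = 2^{-j}`, with `M` complex. -/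
def geom2 (j : ℕ) (M : ℂ) : ℂ :=
  if j = 0 then M * (M + 1) * (M + 2) / 3
  else
    let w : ℂ := (1 / 2) ^ j
    let r : ℂ := 2 ^ (-(j * M))
    w * ((2 - (M + 2) * (M + 1) * r) / (1 - w) + 2 * (2 * w - (M + 2) * w * r) / (1 - w) ^ 2
      + 2 * w ^ 2 * (1 - r) / (1 - w) ^ 3)

/-- `S_m(z)`, the extension to complex `z` of
`∑_{n=1}^{z-2} (1 - (n+1) 2^{-n} - n(n+1)/4) 2^{-nm}`. -/
def innerSum (m : ℕ) (z : ℂ) : ℂ :=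
  geom0 m (z - 2) - geom1 (m + 1) (z - 2) - geom2 m (z - 2) / 4

/-- `ψ(z)`, the extension to complex `z` of
`Q_{z-2} ∑_{n=1}^{z-2} (1 - (n+1) 2^{-n} - n(n+1)/4) / Q_n`, obtained from
`Q_{z-2} = Q_∞ / Q(2^{2-z})` and `1 / Q_n = (1 / Q_∞) ∑_{m ≥ 0} a_{m+1} 2^{-nm}`. -/
def psi (z : ℂ) : ℂ :=
  (QInf : ℂ) / QFun (2 ^ (2 - z)) *
    (1 / (QInf : ℂ) * ∑' m : ℕ, (eulerCoeff m : ℂ) * innerSum m z)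

/-- The points `χ_k = 2πik / log 2`. -/
def chi (k : ℤ) : ℂ := 2 * Real.pi * Complex.I * k / Real.log 2

private lemma two_cpow_neg (j M : ℕ) : (2 : ℂ) ^ (-((j : ℂ) * (M : ℂ))) = ((1 / 2) ^ j) ^ M := by
  rw [Complex.cpow_neg, ← Nat.cast_mul, Complex.cpow_natCast, pow_mul]
  simp

private lemma one_sub_ne (j : ℕ) (hj : j ≠ 0) : (1 : ℂ) - (1 / 2) ^ j ≠ 0 := by
  intro h
  have h1 : ((1 / 2 : ℂ)) ^ j = 1 := (sub_eq_zero.mp h).symm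
  have h2 : ‖((1 / 2 : ℂ)) ^ j‖ = 1 := by rw [h1]; simp
  rw [norm_pow] at h2
  have h3 : ‖(1 / 2 : ℂ)‖ = 1 / 2 := by norm_num
  rw [h3] at h2
  have := pow_lt_one₀ (by norm_num : (0 : ℝ) ≤ 1 / 2) (by norm_num) hj
  linarith

private lemma geom0_natCast (j M : ℕ) :
    geom0 j M = ∑ n ∈ Finset.Icc 1 M, (((1 / 2 : ℂ)) ^ j) ^ n := by
  unfold geom0
  split_ifs with h
  · simp [h]
  · have hw := one_sub_ne j h
    simp only [two_cpow_neg]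
    generalize ((1 / 2 : ℂ)) ^ j = w at *
    induction M with
    | zero => simp
    | succ M ih =>
      rw [Finset.sum_Icc_succ_top (by omega), ← ih]
      field_simp
      ring

private lemma geom1_natCast (j M : ℕ) :
    geom1 j M = ∑ n ∈ Finset.Icc 1 M, ((n : ℂ) + 1) * (((1 / 2 : ℂ)) ^ j) ^ n := by
  unfold geom1
  split_ifs with h
  · subst h
    induction M with
    | zero => simp
    | succ M ih =>
      rw [Finset.sum_Icc_succ_top (by omega), ← ih]
      push_cast
      simp
      ring
  · have hw := one_sub_ne j h
    simp only [two_cpow_neg]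
    generalize ((1 / 2 : ℂ)) ^ j = w at *
    induction M with
    | zero => simp
    | succ M ih =>
      rw [Finset.sum_Icc_succ_top (by omega), ← ih]
      push_cast
      field_simp
      ring

private lemma geom2_natCast (j M : ℕ) :
    geom2 j M = ∑ n ∈ Finset.Icc 1 M, (n : ℂ) * (n + 1) * (((1 / 2 : ℂ)) ^ j) ^ n := by
  unfold geom2
  split_ifs with h
  · subst h
    induction M with
    | zero => simp
    | succ M ih =>
      rw [Finset.sum_Icc_succ_top (by omega), ← ih]
      push_cast
      simp
      ring
  · have hw := one_sub_ne j h
    simp only [two_cpow_neg]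
    generalize ((1 / 2 : ℂ)) ^ j = w at *
    induction M with
    | zero => simp
    | succ M ih =>
      rw [Finset.sum_Icc_succ_top (by omega), ← ih]
      push_cast
      field_simp
      ring

/-- `innerSum` does extend the finite sums. -/
theorem innerSum_natCast (m M : ℕ) :
    innerSum m ((M : ℂ) + 2) = ∑ n ∈ Finset.Icc 1 M,
      (1 - ((n : ℂ) + 1) * (1 / 2) ^ n - (n : ℂ) * (n + 1) / 4) * ((1 / 2) ^ m) ^ n := by
  unfold innerSum
  rw [add_sub_cancel_right, geom0_natCast, geom1_natCast, geom2_natCast, Finset.sum_div,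
    ← Finset.sum_sub_distrib, ← Finset.sum_sub_distrib]
  refine Finset.sum_congr rfl fun n _ => ?_
  rw [pow_succ, mul_pow]
  ring

end DST

end

/-! The subtree sizes of a random tree are binomial, and whether the root is 2-protected depends
only on these sizes. Hence l_{n+1} = 2·2^{-n} ∑ binom(n,i) l_i + P(root protected). Writing l_N = ∑
binom(N,k) (-1)^k t_k turns this into a first-order recursion for t, with factor 1 - 2^{1-k}, solved
by t_{M+2} = Q_M ∑_{n≤M} weight(n)/Q_n (`averageProtected_eq_binomTr`, `transform_eq_sum`).

No contour integral is used to evaluate the alternating sum. Instead t_k is expanded in powers of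
2^{-k}. Euler's expansion of Q(x) gives 1/Q_n, the companion expansion ∑ x^j/Q_j gives Q_M, and the
geometric sums S_m are polynomials in κ = z - 1 and ρ = 2^{-κ}. So t_k = ∑_n 2^{-n(k-1)}·(cubic in
k), with coefficients that are convolutions with 1/Q_j (`hasSum_transform`). The alternating
transform of y^k times a falling factorial is explicit, so l_N becomes N·`baseConst` plus a sum over
levels n of 2^n times an expression in (1 - 2^{-n})^N (`hasSum_levelTerm`).

Each level is close to `profile` at u = N/2^n, and the errors add up to O(1). Two cancellations are
essential: ∑ `seriesOne` = 0, reflecting S_m(1) = 0, and the equality of the `seriesOne` and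
`seriesLin` sums weighted by 2^n, reflecting Q(2) = 0. Without the second one the error would only
be bounded by O(log N).

Extending the dyadic sum to all integer levels costs O(1) and gives N times a 1-periodic function of
log_2 N. By Poisson summation its Fourier coefficients are values of the Mellin transform of
`profile`, that is, a Gamma factor times a rational function of χ_k. The coefficient of index 0
joins `baseConst` to form the leading constant (`leadingConstant_eq`). The others are the residues
of Γ(-z)ψ(z), because Q(2^{2-z}) = (1 - 2^{1-z}) Q(2^{1-z}) has a simple zero at 1 + χ_k
(`tendsto_residue`). The size of δ comes from |Γ(1-iy)|² = πy/sinh(πy), and the digits of the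
constant from rational partial sums with rapidly decaying tails. -/

noncomputable section

namespace DST

/-! ### Expectations over random digital search trees -/

/-- The expectation of a nonnegative function of a random element. -/
def expect {α : Type*} (p : PMF α) (F : α → ENNReal) : ENNReal := ∑' t, p t * F t

lemma expect_pure {α : Type*} (a : α) (F : α → ENNReal) : expect (PMF.pure a) F = F a := by
  classical
  rw [expect, tsum_eq_single a]
  · simp [PMF.pure_apply]
  · intro b hb
    simp [PMF.pure_apply, hb]

lemma expect_bind {α β : Type*} (p : PMF α) (f : α → PMF β) (F : β → ENNReal) :
    expect (p.bind f) F = expect p fun a => expect (f a) F := by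
  simp only [expect, PMF.bind_apply, ← ENNReal.tsum_mul_right, ← ENNReal.tsum_mul_left]
  rw [ENNReal.tsum_comm]
  simp only [mul_assoc]

lemma expect_map {α β : Type*} (p : PMF α) (f : α → β) (F : β → ENNReal) :
    expect (p.map f) F = expect p fun a => F (f a) := by
  rw [PMF.map, expect_bind]
  simp only [Function.comp, expect_pure]

lemma expect_add {α : Type*} (p : PMF α) (F G : α → ENNReal) :
    (expect p fun a => F a + G a) = expect p F + expect p G := by
  simp only [expect, mul_add, ENNReal.tsum_add]

lemma expect_const_mul {α : Type*} (p : PMF α) (c : ENNReal) (F : α → ENNReal) :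
    (expect p fun a => c * F a) = c * expect p F := by
  simp only [expect, ← ENNReal.tsum_mul_left, mul_left_comm]

lemma expect_const {α : Type*} (p : PMF α) (c : ENNReal) : (expect p fun _ => c) = c := by
  simp only [expect, ENNReal.tsum_mul_right, PMF.tsum_coe, one_mul]

lemma expect_comm {α β : Type*} (p : PMF α) (q : PMF β) (F : α → β → ENNReal) :
    (expect p fun a => expect q fun b => F a b) = expect q fun b => expect p fun a => F a b := by
  simp only [expect, ← ENNReal.tsum_mul_left]
  rw [ENNReal.tsum_comm]
  simp only [mul_left_comm]

lemma expect_congr {α : Type*} (p : PMF α) {F G : α → ENNReal}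
    (h : ∀ a, p a ≠ 0 → F a = G a) : expect p F = expect p G := by
  refine tsum_congr fun a => ?_
  by_cases ha : p a = 0
  · simp [ha]
  · rw [h a ha]

lemma expect_coin (F : Bool → ENNReal) : expect coin F = 2⁻¹ * (F true + F false) := by
  simp [expect, coin, mul_add]

/-- The expectation of a function of a tree whose subtrees are independent random trees. -/
def expectNode (i j : ℕ) (F : BinaryTree Unit → ENNReal) : ENNReal :=
  expect (randomTree i) fun l => expect (randomTree j) fun r => F (.node () l r)

lemma expect_insertRandom_node (l r : BinaryTree Unit) (F : BinaryTree Unit → ENNReal) :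
    expect (insertRandom (.node () l r)) F =
      2⁻¹ * ((expect (insertRandom r) fun r' => F (.node () l r')) +
        expect (insertRandom l) fun l' => F (.node () l' r)) := by
  rw [insertRandom, expect_bind, expect_coin]
  simp [expect_map]

lemma expect_randomTree_succ (n : ℕ) (F : BinaryTree Unit → ENNReal) :
    expect (randomTree (n + 1)) F =
      expect (randomTree n) fun t => expect (insertRandom t) F := by
  rw [randomTree, expect_bind]

lemma expectNode_insertRandom (i j : ℕ) (F : BinaryTree Unit → ENNReal) :
    (expectNode i j fun t => expect (insertRandom t) F) =
      2⁻¹ * (expectNode i (j + 1) F + expectNode (i + 1) j F) := by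
  simp only [expectNode, expect_insertRandom_node, expect_const_mul, expect_add]
  congr 2
  · simp only [expect_randomTree_succ j]
  · rw [expect_comm, expect_comm (randomTree (i + 1))]
    simp only [expect_randomTree_succ i]

/-- The subtree sizes of a random digital search tree are binomially distributed, and given their
sizes the subtrees are independent random digital search trees. -/
lemma expect_randomTree_eq_sum (n : ℕ) (F : BinaryTree Unit → ENNReal) :
    expect (randomTree (n + 1)) F =
      2⁻¹ ^ n * ∑ ij ∈ Finset.HasAntidiagonal.antidiagonal n, (n.choose ij.1 : ENNReal) *
        expectNode ij.1 ij.2 F := by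
  induction n generalizing F with
  | zero => simp [expectNode, randomTree, expect_pure, insertRandom]
  | succ n ih =>
    -- Pascal's rule: the new datum goes to the left or to the right subtree with probability 1/2
    -- each, which supplies the extra factor 2⁻¹.
    rw [expect_randomTree_succ, ih, Finset.sum_antidiagonal_choose_succ_mul
      (fun i j => expectNode i j F), pow_succ, mul_assoc]
    congr 1
    rw [← Finset.sum_add_distrib, Finset.mul_sum]
    refine Finset.sum_congr rfl fun ij hij => ?_
    rw [expectNode_insertRandom,
      Nat.choose_symm_of_eq_add (Finset.HasAntidiagonal.mem_antidiagonal.mp hij).symm]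
    ring

/-! ### Tree sizes and the recursion for the average -/

lemma numNodes_of_insertRandom_ne_zero (t s : BinaryTree Unit) (h : insertRandom t s ≠ 0) :
    s.numNodes = t.numNodes + 1 := by
  induction t generalizing s with
  | nil =>
    rw [insertRandom, ← PMF.mem_support_iff] at h
    simp at h
    simp [h, BinaryTree.numNodes]
  | node v l r ihl ihr =>
    rw [insertRandom, ← PMF.mem_support_iff, PMF.mem_support_bind_iff] at h
    obtain ⟨bit, -, h⟩ := h
    cases bit
    · simp only [Bool.false_eq_true, if_false, PMF.mem_support_map_iff] at h
      obtain ⟨l', hl, rfl⟩ := h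
      simp only [BinaryTree.numNodes, ihl l' hl]
      omega
    · simp only [if_true, PMF.mem_support_map_iff] at h
      obtain ⟨r', hr, rfl⟩ := h
      simp only [BinaryTree.numNodes, ihr r' hr]
      omega

lemma numNodes_of_randomTree_ne_zero (n : ℕ) (t : BinaryTree Unit) (h : randomTree n t ≠ 0) :
    t.numNodes = n := by
  induction n generalizing t with
  | zero =>
    rw [randomTree, ← PMF.mem_support_iff] at h
    simp at h
    simp [h, BinaryTree.numNodes]
  | succ n ih =>
    rw [randomTree, ← PMF.mem_support_iff, PMF.mem_support_bind_iff] at h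
    obtain ⟨s, hs, h⟩ := h
    rw [numNodes_of_insertRandom_ne_zero s t h, ih s hs]

lemma numNodes_eq_zero_iff (t : BinaryTree Unit) : t.numNodes = 0 ↔ t = .nil := by
  cases t <;> simp [BinaryTree.numNodes]

lemma leafDist_eq_zero_iff (t : BinaryTree Unit) : leafDist t = 0 ↔ t.numNodes = 1 := by
  cases t with
  | nil => simp [leafDist, BinaryTree.numNodes]
  | node v l r =>
    simp only [leafDist, BinaryTree.numNodes, ← numNodes_eq_zero_iff]
    split_ifs with h
    · simp [h]
    · simp
      omega

lemma two_le_one_add_min_iff (a b : ℕ∞) : 2 ≤ 1 + min a b ↔ a ≠ 0 ∧ b ≠ 0 := by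
  rw [← one_add_one_eq_two, ENat.add_le_add_iff_left (by simp), le_min_iff, Order.one_le_iff_ne_zero,
    Order.one_le_iff_ne_zero]

/-- Whether the root of a tree with subtree sizes `i` and `j` is 2-protected. -/
def rootProtected (i j : ℕ) : ℕ := if (i = 0 ∧ j = 0) ∨ i = 1 ∨ j = 1 then 0 else 1

/-- The root fails to be 2-protected exactly when it or one of its children is a leaf, and a tree's
root is a leaf iff the tree has one node. Thus the toll depends on the subtree sizes alone, which
makes the recursion for the expectation close. -/
lemma protectedCount_node (l r : BinaryTree Unit) :
    protectedCount (.node () l r) =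
      rootProtected l.numNodes r.numNodes + protectedCount l + protectedCount r := by
  rw [protectedCount]
  congr 2
  simp only [leafDist, rootProtected, ← leafDist_eq_zero_iff l, ← leafDist_eq_zero_iff r,
    numNodes_eq_zero_iff]
  split_ifs with h1 h2 h3 h4 h5 <;> simp_all [two_le_one_add_min_iff]

lemma protectedCount_le_numNodes (t : BinaryTree Unit) : protectedCount t ≤ t.numNodes := by
  induction t with
  | nil => simp [protectedCount]
  | node v l r ihl ihr =>
    simp only [protectedCount, BinaryTree.numNodes]
    split_ifs <;> omega

/-- The expected number of 2-protected nodes as an extended nonnegative real. -/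
def expectedProtected (n : ℕ) : ENNReal :=
  expect (randomTree n) fun t => (protectedCount t : ENNReal)

lemma averageProtected_eq (n : ℕ) : averageProtected n = (expectedProtected n).toReal := rfl

lemma expectedProtected_ne_top (n : ℕ) : expectedProtected n ≠ ⊤ := by
  have h : expectedProtected n ≤ n := by
    rw [← expect_const (randomTree n) (n : ENNReal)]
    refine ENNReal.tsum_le_tsum fun t => ?_
    by_cases ht : randomTree n t = 0
    · simp [ht]
    · gcongr
      rw [← numNodes_of_randomTree_ne_zero n t ht]
      show (protectedCount t : ENNReal) ≤ (t.numNodes : ENNReal)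
      exact_mod_cast protectedCount_le_numNodes t
  exact ne_top_of_le_ne_top (by simp) h

lemma expectNode_protectedCount (i j : ℕ) :
    (expectNode i j fun t => (protectedCount t : ENNReal)) =
      rootProtected i j + expectedProtected i + expectedProtected j := by
  have h : (expectNode i j fun t => (protectedCount t : ENNReal)) =
      expect (randomTree i) fun l => expect (randomTree j) fun r =>
        ((rootProtected i j : ENNReal) + protectedCount l + protectedCount r) := by
    refine expect_congr _ fun l hl => expect_congr _ fun r hr => ?_
    beta_reduce
    rw [protectedCount_node, numNodes_of_randomTree_ne_zero i l hl,
      numNodes_of_randomTree_ne_zero j r hr]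
    push_cast
    rfl
  rw [h]
  simp only [expect_add, expect_const]
  rfl

lemma averageProtected_zero : averageProtected 0 = 0 := by
  simp [averageProtected_eq, expectedProtected, randomTree, expect_pure, protectedCount]

lemma averageProtected_succ (n : ℕ) :
    averageProtected (n + 1) =
      (1 / 2) ^ n * ∑ ij ∈ Finset.HasAntidiagonal.antidiagonal n, (n.choose ij.1 : ℝ) *
      (rootProtected ij.1 ij.2 + averageProtected ij.1 + averageProtected ij.2) := by
  rw [averageProtected_eq, expectedProtected, expect_randomTree_eq_sum, ENNReal.toReal_mul,
    ENNReal.toReal_sum]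
  · congr 1
    · simp
    · refine Finset.sum_congr rfl fun ij _ => ?_
      rw [expectNode_protectedCount, ENNReal.toReal_mul, ENNReal.toReal_add, ENNReal.toReal_add]
      · simp [averageProtected_eq]
      all_goals simp [expectedProtected_ne_top]
  · intro ij _
    rw [expectNode_protectedCount]
    simp [ENNReal.mul_eq_top, expectedProtected_ne_top]

/-! ### The alternating binomial transform -/

/-- `binomTr a u N = ∑ k, binom(N, k) a^(N-k) (-1)^k u k`, given by its recursion in `N`. -/
def binomTr (a : ℝ) : (ℕ → ℝ) → ℕ → ℝ
  | u, 0 => u 0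
  | u, N + 1 => a * binomTr a u N - binomTr a (fun k => u (k + 1)) N

lemma binomTr_add (a : ℝ) (u v : ℕ → ℝ) (N : ℕ) :
    binomTr a (fun k => u k + v k) N = binomTr a u N + binomTr a v N := by
  induction N generalizing u v with
  | zero => rfl
  | succ N ih =>
    simp only [binomTr, ih]
    ring

lemma binomTr_const_mul (a c : ℝ) (u : ℕ → ℝ) (N : ℕ) :
    binomTr a (fun k => c * u k) N = c * binomTr a u N := by
  induction N generalizing u with
  | zero => rfl
  | succ N ih =>
    simp only [binomTr, ih]
    ring

lemma binomTr_sub (a : ℝ) (u v : ℕ → ℝ) (N : ℕ) :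
    binomTr a (fun k => u k - v k) N = binomTr a u N - binomTr a v N := by
  have h : (fun k => u k - v k) = fun k => u k + (-1) * v k := by
    funext k
    ring
  rw [h, binomTr_add, binomTr_const_mul]
  ring

lemma hasSum_binomTr (a : ℝ) {v : ℕ → ℕ → ℝ} {u : ℕ → ℝ}
    (h : ∀ k, HasSum (fun n => v n k) (u k)) (N : ℕ) :
    HasSum (fun n => binomTr a (v n) N) (binomTr a u N) := by
  induction N generalizing u v with
  | zero => exact h 0
  | succ N ih => exact ((ih h).mul_left a).sub (ih fun k => h (k + 1))

/-- The weights 2^{N-k} of the transform with a = 2, divided by 2^N, are 2^{-k}. With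
`sum_choose_mul_binomTr`, binomial averaging of l therefore becomes multiplication of its transform
by 2^{-k}. -/
lemma binomTr_two (u : ℕ → ℝ) (N : ℕ) :
    (1 / 2) ^ N * binomTr 2 u N = binomTr 1 (fun k => (1 / 2) ^ k * u k) N := by
  induction N generalizing u with
  | zero => simp [binomTr]
  | succ N ih =>
    have h : (fun k => (1 / 2 : ℝ) ^ (k + 1) * u (k + 1)) =
        fun k => 1 / 2 * ((1 / 2) ^ k * u (k + 1)) := by
      funext k
      ring
    simp only [binomTr]
    rw [h, binomTr_const_mul, ← ih, ← ih fun k => u (k + 1)]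
    ring

lemma sum_choose_mul_binomTr (u : ℕ → ℝ) (N : ℕ) :
    ∑ ij ∈ Finset.HasAntidiagonal.antidiagonal N, (N.choose ij.1 : ℝ) * binomTr 1 u ij.1 =
      binomTr 2 u N := by
  induction N generalizing u with
  | zero => simp [binomTr]
  | succ N ih =>
    rw [Finset.sum_antidiagonal_choose_succ_mul (fun i _ => binomTr 1 u i), binomTr, ← ih,
      ← ih fun k => u (k + 1), Finset.mul_sum, ← Finset.sum_sub_distrib, ← Finset.sum_add_distrib]
    refine Finset.sum_congr rfl fun ij hij => ?_
    rw [← Nat.choose_symm_of_eq_add (Finset.HasAntidiagonal.mem_antidiagonal.mp hij).symm, binomTr]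
    ring

lemma binomTr_pow (y : ℝ) (N : ℕ) : binomTr 1 (fun k => y ^ k) N = (1 - y) ^ N := by
  induction N with
  | zero => simp [binomTr]
  | succ N ih =>
    have h : (fun k => y ^ (k + 1)) = fun k => y * y ^ k := by
      funext k
      ring
    rw [binomTr, h, binomTr_const_mul, ih]
    ring

lemma binomTr_mul_pow (y : ℝ) (N : ℕ) :
    binomTr 1 (fun k => k * y ^ k) N = -(N * y * (1 - y) ^ (N - 1)) := by
  induction N with
  | zero => simp [binomTr]
  | succ N ih =>
    have h : (fun k : ℕ => ((k + 1 : ℕ) : ℝ) * y ^ (k + 1)) =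
        fun k : ℕ => y * (k * y ^ k) + y * y ^ k := by
      funext k
      push_cast
      ring
    rw [binomTr, h, binomTr_add, binomTr_const_mul, binomTr_const_mul, binomTr_pow, ih]
    rcases N with _ | N
    · simp
    · push_cast [Nat.add_sub_cancel]
      ring

lemma binomTr_mul_mul_pow (y : ℝ) (N : ℕ) :
    binomTr 1 (fun k => k * (k - 1) * y ^ k) N = N * (N - 1) * y ^ 2 * (1 - y) ^ (N - 2) := by
  induction N with
  | zero => simp [binomTr]
  | succ N ih =>
    have h : (fun k : ℕ => ((k + 1 : ℕ) : ℝ) * ((k + 1 : ℕ) - 1) * y ^ (k + 1)) =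
        fun k : ℕ => y * (k * (k - 1) * y ^ k) + (2 * y) * (k * y ^ k) := by
      funext k
      push_cast
      ring
    rw [binomTr, h, binomTr_add, binomTr_const_mul, binomTr_const_mul, binomTr_mul_pow, ih]
    rcases N with _ | _ | N
    · simp
    · norm_num
      ring
    · push_cast [Nat.add_sub_cancel]
      ring

lemma binomTr_mul_mul_mul_pow (y : ℝ) (N : ℕ) :
    binomTr 1 (fun k => k * (k - 1) * (k - 2) * y ^ k) N =
      -(N * (N - 1) * (N - 2) * y ^ 3 * (1 - y) ^ (N - 3)) := by
  induction N with
  | zero => simp [binomTr]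
  | succ N ih =>
    have h : (fun k : ℕ => ((k + 1 : ℕ) : ℝ) * ((k + 1 : ℕ) - 1) * ((k + 1 : ℕ) - 2) *
        y ^ (k + 1)) =
        fun k : ℕ => y * (k * (k - 1) * (k - 2) * y ^ k) + (3 * y) * (k * (k - 1) * y ^ k) := by
      funext k
      push_cast
      ring
    rw [binomTr, h, binomTr_add, binomTr_const_mul, binomTr_const_mul, binomTr_mul_mul_pow, ih]
    rcases N with _ | _ | _ | N
    · simp
    · norm_num
    · norm_num
      ring
    · push_cast [Nat.add_sub_cancel]
      ring

lemma binomTr_zero_fun (N : ℕ) : binomTr 1 (fun _ => 0) N = 0 := by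
  have := binomTr_const_mul 1 0 (fun _ => 0) N
  simpa using this

lemma binomTr_indicator_zero (N : ℕ) :
    binomTr 1 (fun k => if k = 0 then 1 else 0) N = 1 := by
  induction N with
  | zero => simp [binomTr]
  | succ N ih => simp [binomTr, ih, binomTr_zero_fun]

lemma binomTr_indicator_one (N : ℕ) :
    binomTr 1 (fun k => if k = 1 then 1 else 0) N = -N := by
  induction N with
  | zero => simp [binomTr]
  | succ N ih =>
    simp [binomTr, ih, binomTr_indicator_zero]
    ring

/-! ### The transform of the average number of 2-protected nodes -/

/-- The probability that the root of a random tree of size `n + 1` is 2-protected. -/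
def rootProb (n : ℕ) : ℝ := (1 / 2) ^ n *
  ∑ ij ∈ Finset.HasAntidiagonal.antidiagonal n, (n.choose ij.1 : ℝ) * rootProtected ij.1 ij.2

lemma averageProtected_succ_eq (n : ℕ) :
    averageProtected (n + 1) = 2 * ((1 / 2) ^ n *
      ∑ ij ∈ Finset.HasAntidiagonal.antidiagonal n, (n.choose ij.1 : ℝ) * averageProtected ij.1) +
      rootProb n := by
  have h : ∑ ij ∈ Finset.HasAntidiagonal.antidiagonal n,
      (n.choose ij.1 : ℝ) * averageProtected ij.2 =
      ∑ ij ∈ Finset.HasAntidiagonal.antidiagonal n,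
        (n.choose ij.1 : ℝ) * averageProtected ij.1 := by
    rw [← Finset.Nat.sum_antidiagonal_swap]
    refine Finset.sum_congr rfl fun ij hij => ?_
    rw [Prod.fst_swap, Prod.snd_swap,
      Nat.choose_symm_of_eq_add (Finset.HasAntidiagonal.mem_antidiagonal.mp hij).symm]
  rw [averageProtected_succ, rootProb]
  simp only [mul_add, Finset.sum_add_distrib]
  rw [h]
  ring

/-- Only the size pairs (1, n+2) and (n+2, 1) contribute a failure, each with weight n+3. They are
distinct because the total is at least 3; smaller totals are exceptional and are treated separately
in `binomTr_source`. -/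
lemma sum_choose_rootProtected (n : ℕ) :
    ∑ ij ∈ Finset.HasAntidiagonal.antidiagonal (n + 3),
      ((n + 3).choose ij.1 : ℝ) * rootProtected ij.1 ij.2 = 2 ^ (n + 3) - 2 * (n + 3) := by
  have h : ∀ ij ∈ Finset.HasAntidiagonal.antidiagonal (n + 3),
      ((n + 3).choose ij.1 : ℝ) * rootProtected ij.1 ij.2 =
        ((n + 3).choose ij.1 : ℝ) - (if ij = (1, n + 2) then ((n + 3 : ℕ) : ℝ) else 0)
          - (if ij = (n + 2, 1) then ((n + 3 : ℕ) : ℝ) else 0) := by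
    rintro ⟨i, j⟩ hij
    rw [Finset.HasAntidiagonal.mem_antidiagonal] at hij
    simp only [Prod.mk.injEq, rootProtected] at hij ⊢
    by_cases h1 : i = 1
    · obtain rfl : j = n + 2 := by omega
      subst h1
      simp
    by_cases h2 : j = 1
    · obtain rfl : i = n + 2 := by omega
      subst h2
      rw [Nat.choose_symm_of_eq_add (show n + 3 = n + 2 + 1 by omega)]
      simp
    · simp [h1, h2]
      omega
  rw [Finset.sum_congr rfl h, Finset.sum_sub_distrib, Finset.sum_sub_distrib,
    Finset.sum_ite_eq', Finset.sum_ite_eq', if_pos, if_pos]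
  · rw [Finset.Nat.sum_antidiagonal_eq_sum_range_succ_mk]
    have := Nat.sum_range_choose (n + 3)
    have h2 : ∑ k ∈ Finset.range (n + 3).succ, ((n + 3).choose k : ℝ) = 2 ^ (n + 3) := by
      exact_mod_cast this
    rw [h2]
    push_cast
    ring
  · simp
  · simp
    omega

/-- The inhomogeneity of the recursion for the transform. -/
def source (k : ℕ) : ℝ :=
  1 - (if k = 0 then 1 else 0) - k * 2 * (1 / 2) ^ k - k * (k - 1) / 4

/-- The summands of `source` are chosen for this. The constant 1 transforms to 0^n, the indicator of
0 to 1, and the term 2k·2^{-k} yields the failure probability 2n/2^n. The term k(k-1)/4 transforms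
to a quantity that vanishes unless n = 2, where the two failure events coincide in the size pair (1,
1). -/
lemma binomTr_source (n : ℕ) : binomTr 1 source n = -rootProb n := by
  have h : source = fun k : ℕ => ((1 : ℝ) ^ k - (if k = 0 then 1 else 0)) -
      (2 * (k * (1 / 2) ^ k) + 1 / 4 * (k * (k - 1) * 1 ^ k)) := by
    funext k
    simp only [source, one_pow]
    ring
  rw [h, binomTr_sub, binomTr_sub, binomTr_add, binomTr_const_mul, binomTr_const_mul, binomTr_pow,
    binomTr_indicator_zero, binomTr_mul_pow, binomTr_mul_mul_pow]
  rcases n with _ | _ | _ | n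
  · simp [rootProb, rootProtected]
  · norm_num [rootProb, rootProtected, Finset.Nat.antidiagonal_succ]
  · norm_num [rootProb, rootProtected, Finset.Nat.antidiagonal_succ]
  · rw [rootProb, sum_choose_rootProtected]
    have h2 : (1 / 2 : ℝ) ^ (n + 3) * 2 ^ (n + 3) = 1 := by
      rw [← mul_pow]
      norm_num
    rw [show n + 1 + 1 + 1 - 1 = n + 2 by omega, show n + 1 + 1 + 1 - 2 = n + 1 by omega,
      show n + 1 + 1 + 1 = n + 3 by omega]
    push_cast
    norm_num
    linear_combination h2

/-- The alternating binomial transform of the average number of 2-protected nodes. -/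
def transform : ℕ → ℝ
  | 0 => 0
  | k + 1 => (1 - 2 * (1 / 2) ^ k) * transform k + source k

/-- Since the transform of t at n+1 is that of t minus that of the shifted t at n, substituting the
recursion of t leaves twice the transform of 2^{-k} t_k plus `rootProb`, which is the recursion for
the average. -/
theorem averageProtected_eq_binomTr (N : ℕ) : averageProtected N = binomTr 1 transform N := by
  induction N using Nat.strong_induction_on with
  | _ N ih =>
    rcases N with _ | n
    · simp [averageProtected_zero, binomTr, transform]
    · have h : (fun k => transform (k + 1)) = fun k =>
          (transform k - 2 * ((1 / 2) ^ k * transform k)) + source k := by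
        funext k
        rw [transform]
        ring
      rw [averageProtected_succ_eq, binomTr, h, binomTr_add, binomTr_sub, binomTr_const_mul,
        ← binomTr_two, ← sum_choose_mul_binomTr, binomTr_source,
        Finset.sum_congr rfl fun ij hij => by
          rw [ih ij.1 (by have := Finset.HasAntidiagonal.mem_antidiagonal.mp hij; omega)]]
      ring

/-! ### Sequences decaying faster than every geometric sequence -/

/-- `W` decays faster than every geometric sequence. -/
def Fast (W : ℕ → ℝ) : Prop := ∀ r : ℝ, Summable fun n => W n * r ^ n

lemma Fast.summable {W : ℕ → ℝ} (h : Fast W) : Summable W := by simpa using h 1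

lemma Fast.norm {W : ℕ → ℝ} (h : Fast W) (r : ℝ) : Summable fun n => |W n| * r ^ n := by
  refine Summable.of_norm ?_
  have := (h r).norm
  simpa [norm_mul] using this

lemma Fast.add {V W : ℕ → ℝ} (hV : Fast V) (hW : Fast W) : Fast fun n => V n + W n := by
  intro r
  simpa [add_mul] using (hV r).add (hW r)

lemma Fast.mul_of_bounded {W c : ℕ → ℝ} (h : Fast W) (K : ℝ) (hc : ∀ n, |c n| ≤ K) :
    Fast fun n => W n * c n := by
  intro r
  refine Summable.of_norm_bounded ((h.norm |r|).mul_left K) fun n => ?_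
  rw [Real.norm_eq_abs, abs_mul, abs_mul, abs_pow]
  have : 0 ≤ |W n| * |r| ^ n := by positivity
  calc |W n| * |c n| * |r| ^ n = |c n| * (|W n| * |r| ^ n) := by ring
    _ ≤ K * (|W n| * |r| ^ n) := mul_le_mul_of_nonneg_right (hc n) this

lemma Fast.of_succ {W : ℕ → ℝ} (h : Fast fun n => W (n + 1)) : Fast W := by
  intro r
  rw [← summable_nat_add_iff 1]
  have := (h r).mul_left r
  refine this.congr fun n => ?_
  ring

lemma fast_single (c : ℝ) : Fast fun n => if n = 0 then c else 0 := by
  intro r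
  refine summable_of_ne_finset_zero (s := {0}) fun n hn => ?_
  simp at hn
  simp [hn]

/-- Prepending a zero to a sequence. -/
def shift (W : ℕ → ℝ) : ℕ → ℝ
  | 0 => 0
  | n + 1 => W n

lemma Fast.shift {W : ℕ → ℝ} (h : Fast W) : Fast (shift W) := Fast.of_succ h

lemma hasSum_shift_mul {W c : ℕ → ℝ} {s : ℝ} (h : HasSum (fun n => W n * c (n + 1)) s) :
    HasSum (fun n => shift W n * c n) s := by
  rw [← hasSum_nat_add_iff' 1]
  simpa [shift] using h

/-! ### Euler's product -/

lemma Q_eq_prod_range (n : ℕ) : Q n = ∏ k ∈ Finset.range n, (1 - 1 / 2 ^ (k + 1)) := by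
  induction n with
  | zero => simp [Q]
  | succ n ih => rw [Finset.prod_range_succ, ← ih, Q, Q, Finset.prod_Icc_succ_top (by omega)]

lemma Q_succ (n : ℕ) : Q (n + 1) = Q n * (1 - 1 / 2 ^ (n + 1)) := by
  rw [Q_eq_prod_range, Finset.prod_range_succ, ← Q_eq_prod_range]

lemma one_sub_inv_two_pow_pos (n : ℕ) : (0 : ℝ) < 1 - 1 / 2 ^ (n + 1) := by
  have : (1 : ℝ) < 2 ^ (n + 1) := one_lt_pow₀ (by norm_num) (by omega)
  rw [sub_pos, div_lt_one (by positivity)]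
  exact this

lemma Q_pos (n : ℕ) : 0 < Q n := by
  rw [Q_eq_prod_range]
  exact Finset.prod_pos fun k _ => one_sub_inv_two_pow_pos k

lemma Q_zero : Q 0 = 1 := by simp [Q]

lemma eulerCoeff_zero : eulerCoeff 0 = 1 := by simp [eulerCoeff, Q_zero]

lemma eulerCoeff_succ (m : ℕ) : eulerCoeff (m + 1) = -eulerCoeff m / (2 ^ (m + 1) - 1) := by
  have h1 : (m + 1 + 1).choose 2 = (m + 1).choose 2 + (m + 1) := by
    rw [Nat.choose_succ_succ' (m + 1) 1]
    simp
    ring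
  have h2 := one_sub_inv_two_pow_pos m
  have h3 : (1 : ℝ) < 2 ^ (m + 1) := one_lt_pow₀ (by norm_num) (by omega)
  have h4 : (2 : ℝ) ^ (m + 1) - 1 ≠ 0 := by linarith
  have h5 := (Q_pos m).ne'
  have h6 : (1 : ℝ) - 1 / 2 ^ (m + 1) = (2 ^ (m + 1) - 1) / 2 ^ (m + 1) := by
    field_simp
  rw [eulerCoeff, eulerCoeff, h1, Q_succ, h6, pow_add, pow_add]
  field_simp

lemma eulerCoeff_one : eulerCoeff 1 = -1 := by
  rw [eulerCoeff_succ, eulerCoeff_zero]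
  norm_num

lemma eulerCoeff_succ_mul (m : ℕ) :
    eulerCoeff (m + 1) * (1 - (1 / 2) ^ (m + 1)) = -eulerCoeff m * (1 / 2) ^ (m + 1) := by
  have h3 : (1 : ℝ) < 2 ^ (m + 1) := one_lt_pow₀ (by norm_num) (by omega)
  have h4 : (2 : ℝ) ^ (m + 1) - 1 ≠ 0 := by linarith
  rw [eulerCoeff_succ, one_div, inv_pow]
  field_simp

lemma fast_eulerCoeff : Fast eulerCoeff := by
  intro r
  refine summable_of_ratio_norm_eventually_le (r := 1 / 2) (by norm_num) ?_
  have h : Tendsto (fun m : ℕ => (2 : ℝ) ^ (m + 1)) atTop atTop :=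
    (tendsto_pow_atTop_atTop_of_one_lt (by norm_num)).comp (tendsto_add_atTop_nat 1)
  filter_upwards [h.eventually_ge_atTop (1 + 2 * |r|), h.eventually_gt_atTop 1] with m hm hm1
  rw [eulerCoeff_succ, norm_mul, norm_mul, norm_div, norm_neg, pow_succ r, norm_mul]
  have h1 : ‖(2 : ℝ) ^ (m + 1) - 1‖ = 2 ^ (m + 1) - 1 := by
    rw [Real.norm_eq_abs, abs_of_pos (by linarith)]
  rw [h1, Real.norm_eq_abs r]
  have h2 : |r| / (2 ^ (m + 1) - 1) ≤ 1 / 2 := by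
    rw [div_le_div_iff₀ (by linarith) (by norm_num)]
    linarith
  calc ‖eulerCoeff m‖ / (2 ^ (m + 1) - 1) * (‖r ^ m‖ * |r|)
      = |r| / (2 ^ (m + 1) - 1) * (‖eulerCoeff m‖ * ‖r ^ m‖) := by ring
    _ ≤ 1 / 2 * (‖eulerCoeff m‖ * ‖r ^ m‖) := mul_le_mul_of_nonneg_right h2 (by positivity)

/-- The power series `∑ a_{m+1} x^m`. -/
def eulerSeries (x : ℂ) : ℂ := ∑' m, (eulerCoeff m : ℂ) * x ^ m

lemma hasSum_eulerSeries (x : ℂ) :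
    HasSum (fun m => (eulerCoeff m : ℂ) * x ^ m) (eulerSeries x) := by
  refine Summable.hasSum (Summable.of_norm ?_)
  simpa using fast_eulerCoeff.norm ‖x‖

lemma continuous_eulerSeries : Continuous eulerSeries := by
  rw [continuous_iff_continuousAt]
  intro x
  have h : ContinuousOn eulerSeries (Metric.ball 0 (‖x‖ + 1)) := by
    refine continuousOn_tsum (u := fun m => |eulerCoeff m| * (‖x‖ + 1) ^ m)
      (fun m => by fun_prop) (fast_eulerCoeff.norm _) fun m y hy => ?_
    rw [mem_ball_zero_iff] at hy
    rw [norm_mul, norm_pow, Complex.norm_real, Real.norm_eq_abs]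
    gcongr
  exact h.continuousAt (Metric.isOpen_ball.mem_nhds (by simp))

lemma eulerSeries_zero : eulerSeries 0 = 1 := by
  rw [eulerSeries, tsum_eq_single 0]
  · simp [eulerCoeff_zero]
  · intro m hm
    simp [hm]

/-- Comparing coefficients reduces this functional equation to a_{m+2}(1 - 2^{-(m+1)}) = -a_{m+1}
2^{-(m+1)}. Its iteration, continuity and the value 1 at 0 produce the infinite product. -/
lemma eulerSeries_half (x : ℂ) : eulerSeries x = (1 - x / 2) * eulerSeries (x / 2) := by
  have h1 := (hasSum_eulerSeries x).sub (hasSum_eulerSeries (x / 2))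
  rw [← hasSum_nat_add_iff' 1] at h1
  have h2 := (hasSum_eulerSeries (x / 2)).mul_left (-(x / 2))
  have h3 : ∀ m : ℕ, -(x / 2) * ((eulerCoeff m : ℂ) * (x / 2) ^ m) =
      (eulerCoeff (m + 1) : ℂ) * x ^ (m + 1) - (eulerCoeff (m + 1) : ℂ) * (x / 2) ^ (m + 1) := by
    intro m
    have := congrArg (fun t : ℝ => (t : ℂ)) (eulerCoeff_succ_mul m)
    push_cast at this
    rw [div_eq_mul_one_div x, mul_pow, mul_pow]
    linear_combination -x ^ (m + 1) * this
  have h4 := h1.unique (h2.congr_fun fun m => (h3 m).symm)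
  simp at h4
  linear_combination h4

lemma eulerSeries_eq_prod_mul (x : ℂ) (n : ℕ) :
    eulerSeries x =
      (∏ k ∈ Finset.range n, (1 - x / 2 ^ (k + 1))) * eulerSeries (x / 2 ^ n) := by
  induction n with
  | zero => simp
  | succ n ih =>
    rw [ih, Finset.prod_range_succ, mul_assoc, eulerSeries_half (x / 2 ^ n), div_div, ← pow_succ]

lemma tendsto_div_two_pow (x : ℂ) : Tendsto (fun n : ℕ => x / 2 ^ n) atTop (𝓝 0) := by
  have h : Tendsto (fun n : ℕ => x * (1 / 2 : ℂ) ^ n) atTop (𝓝 (x * 0)) :=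
    (tendsto_pow_atTop_nhds_zero_of_norm_lt_one (by norm_num)).const_mul x
  rw [mul_zero] at h
  refine h.congr fun n => ?_
  rw [one_div, inv_pow, div_eq_mul_inv]

lemma tendsto_eulerSeries_div (x : ℂ) :
    Tendsto (fun n : ℕ => eulerSeries (x / 2 ^ n)) atTop (𝓝 1) := by
  have := (continuous_eulerSeries.tendsto 0).comp (tendsto_div_two_pow x)
  rwa [eulerSeries_zero] at this

/-- The factor `eulerSeries (x / 2 ^ n)` tends to 1, so it can be divided out eventually. The limit
may itself be 0, as at x = 2. -/
lemma tendsto_prod_eulerSeries (x : ℂ) :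
    Tendsto (fun n => ∏ k ∈ Finset.range n, (1 - x / 2 ^ (k + 1))) atTop
      (𝓝 (eulerSeries x)) := by
  have h := (tendsto_const_nhds (x := eulerSeries x)).div (tendsto_eulerSeries_div x) one_ne_zero
  rw [div_one] at h
  refine h.congr' ?_
  filter_upwards [(tendsto_eulerSeries_div x).eventually_ne one_ne_zero] with n hn
  rw [Pi.div_apply, div_eq_iff hn]
  exact eulerSeries_eq_prod_mul x n

/-- Euler's expansion of the infinite product `Q(x)`. -/
theorem QFun_eq_eulerSeries (x : ℂ) : QFun x = eulerSeries x := by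
  have h : Multipliable fun k : ℕ => (1 : ℂ) - x / 2 ^ (k + 1) := by
    have := Complex.multipliable_one_add_of_summable (f := fun k : ℕ => -(x / 2 ^ (k + 1))) ?_
    · simpa [sub_eq_add_neg] using this
    · have h : Summable fun k : ℕ => (1 / 2 : ℂ) ^ k := by
        rw [summable_geometric_iff_norm_lt_one]
        norm_num
      refine (h.mul_left (-(x / 2))).congr fun k => ?_
      rw [one_div, inv_pow, pow_succ]
      field_simp
  exact tendsto_nhds_unique h.tendsto_prod_tprod_nat (tendsto_prod_eulerSeries x)

lemma QInf_eq_eulerSeries : (QInf : ℂ) = eulerSeries 1 := by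
  have h : Multipliable fun k : ℕ => (1 : ℝ) - 1 / 2 ^ (k + 1) := by
    have := Real.multipliable_one_add_of_summable (f := fun k : ℕ => -(1 / 2 ^ (k + 1) : ℝ)) ?_
    · simpa [sub_eq_add_neg] using this
    · refine ((summable_geometric_two).mul_left (-(1 / 2))).congr fun k => ?_
      rw [one_div, inv_pow, pow_succ]
      field_simp
  have h1 := (Complex.continuous_ofReal.tendsto _).comp h.tendsto_prod_tprod_nat
  refine tendsto_nhds_unique h1 ((tendsto_prod_eulerSeries 1).congr fun n => ?_)
  simp

lemma tendsto_Q : Tendsto Q atTop (𝓝 QInf) := by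
  have h := tendsto_prod_eulerSeries 1
  rw [← QInf_eq_eulerSeries] at h
  have h2 := (Complex.continuous_re.tendsto _).comp h
  refine h2.congr fun n => ?_
  have : ∏ k ∈ Finset.range n, (1 - (1 : ℂ) / 2 ^ (k + 1)) = (Q n : ℂ) := by
    rw [Q_eq_prod_range]
    simp
  simp only [Function.comp, this, Complex.ofReal_re]

lemma QInf_eq_Q_mul (n : ℕ) : (QInf : ℂ) = Q n * eulerSeries (1 / 2 ^ n) := by
  rw [QInf_eq_eulerSeries, eulerSeries_eq_prod_mul 1 n, Q_eq_prod_range]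
  simp

lemma Q_antitone : Antitone Q := by
  refine antitone_nat_of_succ_le fun n => ?_
  rw [Q_succ]
  refine mul_le_of_le_one_right (Q_pos n).le ?_
  have : (0 : ℝ) ≤ 1 / 2 ^ (n + 1) := by positivity
  linarith

lemma QInf_le_Q (n : ℕ) : QInf ≤ Q n := Q_antitone.le_of_tendsto tendsto_Q n

/-- Q_∞ = Q_n · E(2^{-n}) with E the Euler series, and the second factor is nonzero for some n
because it tends to 1. -/
lemma QInf_pos : 0 < QInf := by
  refine lt_of_le_of_ne (ge_of_tendsto' tendsto_Q fun n => (Q_pos n).le) fun h => ?_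
  obtain ⟨n, hn⟩ := ((tendsto_eulerSeries_div 1).eventually_ne one_ne_zero).exists
  have h1 := QInf_eq_Q_mul n
  rw [← h, Complex.ofReal_zero, eq_comm, mul_eq_zero] at h1
  rcases h1 with h1 | h1
  · exact (Q_pos n).ne' (by exact_mod_cast h1)
  · exact hn h1

lemma eulerSeries_two : eulerSeries 2 = 0 := by
  rw [eulerSeries_half]
  simp

/-- The expansion of `1 / Q_n`. -/
lemma hasSum_eulerCoeff (n : ℕ) :
    HasSum (fun m => eulerCoeff m * ((1 / 2) ^ n) ^ m) (QInf / Q n) := by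
  have h := hasSum_eulerSeries (1 / 2 ^ n)
  have h1 := QInf_eq_Q_mul n
  have h2 : eulerSeries (1 / 2 ^ n) = ((QInf / Q n : ℝ) : ℂ) := by
    rw [Complex.ofReal_div, h1]
    have : (Q n : ℂ) ≠ 0 := by exact_mod_cast (Q_pos n).ne'
    field_simp
  rw [h2, one_div, ← inv_pow, ← one_div] at h
  rw [← Complex.hasSum_ofReal]
  simpa using h

lemma inv_Q_le (n : ℕ) : 1 / Q n ≤ 1 / QInf :=
  one_div_le_one_div_of_le QInf_pos (QInf_le_Q n)

/-! ### The companion expansion of the reciprocal product -/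

/-- The power series `∑ x^j / Q_j`. -/
def invQSeries (x : ℝ) : ℝ := ∑' j, x ^ j / Q j

lemma summable_invQSeries {x : ℝ} (h0 : 0 ≤ x) (h1 : x < 1) : Summable fun j => x ^ j / Q j := by
  refine Summable.of_nonneg_of_le (fun j => by have := Q_pos j; positivity) (fun j => ?_)
    ((summable_geometric_of_lt_one h0 h1).mul_right (1 / QInf))
  rw [div_eq_mul_one_div]
  exact mul_le_mul_of_nonneg_left (inv_Q_le j) (by positivity)

lemma invQSeries_half {x : ℝ} (h0 : 0 ≤ x) (h1 : x < 1) :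
    invQSeries (x / 2) = (1 - x) * invQSeries x := by
  have hs := summable_invQSeries h0 h1
  have hs' := summable_invQSeries (x := x / 2) (by linarith) (by linarith)
  have h2 := hs.hasSum.sub hs'.hasSum
  rw [← hasSum_nat_add_iff' 1] at h2
  have h3 := hs.hasSum.mul_left x
  have h4 : ∀ j : ℕ, x ^ (j + 1) / Q (j + 1) - (x / 2) ^ (j + 1) / Q (j + 1) =
      x * (x ^ j / Q j) := by
    intro j
    have := (one_sub_inv_two_pow_pos j).ne'
    have h5 := (Q_pos j).ne'
    have h3 : (1 : ℝ) < 2 ^ (j + 1) := one_lt_pow₀ (by norm_num) (by omega)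
    have h6 : (2 : ℝ) ^ (j + 1) - 1 ≠ 0 := by linarith
    rw [Q_succ, div_pow]
    field_simp
    ring
  have h5 := h2.unique (h3.congr_fun h4)
  simp only [Finset.range_one, Finset.sum_singleton, pow_zero, sub_self, sub_zero] at h5
  rw [invQSeries, invQSeries]
  linarith

lemma tendsto_invQSeries : Tendsto (fun n : ℕ => invQSeries ((1 / 2) ^ (n + 1))) atTop (𝓝 1) := by
  have h : ContinuousOn invQSeries (Set.Icc 0 (1 / 2)) := by
    refine continuousOn_tsum (u := fun j => (1 / 2) ^ j / Q j) (fun j => by fun_prop)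
      (summable_invQSeries (by norm_num) (by norm_num)) fun j x hx => ?_
    have := Q_pos j
    rw [Real.norm_eq_abs, abs_of_nonneg (div_nonneg (pow_nonneg hx.1 _) this.le)]
    gcongr
    exacts [hx.1, hx.2]
  have h0 : invQSeries 0 = 1 := by
    rw [invQSeries, tsum_eq_single 0]
    · simp [Q_zero]
    · intro j hj
      simp [hj]
  have h1 : Tendsto (fun n : ℕ => (1 / 2 : ℝ) ^ (n + 1)) atTop (𝓝[Set.Icc 0 (1 / 2)] 0) := by
    rw [tendsto_nhdsWithin_iff]
    refine ⟨(tendsto_pow_atTop_nhds_zero_of_lt_one (by norm_num) (by norm_num)).comp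
      (tendsto_add_atTop_nat 1), Eventually.of_forall fun n => ⟨by positivity, ?_⟩⟩
    rw [pow_succ]
    have : (1 / 2 : ℝ) ^ n ≤ 1 := pow_le_one₀ (by norm_num) (by norm_num)
    linarith
  have h2 := (h 0 ⟨le_rfl, by norm_num⟩).tendsto.comp h1
  rwa [h0] at h2

/-- The expansion of `Q_M` in powers of `2^{-M}`. -/
lemma hasSum_inv_Q (M : ℕ) :
    HasSum (fun j => ((1 / 2) ^ (M + 1)) ^ j / Q j) (Q M / QInf) := by
  -- Iterating P(x/2) = (1 - x) P(x) from x = 1/2; letting n → ∞ then forces P(1/2) = 1/Q_∞.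
  have h : ∀ n, invQSeries ((1 / 2) ^ (n + 1)) = Q n * invQSeries (1 / 2) := by
    intro n
    induction n with
    | zero => simp [Q_zero]
    | succ n ih =>
      have h2 : (1 / 2 : ℝ) ^ (n + 1) < 1 := pow_lt_one₀ (by norm_num) (by norm_num) (by omega)
      have := invQSeries_half (x := (1 / 2) ^ (n + 1)) (by positivity) h2
      rw [pow_succ, mul_one_div, this, ih, Q_succ, one_div_pow]
      ring
  have h1 : invQSeries (1 / 2) = 1 / QInf := by
    have h2 : Tendsto (fun n => Q n * invQSeries (1 / 2)) atTop (𝓝 1) :=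
      tendsto_invQSeries.congr h
    have h3 := tendsto_nhds_unique h2 (tendsto_Q.mul_const _)
    rw [eq_div_iff QInf_pos.ne', mul_comm, ← h3]
  have h2 : (1 / 2 : ℝ) ^ (M + 1) < 1 := pow_lt_one₀ (by norm_num) (by norm_num) (by omega)
  have h3 := (summable_invQSeries (x := (1 / 2) ^ (M + 1)) (by positivity) h2).hasSum
  have h4 := h M
  rw [h1, mul_one_div] at h4
  rw [← h4]
  exact h3

/-- A constant dominating the errors in the approximations of `1 / Q_j`. -/
def errConst : ℝ := (1 + ∑' m, |eulerCoeff m|) / QInf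

lemma summable_abs_eulerCoeff : Summable fun m => |eulerCoeff m| := by
  simpa using fast_eulerCoeff.norm 1

lemma tsum_abs_eulerCoeff_nonneg : 0 ≤ ∑' m, |eulerCoeff m| := tsum_nonneg fun _ => abs_nonneg _

lemma abs_inv_Q_sub_le (j : ℕ) : |1 / Q j - 1 / QInf| ≤ errConst * (1 / 2) ^ j := by
  have h := (hasSum_nat_add_iff' 1).mpr (hasSum_eulerCoeff j)
  simp only [Finset.range_one, Finset.sum_singleton, pow_zero, eulerCoeff_zero, mul_one] at h
  have h1 : |QInf / Q j - 1| ≤ (1 / 2) ^ j * ∑' m, |eulerCoeff m| := by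
    rw [← h.tsum_eq, ← Real.norm_eq_abs, ← tsum_mul_left]
    have hs := (summable_abs_eulerCoeff.mul_left ((1 / 2 : ℝ) ^ j))
    refine (tsum_of_norm_bounded (((summable_nat_add_iff 1).mpr hs).hasSum) fun m => ?_).trans ?_
    · rw [norm_mul, Real.norm_eq_abs, mul_comm]
      refine mul_le_mul_of_nonneg_right ?_ (abs_nonneg _)
      rw [Real.norm_eq_abs, abs_of_nonneg (by positivity), pow_succ]
      exact mul_le_of_le_one_left (by positivity)
        (pow_le_one₀ (by positivity) (pow_le_one₀ (by norm_num) (by norm_num)))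
    · rw [hs.tsum_eq_zero_add]
      have : 0 ≤ (1 / 2 : ℝ) ^ j * |eulerCoeff 0| := by positivity
      linarith
  have h2 : 1 / Q j - 1 / QInf = (QInf / Q j - 1) / QInf := by
    have h3 := QInf_pos.ne'
    have h4 := (Q_pos j).ne'
    field_simp
  rw [h2, abs_div, abs_of_pos QInf_pos, errConst, div_mul_eq_mul_div]
  gcongr
  · exact QInf_pos.le
  refine h1.trans ?_
  have : (0 : ℝ) < (1 / 2) ^ j := by positivity
  linarith

/-- Second-order version of the preceding bound: Q_∞/Q_j = 1 - 2^{-j} + O(4^{-j}), the first two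
Euler coefficients being 1 and -1. It is needed where the 2^{-j} terms cancel in a convolution. -/
lemma abs_inv_Q_sub_add_le (j : ℕ) :
    |1 / Q j - 1 / QInf + (1 / 2) ^ j / QInf| ≤ errConst * (1 / 4) ^ j := by
  have h := (hasSum_nat_add_iff' 2).mpr (hasSum_eulerCoeff j)
  simp only [Finset.sum_range_succ, Finset.range_zero, Finset.sum_empty, pow_zero, eulerCoeff_zero,
    eulerCoeff_one, mul_one, zero_add, pow_one] at h
  have h1 : |QInf / Q j - (1 + -1 * (1 / 2) ^ j)| ≤ (1 / 4) ^ j * ∑' m, |eulerCoeff m| := by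
    rw [← h.tsum_eq, ← Real.norm_eq_abs, ← tsum_mul_left]
    have hs := (summable_abs_eulerCoeff.mul_left ((1 / 4 : ℝ) ^ j))
    refine (tsum_of_norm_bounded (((summable_nat_add_iff 2).mpr hs).hasSum) fun m => ?_).trans ?_
    · rw [norm_mul, Real.norm_eq_abs, mul_comm]
      refine mul_le_mul_of_nonneg_right ?_ (abs_nonneg _)
      have h4 : (1 / 4 : ℝ) ^ j = ((1 / 2) ^ j) ^ 2 := by
        rw [← pow_mul, mul_comm, pow_mul]
        norm_num
      rw [Real.norm_eq_abs, abs_of_nonneg (by positivity), pow_add, h4]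
      exact mul_le_of_le_one_left (by positivity)
        (pow_le_one₀ (by positivity) (pow_le_one₀ (by norm_num) (by norm_num)))
    · rw [← hs.sum_add_tsum_nat_add 2]
      have : 0 ≤ ∑ i ∈ Finset.range 2, (1 / 4 : ℝ) ^ j * |eulerCoeff i| :=
        Finset.sum_nonneg fun i _ => by positivity
      linarith
  have h2 : 1 / Q j - 1 / QInf + (1 / 2) ^ j / QInf =
      (QInf / Q j - (1 + -1 * (1 / 2) ^ j)) / QInf := by
    have h3 := QInf_pos.ne'
    have h4 := (Q_pos j).ne'
    field_simp
    ring
  rw [h2, abs_div, abs_of_pos QInf_pos, errConst, div_mul_eq_mul_div]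
  gcongr
  · exact QInf_pos.le
  refine h1.trans ?_
  have : (0 : ℝ) < (1 / 4) ^ j := by positivity
  linarith

lemma one_div_QInf_le_errConst : 1 / QInf ≤ errConst := by
  rw [errConst]
  gcongr
  · exact QInf_pos.le
  · linarith [tsum_abs_eulerCoeff_nonneg]

/-! ### Closed form of the inner sums -/

/-- The six families collect the closed form of S_m by powers of ρ and polynomials in κ; see
`innerPoly`. The case m = 0 is special because the geometric ratio is then 1, so powers of κ replace
one of the exponentials; only there does a cubic term (`coeffI`) occur. The polynomials κ(κ+1) and
κ³-κ are falling factorials k(k-1) and k(k-1)(k-2) of k = κ+1, matching the alternating transforms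
computed above. -/
def coeffD (m : ℕ) : ℝ :=
  if m = 0 then 0 else -1 / (1 - (1 / 2) ^ m) + (1 / 2) ^ m / (2 * (1 - (1 / 2) ^ m) ^ 3)

def coeffE (m : ℕ) : ℝ := 1 / (1 - (1 / 2) ^ m / 2) ^ 2

def coeffF (m : ℕ) : ℝ :=
  if m = 0 then 1 else (1 / 2) ^ m / (2 * (1 - (1 / 2) ^ m) ^ 2)

def coeffG (m : ℕ) : ℝ := 1 / (1 - (1 / 2) ^ m / 2)

def coeffH (m : ℕ) : ℝ := if m = 0 then 0 else 1 / (4 * (1 - (1 / 2) ^ m))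

def coeffI (m : ℕ) : ℝ := if m = 0 then 1 / 12 else 0

/-- The inner sum as a polynomial in `κ = z - 1` and `ρ = 2^{-κ}`. -/
def innerPoly (m : ℕ) (ρ κ : ℂ) : ℂ :=
  coeffD m * (ρ ^ m - 1) + coeffE m * (ρ ^ (m + 1) - 1) +
    κ * (coeffF m * ρ ^ m + coeffG m * ρ ^ (m + 1)) + κ * (κ + 1) * (coeffH m * ρ ^ m) -
    (κ ^ 3 - κ) * (coeffI m * ρ ^ m)

lemma two_cpow_neg_mul_sub_one (j : ℕ) (κ : ℂ) :
    (2 : ℂ) ^ (-((j : ℂ) * (κ - 1))) = (2 ^ (-κ)) ^ j * 2 ^ j := by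
  rw [← Complex.cpow_nat_mul, ← Complex.cpow_natCast, ← Complex.cpow_add _ _ two_ne_zero]
  congr 1
  ring

lemma half_pow_lt_one {m : ℕ} (hm : m ≠ 0) : (1 / 2 : ℝ) ^ m ≤ 1 / 2 := by
  obtain ⟨k, rfl⟩ := Nat.exists_eq_succ_of_ne_zero hm
  rw [pow_succ]
  have : (1 / 2 : ℝ) ^ k ≤ 1 := pow_le_one₀ (by norm_num) (by norm_num)
  linarith

lemma half_pow_le_one (m : ℕ) : (1 / 2 : ℝ) ^ m ≤ 1 := pow_le_one₀ (by norm_num) (by norm_num)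

theorem innerSum_eq_innerPoly (m : ℕ) (κ : ℂ) :
    innerSum m (1 + κ) = innerPoly m (2 ^ (-κ)) κ := by
  have hM : 1 + κ - 2 = κ - 1 := by ring
  rcases Nat.eq_zero_or_pos m with rfl | hm
  · simp only [innerSum, geom0, geom1, geom2, hM, two_cpow_neg_mul_sub_one, innerPoly, coeffD,
      coeffE, coeffF, coeffG, coeffH, coeffI]
    norm_num
    ring
  · have hm0 : m ≠ 0 := hm.ne'
    have h1 : (1 : ℂ) - (1 / 2) ^ m ≠ 0 := by
      have : (1 : ℝ) - (1 / 2) ^ m ≠ 0 := by linarith [half_pow_lt_one hm0]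
      intro h
      apply this
      rw [← Complex.ofReal_inj]
      push_cast
      exact h
    have h2 : (2 : ℂ) - (1 / 2) ^ m ≠ 0 := by
      have : (2 : ℝ) - (1 / 2) ^ m ≠ 0 := by linarith [half_pow_lt_one hm0]
      intro h
      apply this
      rw [← Complex.ofReal_inj]
      push_cast
      exact h
    have h3 : (2 : ℂ) ^ m = ((1 / 2) ^ m)⁻¹ := by simp
    have h4 : (1 / 2 : ℂ) ^ m ≠ 0 := pow_ne_zero _ (by norm_num)
    simp only [innerSum, geom0, geom1, geom2, hM, two_cpow_neg_mul_sub_one, innerPoly, coeffD,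
      coeffE, coeffF, coeffG, coeffH, coeffI, hm0, if_false, Nat.succ_ne_zero, pow_succ]
    push_cast
    simp only [h3]
    generalize (2 : ℂ) ^ (-κ) = ρ at *
    generalize ρ ^ m = r at *
    generalize (1 / 2 : ℂ) ^ m = w at *
    have h5 : (1 : ℂ) - w * (1 / 2) ≠ 0 := by
      intro h
      apply h2
      linear_combination 2 * h
    have h6 : (1 : ℂ) - w / 2 ≠ 0 := by
      intro h
      apply h2
      linear_combination 2 * h
    have e1 : (1 : ℂ) - w * (1 / 2) = (2 - w) / 2 := by ring
    have e2 : (1 : ℂ) - w / 2 = (2 - w) / 2 := by ring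
    rw [e1, e2]
    field_simp
    ring

lemma abs_coeffD_le (m : ℕ) : |coeffD m| ≤ 4 := by
  unfold coeffD
  split_ifs with h
  · norm_num
  · have h1 := half_pow_lt_one h
    have h2 : (0 : ℝ) < (1 / 2) ^ m := by positivity
    generalize (1 / 2 : ℝ) ^ m = w at *
    have h3 : (1 / 2) ^ 3 ≤ (1 - w) ^ 3 := by
      gcongr
      linarith
    have h4 : |(-1 : ℝ) / (1 - w)| ≤ 2 := by
      rw [abs_div, abs_neg, abs_one, abs_of_pos (by linarith), div_le_iff₀ (by linarith)]
      linarith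
    have h5 : |w / (2 * (1 - w) ^ 3)| ≤ 2 := by
      have : 0 < (1 - w) ^ 3 := lt_of_lt_of_le (by norm_num) h3
      rw [abs_of_pos (by positivity), div_le_iff₀ (by positivity)]
      linarith
    exact (abs_add_le _ _).trans (by linarith)

lemma abs_coeffE_le (m : ℕ) : |coeffE m| ≤ 4 := by
  unfold coeffE
  have h1 := half_pow_le_one m
  generalize (1 / 2 : ℝ) ^ m = w at *
  have h3 : (1 / 2) ^ 2 ≤ (1 - w / 2) ^ 2 := by
    gcongr
    linarith
  have h4 : 0 < (1 - w / 2) ^ 2 := lt_of_lt_of_le (by norm_num) h3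
  rw [abs_of_pos (by positivity), div_le_iff₀ h4]
  linarith

lemma abs_coeffF_le (m : ℕ) : |coeffF m| ≤ 1 := by
  unfold coeffF
  split_ifs with h
  · norm_num
  · have h1 := half_pow_lt_one h
    have h2 : (0 : ℝ) < (1 / 2) ^ m := by positivity
    generalize (1 / 2 : ℝ) ^ m = w at *
    have h3 : (1 / 2) ^ 2 ≤ (1 - w) ^ 2 := by
      gcongr
      linarith
    have h4 : 0 < (1 - w) ^ 2 := lt_of_lt_of_le (by norm_num) h3
    rw [abs_of_pos (by positivity), div_le_iff₀ (by positivity)]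
    linarith

lemma abs_coeffG_le (m : ℕ) : |coeffG m| ≤ 2 := by
  unfold coeffG
  have h1 := half_pow_le_one m
  generalize (1 / 2 : ℝ) ^ m = w at *
  rw [abs_of_pos (by apply one_div_pos.mpr; linarith), div_le_iff₀ (by linarith)]
  linarith

lemma abs_coeffH_le (m : ℕ) : |coeffH m| ≤ 1 / 2 := by
  unfold coeffH
  split_ifs with h
  · norm_num
  · have h1 := half_pow_lt_one h
    generalize (1 / 2 : ℝ) ^ m = w at *
    rw [abs_of_pos (by apply one_div_pos.mpr; linarith), div_le_iff₀ (by linarith)]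
    linarith

lemma abs_coeffI_le (m : ℕ) : |coeffI m| ≤ 1 / 12 := by
  unfold coeffI
  split_ifs <;> norm_num

/-! ### The coefficients of `∑ a_{m+1} S_m(1 + κ)` as a power series in `ρ` -/

lemma fast_mul {c : ℕ → ℝ} {K : ℝ} (h : ∀ m, |c m| ≤ K) : Fast fun m => eulerCoeff m * c m :=
  fast_eulerCoeff.mul_of_bounded K h

lemma fast_D : Fast fun m => eulerCoeff m * coeffD m := fast_mul abs_coeffD_le
lemma fast_E : Fast fun m => eulerCoeff m * coeffE m := fast_mul abs_coeffE_le
lemma fast_F : Fast fun m => eulerCoeff m * coeffF m := fast_mul abs_coeffF_le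
lemma fast_G : Fast fun m => eulerCoeff m * coeffG m := fast_mul abs_coeffG_le
lemma fast_H : Fast fun m => eulerCoeff m * coeffH m := fast_mul abs_coeffH_le
lemma fast_I : Fast fun m => eulerCoeff m * coeffI m := fast_mul abs_coeffI_le

/-- The total of the -1's in ρ^m - 1 and ρ^{m+1} - 1, to be subtracted from the coefficient of ρ^0
in `seriesOne`. The E and G families accompany ρ^{m+1} and therefore enter the series shifted by
one. -/
def seriesConst : ℝ := ∑' m, eulerCoeff m * coeffD m + ∑' m, eulerCoeff m * coeffE m

def seriesOne (n : ℕ) : ℝ :=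
  eulerCoeff n * coeffD n + shift (fun m => eulerCoeff m * coeffE m) n +
    if n = 0 then -seriesConst else 0

def seriesLin (n : ℕ) : ℝ :=
  eulerCoeff n * coeffF n + shift (fun m => eulerCoeff m * coeffG m) n

def seriesQuad (n : ℕ) : ℝ := eulerCoeff n * coeffH n

def seriesCub (n : ℕ) : ℝ := eulerCoeff n * -coeffI n

lemma fast_seriesOne : Fast seriesOne := (fast_D.add fast_E.shift).add (fast_single _)

lemma fast_seriesLin : Fast seriesLin := fast_F.add fast_G.shift

lemma fast_seriesQuad : Fast seriesQuad := fast_H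

lemma fast_seriesCub : Fast seriesCub :=
  fast_mul (K := 1 / 12) fun m => by rw [abs_neg]; exact abs_coeffI_le m

/-- The power series with coefficients `W`. -/
def powerSum (W : ℕ → ℝ) (ρ : ℂ) : ℂ := ∑' n, (W n : ℂ) * ρ ^ n

lemma Fast.hasSum {W : ℕ → ℝ} (h : Fast W) (ρ : ℂ) :
    HasSum (fun n => (W n : ℂ) * ρ ^ n) (powerSum W ρ) := by
  refine Summable.hasSum (Summable.of_norm ?_)
  simpa using h.norm ‖ρ‖

lemma Fast.powerSum_shift {W : ℕ → ℝ} (h : Fast W) (ρ : ℂ) :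
    powerSum (DST.shift W) ρ = ρ * powerSum W ρ := by
  have h1 := (h.hasSum ρ).mul_left ρ
  have h2 := (hasSum_nat_add_iff' 1).mpr (h.shift.hasSum ρ)
  simp only [DST.shift, Finset.range_one, Finset.sum_singleton, Complex.ofReal_zero, zero_mul,
    sub_zero] at h2
  refine h2.unique (h1.congr_fun fun n => ?_)
  ring

lemma Fast.powerSum_add {V W : ℕ → ℝ} (hV : Fast V) (hW : Fast W) (ρ : ℂ) :
    powerSum (fun n => V n + W n) ρ = powerSum V ρ + powerSum W ρ := by
  have := (hV.hasSum ρ).add (hW.hasSum ρ)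
  rw [← this.tsum_eq, powerSum]
  refine tsum_congr fun n => ?_
  push_cast
  ring

lemma powerSum_ofReal (W : ℕ → ℝ) (r : ℝ) : powerSum W r = ((∑' n, W n * r ^ n : ℝ) : ℂ) := by
  rw [powerSum, Complex.ofReal_tsum]
  simp

lemma powerSum_one (W : ℕ → ℝ) : powerSum W 1 = ((∑' n, W n : ℝ) : ℂ) := by
  simpa using powerSum_ofReal W 1

lemma powerSum_seriesOne (ρ : ℂ) :
    powerSum seriesOne ρ = powerSum (fun m => eulerCoeff m * coeffD m) ρ +
      ρ * powerSum (fun m => eulerCoeff m * coeffE m) ρ - seriesConst := by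
  have h := (fast_D.add fast_E.shift).powerSum_add (fast_single (-seriesConst)) ρ
  rw [fast_D.powerSum_add fast_E.shift, fast_E.powerSum_shift] at h
  have h2 : powerSum (fun n => if n = 0 then -seriesConst else 0) ρ = -seriesConst := by
    rw [powerSum, tsum_eq_single 0]
    · simp
    · intro n hn
      simp [hn]
  rw [h2] at h
  rw [sub_eq_add_neg, ← h]
  rfl

lemma powerSum_seriesLin (ρ : ℂ) :
    powerSum seriesLin ρ = powerSum (fun m => eulerCoeff m * coeffF m) ρ +
      ρ * powerSum (fun m => eulerCoeff m * coeffG m) ρ := by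
  have h := fast_F.powerSum_add fast_G.shift ρ
  rw [fast_G.powerSum_shift] at h
  exact h

/-- The value of `∑ a_{m+1} S_m(1 + κ)`. -/
def innerTotal (ρ κ : ℂ) : ℂ :=
  powerSum seriesOne ρ + κ * powerSum seriesLin ρ + κ * (κ + 1) * powerSum seriesQuad ρ +
    (κ ^ 3 - κ) * powerSum seriesCub ρ

lemma hasSum_innerPoly (ρ κ : ℂ) :
    HasSum (fun m => (eulerCoeff m : ℂ) * innerPoly m ρ κ) (innerTotal ρ κ) := by
  have hD := fast_D.hasSum ρ
  have hE := (fast_E.hasSum ρ).mul_left ρ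
  have hF := (fast_F.hasSum ρ).mul_left κ
  have hG := ((fast_G.hasSum ρ).mul_left ρ).mul_left κ
  have hH := (fast_H.hasSum ρ).mul_left (κ * (κ + 1))
  have hI := (fast_seriesCub.hasSum ρ).mul_left (κ ^ 3 - κ)
  have hD1 := fast_D.hasSum 1
  have hE1 := fast_E.hasSum 1
  have hc : powerSum (fun m => eulerCoeff m * coeffD m) 1 +
      powerSum (fun m => eulerCoeff m * coeffE m) 1 = seriesConst := by
    rw [powerSum_one, powerSum_one, ← Complex.ofReal_add, seriesConst]
  have h := ((((((hD.add hE).add hF).add hG).add hH).add hI).sub hD1).sub hE1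
  have h3 : innerTotal ρ κ = powerSum (fun m => eulerCoeff m * coeffD m) ρ +
      ρ * powerSum (fun m => eulerCoeff m * coeffE m) ρ +
      κ * powerSum (fun m => eulerCoeff m * coeffF m) ρ +
      κ * (ρ * powerSum (fun m => eulerCoeff m * coeffG m) ρ) +
      κ * (κ + 1) * powerSum (fun m => eulerCoeff m * coeffH m) ρ +
      (κ ^ 3 - κ) * powerSum seriesCub ρ -
      powerSum (fun m => eulerCoeff m * coeffD m) 1 -
      powerSum (fun m => eulerCoeff m * coeffE m) 1 := by
    rw [innerTotal, powerSum_seriesOne, powerSum_seriesLin, ← hc]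
    unfold seriesQuad
    ring
  rw [h3]
  refine h.congr_fun fun m => ?_
  simp only [innerPoly, seriesCub]
  push_cast
  ring

/-- The series for `∑ a_{m+1} S_m(z)`. -/
theorem hasSum_innerSum (κ : ℂ) :
    HasSum (fun m => (eulerCoeff m : ℂ) * innerSum m (1 + κ)) (innerTotal (2 ^ (-κ)) κ) := by
  simp only [innerSum_eq_innerPoly]
  exact hasSum_innerPoly _ _

/-- This is the total at z = 1, where ρ = 1 and κ = 0 and every S_m vanishes. It makes the
convolution of `seriesOne` with 1/Q_j tend to 0, hence summable. -/
lemma tsum_seriesOne : ∑' n, seriesOne n = 0 := by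
  have h := hasSum_innerPoly 1 0
  have h2 : ∀ m, (eulerCoeff m : ℂ) * innerPoly m 1 0 = 0 := by
    intro m
    simp [innerPoly]
  simp only [h2] at h
  have h3 := h.unique hasSum_zero
  simp only [innerTotal, powerSum_one] at h3
  simpa using h3

lemma innerPoly_two (m : ℕ) : innerPoly m 2 (-1) = -2 ^ m := by
  rcases Nat.eq_zero_or_pos m with rfl | hm
  · norm_num [innerPoly, coeffD, coeffE, coeffF, coeffG]
  · have hm0 : m ≠ 0 := hm.ne'
    have h1 : (1 : ℂ) - (1 / 2) ^ m ≠ 0 := by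
      have : (1 : ℝ) - (1 / 2) ^ m ≠ 0 := by linarith [half_pow_lt_one hm0]
      intro h
      apply this
      rw [← Complex.ofReal_inj]
      push_cast
      exact h
    have h2 : (2 : ℂ) - (1 / 2) ^ m ≠ 0 := by
      have : (2 : ℝ) - (1 / 2) ^ m ≠ 0 := by linarith [half_pow_lt_one hm0]
      intro h
      apply this
      rw [← Complex.ofReal_inj]
      push_cast
      exact h
    have h3 : (2 : ℂ) ^ m = ((1 / 2) ^ m)⁻¹ := by simp
    have h4 : (1 / 2 : ℂ) ^ m ≠ 0 := pow_ne_zero _ (by norm_num)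
    simp only [innerPoly, coeffD, coeffE, coeffF, coeffG, coeffH, coeffI, hm0, if_false, pow_succ]
    push_cast
    simp only [h3]
    generalize (1 / 2 : ℂ) ^ m = w at *
    have e2 : (1 : ℂ) - w / 2 = (2 - w) / 2 := by ring
    rw [e2]
    field_simp
    ring

/-- Evaluation at z = 0, that is ρ = 2 and κ = -1. The quadratic and cubic parts vanish, and by
`innerPoly_two` the total is -Q(2) = 0. This removes the 2^{-n} term from the convolution of
`seriesLin` minus `seriesOne`. -/
lemma tsum_seriesOne_two : ∑' n, seriesOne n * 2 ^ n = ∑' n, seriesLin n * 2 ^ n := by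
  have h := hasSum_innerPoly 2 (-1)
  have h1 := (hasSum_eulerSeries 2).neg
  have h3 := h.unique (h1.congr_fun fun m => by rw [innerPoly_two]; ring)
  rw [eulerSeries_two] at h3
  have e : ∀ W : ℕ → ℝ, powerSum W 2 = ((∑' n, W n * 2 ^ n : ℝ) : ℂ) := fun W => by
    simpa using powerSum_ofReal W 2
  simp only [innerTotal, e] at h3
  have h4 : (((∑' n, seriesOne n * 2 ^ n : ℝ) : ℂ)) = ((∑' n, seriesLin n * 2 ^ n : ℝ) : ℂ) := by
    linear_combination h3
  exact_mod_cast h4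

lemma tsum_seriesCub : ∑' n, seriesCub n = -1 / 12 := by
  rw [tsum_eq_single 0]
  · simp [seriesCub, coeffI, eulerCoeff_zero]
    norm_num
  · intro n hn
    simp [seriesCub, coeffI, hn]

lemma tsum_shift {W : ℕ → ℝ} (h : Fast W) : ∑' n, shift W n = ∑' n, W n := by
  have h1 := h.powerSum_shift 1
  rw [powerSum_one, powerSum_one, one_mul] at h1
  exact_mod_cast h1

lemma tsum_seriesLin :
    ∑' n, seriesLin n = ∑' m, eulerCoeff m * (coeffF m + coeffG m) := by
  have h := fast_F.summable.tsum_add fast_G.shift.summable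
  rw [tsum_shift fast_G, ← fast_F.summable.tsum_add fast_G.summable] at h
  simp only [mul_add]
  exact h

/-! ### The binomial transform in closed form -/

/-- The factor of `2^{-nm}` in the inner sums. -/
def weight (n : ℕ) : ℝ := 1 - (n + 1) * (1 / 2) ^ n - n * (n + 1) / 4

/-- The index shift by 2 is natural: t_0 = t_1 = t_2 = 0, and from k = 2 on the factors 1 - 2^{1-k}
build up Q_M. Dividing the recursion by Q_{M+1} makes it telescope, since `source (M+2)` equals
`weight (M+1)`. -/
lemma transform_eq_sum (M : ℕ) :
    transform (M + 2) = Q M * ∑ n ∈ Finset.Icc 1 M, weight n / Q n := by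
  induction M with
  | zero => simp [transform, source]
  | succ M ih =>
    have h1 := (Q_pos M).ne'
    have h2 := (Q_pos (M + 1)).ne'
    rw [show M + 1 + 2 = (M + 2) + 1 by ring, transform, ih, Finset.sum_Icc_succ_top (by omega),
      mul_add, mul_div_cancel₀ _ h2, Q_succ, source, weight]
    have h3 : (1 / 2 : ℝ) ^ (M + 2) * 2 = 1 / 2 ^ (M + 1) := by
      rw [pow_succ, one_div_pow]
      ring
    have h4 : (1 / 2 : ℝ) ^ (M + 1) = 1 / 2 ^ (M + 1) := one_div_pow _ _
    rw [h4, mul_comm (2 : ℝ), h3, mul_assoc ((M + 2 : ℕ) : ℝ), mul_comm (2 : ℝ), h3]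
    simp
    ring

lemma hasSum_innerSum_nat (M : ℕ) :
    HasSum (fun m => (eulerCoeff m : ℂ) * innerSum m (1 + ((M + 1 : ℕ) : ℂ)))
      ((QInf * ∑ n ∈ Finset.Icc 1 M, weight n / Q n : ℝ) : ℂ) := by
  have h : HasSum (fun m => ∑ n ∈ Finset.Icc 1 M, weight n * (eulerCoeff m * ((1 / 2) ^ n) ^ m))
      (∑ n ∈ Finset.Icc 1 M, weight n * (QInf / Q n)) :=
    hasSum_sum fun n _ => (hasSum_eulerCoeff n).mul_left _
  have h2 : ∑ n ∈ Finset.Icc 1 M, weight n * (QInf / Q n) =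
      QInf * ∑ n ∈ Finset.Icc 1 M, weight n / Q n := by
    rw [Finset.mul_sum]
    exact Finset.sum_congr rfl fun n _ => by ring
  rw [h2, ← Complex.hasSum_ofReal] at h
  refine h.congr_fun fun m => ?_
  rw [show 1 + ((M + 1 : ℕ) : ℂ) = (M : ℂ) + 2 by push_cast; ring, innerSum_natCast,
    Complex.ofReal_sum, Finset.mul_sum]
  refine Finset.sum_congr rfl fun n _ => ?_
  rw [weight, ← pow_mul, ← pow_mul, mul_comm m n]
  push_cast
  ring

/-- The convolution of `W` with `1 / Q_j`. -/
def convQ (W : ℕ → ℝ) (n : ℕ) : ℝ := ∑ m ∈ Finset.range (n + 1), W m * (1 / Q (n - m))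

lemma Fast.hasSum_convQ {W : ℕ → ℝ} (h : Fast W) (M : ℕ) :
    HasSum (fun n => convQ W n * ((1 / 2) ^ (M + 1)) ^ n)
      ((∑' n, W n * ((1 / 2) ^ (M + 1)) ^ n) * (Q M / QInf)) := by
  have h1 := (h ((1 / 2) ^ (M + 1))).norm
  have h2 := hasSum_inv_Q M
  have h3 := h2.summable.norm
  have h4 := hasSum_sum_range_mul_of_summable_norm h1 h3
  rw [h2.tsum_eq] at h4
  refine h4.congr_fun fun n => ?_
  rw [convQ, Finset.sum_mul]
  refine Finset.sum_congr rfl fun m hm => ?_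
  have hmn : m ≤ n := by simpa [Nat.lt_succ_iff] using hm
  obtain ⟨j, rfl⟩ := Nat.exists_eq_add_of_le hmn
  rw [Nat.add_sub_cancel_left, pow_add _ m j]
  ring

/-- The expansion of the binomial transform in powers of `2^{-k}`. -/
theorem hasSum_transform (M : ℕ) :
    HasSum (fun n => ((1 / 2 : ℝ) ^ (M + 1)) ^ n *
      (convQ seriesOne n + (M + 1) * convQ seriesLin n + (M + 1) * (M + 2) * convQ seriesQuad n +
        (M + 2) * (M + 1) * M * convQ seriesCub n)) (transform (M + 2)) := by
  set ρ : ℝ := (1 / 2) ^ (M + 1) with hρ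
  have h1 := hasSum_innerSum ((M + 1 : ℕ) : ℂ)
  -- At κ = M+1 the series ∑ a_{m+1} S_m is known twice: as a polynomial in κ with coefficients that
  -- are power series in ρ = 2^{-(M+1)}, and as the finite sum in the solution of the recursion.
  have h2 := h1.unique (hasSum_innerSum_nat M)
  have h3 : (2 : ℂ) ^ (-((M + 1 : ℕ) : ℂ)) = (ρ : ℂ) := by
    rw [Complex.cpow_neg, Complex.cpow_natCast, hρ]
    simp
  rw [h3] at h2
  simp only [innerTotal, powerSum_ofReal] at h2
  have h4 : ∑' n, seriesOne n * ρ ^ n + (M + 1) * ∑' n, seriesLin n * ρ ^ n +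
      (M + 1) * (M + 2) * ∑' n, seriesQuad n * ρ ^ n +
      (M + 2) * (M + 1) * M * ∑' n, seriesCub n * ρ ^ n =
      QInf * ∑ n ∈ Finset.Icc 1 M, weight n / Q n := by
    rw [← Complex.ofReal_inj, ← h2]
    simp only [Complex.ofReal_add, Complex.ofReal_mul, Complex.ofReal_natCast, Complex.ofReal_one,
      Complex.ofReal_ofNat, Nat.cast_add, Nat.cast_one]
    ring
  have h5 : transform (M + 2) = (∑' n, seriesOne n * ρ ^ n + (M + 1) * ∑' n, seriesLin n * ρ ^ n +
      (M + 1) * (M + 2) * ∑' n, seriesQuad n * ρ ^ n +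
      (M + 2) * (M + 1) * M * ∑' n, seriesCub n * ρ ^ n) * (Q M / QInf) := by
    rw [h4, transform_eq_sum]
    have := QInf_pos.ne'
    field_simp
  rw [h5]
  have h := (((fast_seriesOne.hasSum_convQ M).add ((fast_seriesLin.hasSum_convQ M).mul_left
    ((M : ℝ) + 1))).add ((fast_seriesQuad.hasSum_convQ M).mul_left (((M : ℝ) + 1) * (M + 2)))).add
    ((fast_seriesCub.hasSum_convQ M).mul_left (((M : ℝ) + 2) * (M + 1) * M))
  convert! h using 1
  · funext n
    ring
  · ring

/-! ### Approximation of the convolutions -/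

/-- The error in replacing `1 / Q_{n-m}` by its limit. -/
def convErr (n m : ℕ) : ℝ := (if m ≤ n then 1 / Q (n - m) else 0) - 1 / QInf

lemma errConst_pos : 0 < errConst :=
  lt_of_lt_of_le (one_div_pos.mpr QInf_pos) one_div_QInf_le_errConst

lemma one_le_pow_mul_pow {n m : ℕ} (h : n < m) (b : ℝ) (hb : 1 ≤ b) :
    1 ≤ (1 / b) ^ n * b ^ m := by
  obtain ⟨j, rfl⟩ := Nat.exists_eq_add_of_lt h
  rw [add_assoc, pow_add, ← mul_assoc, ← mul_pow, one_div_mul_cancel (by linarith), one_pow,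
    one_mul]
  exact one_le_pow₀ hb

lemma pow_sub_eq {n m : ℕ} (h : m ≤ n) (b : ℝ) (hb : 1 ≤ b) :
    (1 / b) ^ (n - m) = (1 / b) ^ n * b ^ m := by
  obtain ⟨j, rfl⟩ := Nat.exists_eq_add_of_le h
  rw [Nat.add_sub_cancel_left, add_comm m j, pow_add, mul_assoc, ← mul_pow,
    one_div_mul_cancel (by linarith), one_pow, mul_one]

/-- For m > n the missing term costs only 1/Q_∞, while 2^{m-n} ≥ 1. So the bound holds for all m,
and sums over m need not be cut at n. -/
lemma abs_convErr_le (n m : ℕ) : |convErr n m| ≤ errConst * ((1 / 2) ^ n * 2 ^ m) := by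
  unfold convErr
  split_ifs with h
  · rw [← pow_sub_eq h 2 (by norm_num)]
    exact abs_inv_Q_sub_le _
  · rw [zero_sub, abs_neg, abs_of_pos (one_div_pos.mpr QInf_pos)]
    have := one_le_pow_mul_pow (not_le.mp h) 2 (by norm_num)
    nlinarith [one_div_QInf_le_errConst, errConst_pos]

lemma abs_convErr_add_le (n m : ℕ) :
    |convErr n m + (1 / 2) ^ n * 2 ^ m / QInf| ≤ errConst * ((1 / 4) ^ n * 4 ^ m) := by
  unfold convErr
  split_ifs with h
  · rw [← pow_sub_eq h 2 (by norm_num), ← pow_sub_eq h 4 (by norm_num)]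
    exact abs_inv_Q_sub_add_le _
  · have h1 := one_le_pow_mul_pow (not_le.mp h) 2 (by norm_num)
    have h2 : (1 / 4 : ℝ) ^ n * 4 ^ m = ((1 / 2) ^ n * 2 ^ m) ^ 2 := by
      rw [mul_pow, ← pow_mul, ← pow_mul, mul_comm n, mul_comm m, pow_mul, pow_mul]
      norm_num
    have h3 : (0 : ℝ) - 1 / QInf + (1 / 2) ^ n * 2 ^ m / QInf =
        ((1 / 2) ^ n * 2 ^ m - 1) * (1 / QInf) := by ring
    rw [h2, h3]
    generalize (1 / 2 : ℝ) ^ n * 2 ^ m = t at *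
    have h4 := one_div_pos.mpr QInf_pos
    rw [abs_of_nonneg (mul_nonneg (by linarith) h4.le), mul_comm errConst]
    exact mul_le_mul (by nlinarith) one_div_QInf_le_errConst h4.le (by positivity)

lemma hasSum_convErr {W : ℕ → ℝ} (h : Fast W) (n : ℕ) :
    HasSum (fun m => W m * convErr n m) (convQ W n - (∑' m, W m) / QInf) := by
  have h1 : HasSum (fun m => W m * (if m ≤ n then 1 / Q (n - m) else 0)) (convQ W n) := by
    have h2 : convQ W n = ∑ m ∈ Finset.range (n + 1),
        W m * (if m ≤ n then 1 / Q (n - m) else 0) := by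
      refine Finset.sum_congr rfl fun m hm => ?_
      rw [if_pos (by simpa [Nat.lt_succ_iff] using hm)]
    rw [h2]
    refine hasSum_sum_of_ne_finset_zero fun m hm => ?_
    rw [if_neg (by simpa [Nat.lt_succ_iff] using hm), mul_zero]
  have h3 := h1.sub (h.summable.hasSum.mul_right (1 / QInf))
  rw [mul_one_div] at h3
  refine h3.congr_fun fun m => ?_
  rw [convErr, mul_sub]

lemma Fast.abs_convQ_sub_le {W : ℕ → ℝ} (h : Fast W) (n : ℕ) :
    |convQ W n - (∑' m, W m) / QInf| ≤ errConst * (∑' m, |W m| * 2 ^ m) * (1 / 2) ^ n := by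
  rw [← (hasSum_convErr h n).tsum_eq]
  refine tsum_of_norm_bounded (f := fun m => W m * convErr n m)
    (g := fun m => errConst * (|W m| * 2 ^ m) * (1 / 2) ^ n)
    (((h.norm 2).hasSum.mul_left _).mul_right _) fun m => ?_
  rw [norm_mul, Real.norm_eq_abs, Real.norm_eq_abs]
  calc |W m| * |convErr n m| ≤ |W m| * (errConst * ((1 / 2) ^ n * 2 ^ m)) :=
        mul_le_mul_of_nonneg_left (abs_convErr_le n m) (abs_nonneg _)
    _ = _ := by ring

/-- The 2^{-n} term in the asymptotics of the convolution is proportional to ∑ W_m 2^m. If this sum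
vanishes, it can be added at no cost and the second-order estimate for 1/Q_j applies. -/
lemma Fast.abs_convQ_sub_le' {W : ℕ → ℝ} (h : Fast W) (h0 : ∑' m, W m * 2 ^ m = 0) (n : ℕ) :
    |convQ W n - (∑' m, W m) / QInf| ≤ errConst * (∑' m, |W m| * 4 ^ m) * (1 / 4) ^ n := by
  have h1 := (h 2).hasSum
  rw [h0] at h1
  have h2 := (hasSum_convErr h n).add (h1.mul_left ((1 / 2) ^ n / QInf))
  rw [mul_zero, add_zero] at h2
  rw [← h2.tsum_eq]
  refine tsum_of_norm_bounded
    (f := fun m => W m * convErr n m + (1 / 2) ^ n / QInf * (W m * 2 ^ m))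
    (g := fun m => errConst * (|W m| * 4 ^ m) * (1 / 4) ^ n)
    (((h.norm 4).hasSum.mul_left _).mul_right _) fun m => ?_
  have h3 : W m * convErr n m + (1 / 2) ^ n / QInf * (W m * 2 ^ m) =
      W m * (convErr n m + (1 / 2) ^ n * 2 ^ m / QInf) := by ring
  rw [h3, norm_mul, Real.norm_eq_abs, Real.norm_eq_abs]
  calc |W m| * |convErr n m + (1 / 2) ^ n * 2 ^ m / QInf|
      ≤ |W m| * (errConst * ((1 / 4) ^ n * 4 ^ m)) :=
        mul_le_mul_of_nonneg_left (abs_convErr_add_le n m) (abs_nonneg _)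
    _ = _ := by ring

/-- Column m is column 0 moved down by m places, preceded by m entries equal to -1/Q_∞. -/
lemma hasSum_convErr_left (m : ℕ) :
    HasSum (fun n => convErr n m) ((∑' n, convErr n 0) - m / QInf) := by
  have h0 : Summable fun n => convErr n 0 := by
    refine Summable.of_norm_bounded (g := fun n => errConst * ((1 / 2) ^ n * 2 ^ 0))
      ((summable_geometric_two.mul_right _).mul_left _) fun n => abs_convErr_le n 0
  rw [← hasSum_nat_add_iff' m]
  have h1 : ∑ i ∈ Finset.range m, convErr i m = -(m / QInf) := by
    have : ∀ i ∈ Finset.range m, convErr i m = -(1 / QInf) := by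
      intro i hi
      rw [convErr, if_neg (by simpa using hi), zero_sub]
    rw [Finset.sum_congr rfl this]
    simp
    ring
  rw [h1, sub_neg_eq_add, sub_add_cancel]
  refine h0.hasSum.congr_fun fun n => ?_
  simp [convErr]

/-- As ∑ W = 0, each 1/Q_{n-m} may be replaced by its deviation from 1/Q_∞, which makes the double
series absolutely convergent. Summing over n first leaves a constant, killed by ∑ W = 0, and the
part -m/Q_∞. -/
lemma Fast.hasSum_convQ_of_tsum_eq_zero {W : ℕ → ℝ} (h : Fast W) (h0 : ∑' m, W m = 0) :
    HasSum (convQ W) (-(∑' m, m * W m) / QInf) := by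
  have hs : Summable fun p : ℕ × ℕ => W p.1 * convErr p.2 p.1 := by
    have h1 := (h.norm 2).mul_of_nonneg (summable_geometric_two.mul_left errConst)
      (fun m => by positivity) (fun n => mul_nonneg errConst_pos.le (by positivity))
    refine Summable.of_norm_bounded h1 fun p => ?_
    rw [norm_mul, Real.norm_eq_abs, Real.norm_eq_abs]
    calc |W p.1| * |convErr p.2 p.1| ≤ |W p.1| * (errConst * ((1 / 2) ^ p.2 * 2 ^ p.1)) :=
          mul_le_mul_of_nonneg_left (abs_convErr_le _ _) (abs_nonneg _)
      _ = _ := by ring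
  have h2 : HasSum (fun m => W m * ((∑' n, convErr n 0) - m / QInf))
      (∑' p : ℕ × ℕ, W p.1 * convErr p.2 p.1) :=
    hs.hasSum.prod_fiberwise fun m => (hasSum_convErr_left m).mul_left _
  have h3 : HasSum (convQ W) (∑' p : ℕ × ℕ, W p.1 * convErr p.2 p.1) := by
    have h4 := (Equiv.prodComm ℕ ℕ).hasSum_iff.mpr hs.hasSum
    have h5 := h4.prod_fiberwise (g := fun n => convQ W n) fun n => by
      have := hasSum_convErr h n
      rw [h0, zero_div, sub_zero] at this
      exact this
    exact h5
  have hm : Summable fun m : ℕ => (m : ℝ) * W m := by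
    refine Summable.of_norm_bounded (h.norm 2) fun m => ?_
    rw [norm_mul, Real.norm_eq_abs, Real.norm_eq_abs, Nat.abs_cast, mul_comm]
    refine mul_le_mul_of_nonneg_left ?_ (abs_nonneg _)
    exact_mod_cast Nat.lt_two_pow_self.le
  have h6 : HasSum (fun m => W m * ((∑' n, convErr n 0) - m / QInf))
      (-(∑' m, m * W m) / QInf) := by
    have h7 := (h.summable.hasSum.mul_right (∑' n, convErr n 0)).sub (hm.hasSum.mul_right (1 / QInf))
    rw [h0, zero_mul, zero_sub, mul_one_div, ← neg_div] at h7
    refine h7.congr_fun fun m => ?_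
    ring
  rw [← h2.unique h6]
  exact h3

/-! ### The average as a dyadic sum -/

/-- The three numbers are the limits of the convolutions with 1/Q_j; for `seriesOne` the limit is 0.
-/
def limLin : ℝ := (∑' n, seriesLin n) / QInf

def limQuad : ℝ := (∑' n, seriesQuad n) / QInf

def limCub : ℝ := (∑' n, seriesCub n) / QInf

/-- The linear growth coming from the exponentially small corrections. -/
def baseConst : ℝ := -(∑' m : ℕ, m * seriesOne m) / QInf

/-- The contribution of level `n` to the average, divided by `2^n`. -/
def levelTerm (N n : ℕ) : ℝ :=
  (convQ seriesLin n - convQ seriesOne n) *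
      (1 - (1 - (1 / 2) ^ n) ^ N - N * (1 / 2) ^ n * (1 - (1 / 2) ^ n) ^ (N - 1)) -
    convQ seriesOne n * (N * (1 / 2) ^ n * (1 - (1 / 2) ^ n) ^ (N - 1)) +
    convQ seriesQuad n * (N * (N - 1) * ((1 / 2) ^ n) ^ 2 * (1 - (1 / 2) ^ n) ^ (N - 2)) -
    convQ seriesCub n * (N * (N - 1) * (N - 2) * ((1 / 2) ^ n) ^ 3 * (1 - (1 / 2) ^ n) ^ (N - 3))

/-- The contribution of `2^{-nk}` to the transform. -/
def levelTransform (n k : ℕ) : ℝ :=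
  2 ^ n * (convQ seriesOne n - convQ seriesLin n) * ((1 / 2) ^ n) ^ k +
    2 ^ n * convQ seriesLin n * (k * ((1 / 2) ^ n) ^ k) +
    2 ^ n * convQ seriesQuad n * (k * (k - 1) * ((1 / 2) ^ n) ^ k) +
    2 ^ n * convQ seriesCub n * (k * (k - 1) * (k - 2) * ((1 / 2) ^ n) ^ k) +
    -(2 ^ n * (convQ seriesOne n - convQ seriesLin n)) * (if k = 0 then 1 else 0) +
    -convQ seriesOne n * (if k = 1 then 1 else 0)

lemma two_pow_mul_half_pow (n : ℕ) : (2 : ℝ) ^ n * (1 / 2) ^ n = 1 := by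
  rw [← mul_pow]
  norm_num

/-- `hasSum_transform` covers k ≥ 2 only, with 2^{-n(k-1)} rewritten as 2^n·2^{-nk} and κ = k-1. The
two indicator terms make every level vanish at k = 0 and k = 1, where t_k = 0. -/
lemma hasSum_levelTransform (k : ℕ) : HasSum (fun n => levelTransform n k) (transform k) := by
  rcases k with _ | _ | M
  · have : ∀ n, levelTransform n 0 = 0 := fun n => by simp [levelTransform]
    simp only [this]
    exact hasSum_zero
  · have : ∀ n, levelTransform n 1 = 0 := fun n => by
      have h := two_pow_mul_half_pow n
      simp only [levelTransform, pow_one, Nat.cast_one, sub_self, one_ne_zero, if_false,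
        if_true]
      linear_combination (convQ seriesOne n) * h
    have h1 : transform 1 = 0 := by simp [transform, source]
    simp only [zero_add, this, h1]
    exact hasSum_zero
  · refine (hasSum_transform M).congr_fun fun n => ?_
    have h := two_pow_mul_half_pow n
    have h2 : ((1 / 2 : ℝ) ^ (M + 1)) ^ n = ((1 / 2) ^ n) ^ (M + 1) := by
      rw [← pow_mul, ← pow_mul, mul_comm]
    rw [h2, levelTransform]
    generalize (1 / 2 : ℝ) ^ n = y at *
    have h3 : y ^ (M + 1 + 1) * 2 ^ n = y ^ (M + 1) := by
      rw [pow_succ]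
      linear_combination y ^ (M + 1) * h
    rw [← h3]
    simp
    ring

lemma binomTr_levelTransform (N n : ℕ) :
    binomTr 1 (levelTransform n) N = 2 ^ n * levelTerm N n + N * convQ seriesOne n := by
  have h : levelTransform n = fun k => levelTransform n k := rfl
  rw [h]
  simp only [levelTransform]
  rw [binomTr_add, binomTr_add, binomTr_add, binomTr_add, binomTr_add, binomTr_const_mul,
    binomTr_const_mul, binomTr_const_mul, binomTr_const_mul, binomTr_const_mul, binomTr_const_mul,
    binomTr_pow, binomTr_mul_pow, binomTr_mul_mul_pow, binomTr_mul_mul_mul_pow,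
    binomTr_indicator_zero, binomTr_indicator_one, levelTerm]
  ring

/-- The alternating transform is a finite combination, so it acts level by level. The indicator of k
= 1 contributes N times the convolution of `seriesOne`, whose sum over the levels is N·`baseConst`.
-/
theorem hasSum_levelTerm (N : ℕ) :
    HasSum (fun n => 2 ^ n * levelTerm N n) (averageProtected N - N * baseConst) := by
  have h1 := hasSum_binomTr 1 hasSum_levelTransform N
  rw [← averageProtected_eq_binomTr] at h1
  have h2 := (fast_seriesOne.hasSum_convQ_of_tsum_eq_zero tsum_seriesOne).mul_left (N : ℝ)
  refine (h1.sub h2).congr_fun fun n => ?_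
  rw [binomTr_levelTransform]
  ring

/-- The limiting contribution of a level. -/
def profile (u : ℝ) : ℝ :=
  limLin * (1 - (1 + u) * Real.exp (-u)) + limQuad * (u ^ 2 * Real.exp (-u)) -
    limCub * (u ^ 3 * Real.exp (-u))

/-! ### Error estimates -/

/-- A function with telescoping dyadic sums. -/
def bump (u : ℝ) : ℝ := u / ((1 + u) * (2 + u))

lemma bump_nonneg {u : ℝ} (hu : 0 ≤ u) : 0 ≤ bump u := by
  unfold bump
  positivity

lemma bump_eq {u : ℝ} (hu : 0 ≤ u) : bump u = u / (1 + u) - (u / 2) / (1 + u / 2) := by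
  unfold bump
  have h1 : 1 + u ≠ 0 := by positivity
  have h2 : 2 + u ≠ 0 := by positivity
  have h3 : 1 + u / 2 = (2 + u) / 2 := by ring
  rw [h3]
  field_simp
  ring

/-- The sum telescopes by `bump_eq`. The bound is uniform in x, which makes errors of this shape
O(1) over all levels whatever N is. -/
lemma sum_bump_le {x : ℝ} (hx : 0 ≤ x) (n : ℕ) :
    ∑ i ∈ Finset.range n, bump (x * (1 / 2) ^ i) ≤ 1 := by
  have h : ∑ i ∈ Finset.range n, bump (x * (1 / 2) ^ i) =
      x / (1 + x) - (x * (1 / 2) ^ n) / (1 + x * (1 / 2) ^ n) := by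
    induction n with
    | zero => simp
    | succ n ih =>
      rw [Finset.sum_range_succ, ih, bump_eq (by positivity), pow_succ]
      ring_nf
  rw [h]
  have h1 : x / (1 + x) ≤ 1 := by
    rw [div_le_one (by positivity)]
    linarith
  have h2 : 0 ≤ (x * (1 / 2) ^ n) / (1 + x * (1 / 2) ^ n) := by positivity
  linarith

lemma summable_bump {x : ℝ} (hx : 0 ≤ x) : Summable fun i : ℕ => bump (x * (1 / 2) ^ i) :=
  summable_of_sum_range_le (fun i => bump_nonneg (by positivity)) (sum_bump_le hx)

lemma tsum_bump_le {x : ℝ} (hx : 0 ≤ x) : ∑' i : ℕ, bump (x * (1 / 2) ^ i) ≤ 1 :=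
  Real.tsum_le_of_sum_range_le (fun i => bump_nonneg (by positivity)) (sum_bump_le hx)

/-- From (1+u)^5/120 ≤ e^{1+u} and e < 3 one gets (1+u)^5 ≤ 360 e^u; the polynomial inequality in
between costs a factor 2, whence 720. -/
lemma poly_mul_exp_le_bump {u : ℝ} (hu : 0 ≤ u) :
    (u + u ^ 2 + u ^ 3 + u ^ 4) * Real.exp (-u) ≤ 720 * bump u := by
  have h1 := Real.pow_div_factorial_le_exp (1 + u) (by linarith) 5
  rw [Real.exp_add] at h1
  have h2 : Real.exp 1 < 3 := Real.exp_one_lt_three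
  have h3 : (1 + u) ^ 5 ≤ 360 * Real.exp u := by
    have : ((5 : ℕ).factorial : ℝ) = 120 := by norm_num [Nat.factorial]
    rw [this, div_le_iff₀ (by norm_num)] at h1
    nlinarith [Real.exp_pos u]
  have h4 : (1 + u + u ^ 2 + u ^ 3) * ((1 + u) * (2 + u)) ≤ 2 * (1 + u) ^ 5 := by
    have : 2 * (1 + u) ^ 5 - (1 + u + u ^ 2 + u ^ 3) * ((1 + u) * (2 + u)) =
        5 * u + 14 * u ^ 2 + 14 * u ^ 3 + 6 * u ^ 4 + u ^ 5 := by ring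
    have h5 : 0 ≤ 5 * u + 14 * u ^ 2 + 14 * u ^ 3 + 6 * u ^ 4 + u ^ 5 := by positivity
    linarith
  rw [bump, mul_div_assoc', le_div_iff₀ (by positivity), Real.exp_neg]
  rw [show (u + u ^ 2 + u ^ 3 + u ^ 4) * (Real.exp u)⁻¹ * ((1 + u) * (2 + u)) =
    u * ((1 + u + u ^ 2 + u ^ 3) * ((1 + u) * (2 + u))) / Real.exp u by ring,
    div_le_iff₀ (Real.exp_pos u)]
  nlinarith

lemma exp_neg_le {y : ℝ} (hy : 0 ≤ y) : Real.exp (-y) ≤ 1 - y + y ^ 2 := by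
  rw [Real.exp_neg, inv_le_comm₀ (Real.exp_pos y) (by nlinarith [sq_nonneg (y - 1 / 2)])]
  refine le_trans ?_ (Real.add_one_le_exp y)
  rw [inv_le_comm₀ (by nlinarith [sq_nonneg (y - 1 / 2)]) (by linarith),
    inv_le_iff_one_le_mul₀ (by linarith)]
  nlinarith [pow_nonneg hy 3]

lemma exp_four_le : Real.exp 4 ≤ 81 := by
  have h : Real.exp 4 = Real.exp 1 ^ 4 := by
    rw [← Real.exp_nat_mul]
    norm_num
  have h2 : Real.exp 1 ≤ 3 := Real.exp_one_lt_three.le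
  rw [h]
  calc Real.exp 1 ^ 4 ≤ 3 ^ 4 := by gcongr
    _ = 81 := by norm_num

/-- The loss is e^{ry}, at most e^4 ≤ 81. The exponent 4 rather than 3 is shared with the next
lemma, where one further factor is removed from the power. -/
lemma one_sub_pow_le {y : ℝ} (h1 : y ≤ 1) {N r : ℕ} (hr : r ≤ 3) (hN : 4 ≤ N) :
    (1 - y) ^ (N - r) ≤ 81 * Real.exp (-(N * y)) := by
  have h2 : (1 - y) ^ (N - r) ≤ Real.exp (-y) ^ (N - r) := by
    refine pow_le_pow_left₀ (by linarith) ?_ _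
    linarith [Real.add_one_le_exp (-y)]
  refine h2.trans ?_
  rw [← Real.exp_nat_mul]
  have h3 : ((N - r : ℕ) : ℝ) * -y = r * y + -(N * y) := by
    rw [Nat.cast_sub (by omega)]
    ring
  rw [h3, Real.exp_add]
  have hr' : (r : ℝ) ≤ 3 := by exact_mod_cast hr
  have h4 : Real.exp (r * y) ≤ Real.exp 4 := by
    gcongr
    nlinarith
  nlinarith [exp_four_le, Real.exp_pos (-(N * y))]

lemma abs_one_sub_pow_sub_exp_le {y : ℝ} (h0 : 0 ≤ y) (h1 : y ≤ 1) {N r : ℕ} (hr : r ≤ 3)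
    (hN : 4 ≤ N) :
    |(1 - y) ^ (N - r) - Real.exp (-(N * y))| ≤
      81 * y * ((N * y + r) * Real.exp (-(N * y))) := by
  have hr' : (r : ℝ) ≤ 3 := by exact_mod_cast hr
  have hE := Real.exp_pos (-(N * y))
  have h2 : Real.exp (-y) ^ (N - r) = Real.exp (r * y) * Real.exp (-(N * y)) := by
    rw [← Real.exp_nat_mul, ← Real.exp_add, Nat.cast_sub (by omega)]
    ring_nf
  have h3 : |(1 - y) ^ (N - r) - Real.exp (-y) ^ (N - r)| ≤
      81 * y * (N * y * Real.exp (-(N * y))) := by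
    have h4 := abs_pow_sub_pow_le (1 - y) (Real.exp (-y)) (N - r)
    have h5 : max |1 - y| |Real.exp (-y)| = Real.exp (-y) := by
      rw [abs_of_nonneg (by linarith), abs_of_pos (Real.exp_pos _), max_eq_right]
      linarith [Real.add_one_le_exp (-y)]
    have h6 : |1 - y - Real.exp (-y)| ≤ y ^ 2 := by
      rw [abs_le]
      constructor <;> linarith [Real.add_one_le_exp (-y), exp_neg_le h0, sq_nonneg y]
    have h7 : Real.exp (-y) ^ (N - r - 1) ≤ 81 * Real.exp (-(N * y)) := by
      rw [← Real.exp_nat_mul]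
      have h8 : ((N - r - 1 : ℕ) : ℝ) * -y = (r + 1) * y + -(N * y) := by
        rw [Nat.sub_sub, Nat.cast_sub (by omega)]
        push_cast
        ring
      rw [h8, Real.exp_add]
      have h4 : Real.exp ((r + 1) * y) ≤ Real.exp 4 := by
        gcongr
        nlinarith
      nlinarith [exp_four_le]
    have h9 : ((N - r : ℕ) : ℝ) ≤ N := by exact_mod_cast Nat.sub_le N r
    rw [h5] at h4
    refine h4.trans ?_
    calc |1 - y - Real.exp (-y)| * ((N - r : ℕ) : ℝ) * Real.exp (-y) ^ (N - r - 1)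
        ≤ y ^ 2 * N * (81 * Real.exp (-(N * y))) := by gcongr
      _ = _ := by ring
  have h4 : |Real.exp (-y) ^ (N - r) - Real.exp (-(N * y))| ≤
      81 * y * (r * Real.exp (-(N * y))) := by
    have h5 : 1 ≤ Real.exp (r * y) := Real.one_le_exp (by positivity)
    rw [h2, show Real.exp (r * y) * Real.exp (-(N * y)) - Real.exp (-(N * y)) =
      (Real.exp (r * y) - 1) * Real.exp (-(N * y)) by ring,
      abs_of_nonneg (mul_nonneg (by linarith) hE.le)]
    have h6 : Real.exp (r * y) - 1 ≤ r * y * Real.exp (r * y) := by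
      have := Real.add_one_le_exp (-(r * y))
      rw [Real.exp_neg] at this
      have h7 := Real.exp_pos (r * y)
      have h8 : (Real.exp (r * y))⁻¹ * Real.exp (r * y) = 1 := inv_mul_cancel₀ h7.ne'
      nlinarith
    have h7 : Real.exp (r * y) ≤ 81 := by
      refine le_trans ?_ exp_four_le
      gcongr
      nlinarith
    have h8 : Real.exp (r * y) - 1 ≤ 81 * y * r := by
      have : 0 ≤ r * y := by positivity
      nlinarith
    calc (Real.exp (r * y) - 1) * Real.exp (-(N * y)) ≤ 81 * y * r * Real.exp (-(N * y)) := by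
          gcongr
      _ = _ := by ring
  calc |(1 - y) ^ (N - r) - Real.exp (-(N * y))|
      ≤ |(1 - y) ^ (N - r) - Real.exp (-y) ^ (N - r)| +
        |Real.exp (-y) ^ (N - r) - Real.exp (-(N * y))| := abs_sub_le _ _ _
    _ ≤ _ := by linarith

/-- Replacing a coefficient and a factor by nearby ones. -/
lemma abs_mul_sub_mul_le {X X' a a' δ η M : ℝ} (hX : |X - X'| ≤ δ) (ha : |a - a'| ≤ η)
    (hM : |a| ≤ M) : |X * a - X' * a'| ≤ δ * M + |X'| * η := by
  have h : X * a - X' * a' = (X - X') * a + X' * (a - a') := by ring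
  rw [h]
  refine (abs_add_le _ _).trans ?_
  rw [abs_mul, abs_mul]
  have := (abs_nonneg (X - X')).trans hX
  gcongr

lemma convQ_sub (V W : ℕ → ℝ) (n : ℕ) :
    convQ (fun m => V m - W m) n = convQ V n - convQ W n := by
  simp only [convQ, sub_mul, Finset.sum_sub_distrib]

lemma Fast.neg {W : ℕ → ℝ} (h : Fast W) : Fast fun n => -W n := by
  intro r
  simpa using (h r).neg

/-- This quadratic rate is where `tsum_seriesOne_two` enters. In `levelTerm` the difference
multiplies a factor that tends to 1 on the levels with 2^n much smaller than N. After scaling by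
2^n, a linear rate would allow a bounded error on each of about log_2 N levels. -/
lemma exists_abs_convQ_lin_sub_one_le :
    ∃ K : ℝ, ∀ n, |convQ seriesLin n - convQ seriesOne n - limLin| ≤ K * ((1 / 2) ^ n) ^ 2 := by
  have hf : Fast fun m => seriesLin m - seriesOne m := by
    simpa [sub_eq_add_neg] using fast_seriesLin.add fast_seriesOne.neg
  have h0 : ∑' m, (seriesLin m - seriesOne m) * 2 ^ m = 0 := by
    simp only [sub_mul]
    rw [(fast_seriesLin 2).tsum_sub (fast_seriesOne 2), tsum_seriesOne_two, sub_self]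
  have h1 : ∑' m, (seriesLin m - seriesOne m) = ∑' m, seriesLin m := by
    rw [fast_seriesLin.summable.tsum_sub fast_seriesOne.summable, tsum_seriesOne, sub_zero]
  refine ⟨errConst * ∑' m, |seriesLin m - seriesOne m| * 4 ^ m, fun n => ?_⟩
  have h2 := hf.abs_convQ_sub_le' h0 n
  rw [h1, convQ_sub] at h2
  have h3 : ((1 / 2 : ℝ) ^ n) ^ 2 = (1 / 4) ^ n := by
    rw [← pow_mul, mul_comm, pow_mul]
    norm_num
  rw [h3]
  exact h2

lemma exists_abs_convQ_one_le : ∃ K : ℝ, ∀ n, |convQ seriesOne n| ≤ K * (1 / 2) ^ n := by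
  refine ⟨errConst * ∑' m, |seriesOne m| * 2 ^ m, fun n => ?_⟩
  have := fast_seriesOne.abs_convQ_sub_le n
  rw [tsum_seriesOne, zero_div, sub_zero] at this
  exact this

/-- The difference between a level and its limiting profile. -/
lemma exists_abs_levelTerm_sub_profile_le :
    ∃ C : ℝ, 0 ≤ C ∧ ∀ N n : ℕ, 4 ≤ N → |levelTerm N n - profile (N * (1 / 2) ^ n)| ≤
      (1 / 2) ^ n * (C * (bump (N * (1 / 2) ^ n) + (1 / 2) ^ n)) := by
  obtain ⟨K1, hK1⟩ := exists_abs_convQ_lin_sub_one_le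
  obtain ⟨K0, hK0⟩ := exists_abs_convQ_one_le
  have hK2 := fun n => fast_seriesQuad.abs_convQ_sub_le n
  have hK3 := fun n => fast_seriesCub.abs_convQ_sub_le n
  set K2 := errConst * ∑' m, |seriesQuad m| * 2 ^ m
  set K3 := errConst * ∑' m, |seriesCub m| * 2 ^ m
  have k0 : 0 ≤ K0 := by simpa using (abs_nonneg _).trans (hK0 0)
  have k1 : 0 ≤ K1 := by simpa using (abs_nonneg _).trans (hK1 0)
  have k2 : 0 ≤ K2 := by simpa using (abs_nonneg _).trans (hK2 0)
  have k3 : 0 ≤ K3 := by simpa using (abs_nonneg _).trans (hK3 0)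
  refine ⟨163 * K1 + |limLin| * (243 * 720) + K0 * (81 * 720) +
    (K2 * (81 * 720) + |limQuad| * (244 * 720)) + (K3 * (81 * 720) + |limCub| * (327 * 720)),
    by positivity, fun N n hN => ?_⟩
  specialize hK0 n
  specialize hK1 n
  specialize hK2 n
  specialize hK3 n
  have hy0 : (0 : ℝ) < (1 / 2) ^ n := by positivity
  have hy1 := half_pow_le_one n
  unfold levelTerm profile
  generalize (1 / 2 : ℝ) ^ n = y at *
  have hN' : (4 : ℝ) ≤ N := by exact_mod_cast hN
  have p0 := abs_one_sub_pow_sub_exp_le hy0.le hy1 (r := 0) (by norm_num) hN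
  have p1 := abs_one_sub_pow_sub_exp_le hy0.le hy1 (r := 1) (by norm_num) hN
  have p2 := abs_one_sub_pow_sub_exp_le hy0.le hy1 (r := 2) (by norm_num) hN
  have p3 := abs_one_sub_pow_sub_exp_le hy0.le hy1 (r := 3) (by norm_num) hN
  have q0 := one_sub_pow_le hy1 (r := 0) (by norm_num) hN
  have q1 := one_sub_pow_le hy1 (r := 1) (by norm_num) hN
  have q2 := one_sub_pow_le hy1 (r := 2) (by norm_num) hN
  have q3 := one_sub_pow_le hy1 (r := 3) (by norm_num) hN
  have z : (0 : ℝ) ≤ 1 - y := by linarith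
  have z0 : 0 ≤ (1 - y) ^ (N - 0) := pow_nonneg z _
  have z1 : 0 ≤ (1 - y) ^ (N - 1) := pow_nonneg z _
  have z2 : 0 ≤ (1 - y) ^ (N - 2) := pow_nonneg z _
  have z3 : 0 ≤ (1 - y) ^ (N - 3) := pow_nonneg z _
  rw [Nat.sub_zero] at p0 q0 z0
  push_cast at p0 p1 p2 p3
  -- After u = Ny is generalized, N ≥ 4 survives as 4y ≤ u, which makes u - y and u - 2y
  -- nonnegative.
  have hu4 : 4 * y ≤ N * y := mul_le_mul_of_nonneg_right hN' hy0.le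
  have hsplit2 : (N : ℝ) * (N - 1) * y ^ 2 = N * y * (N * y - y) := by ring
  have hsplit3 : (N : ℝ) * (N - 1) * (N - 2) * y ^ 3 = N * y * ((N * y - y) * (N * y - 2 * y)) := by
    ring
  rw [hsplit2, hsplit3]
  generalize (N : ℝ) * y = u at *
  have hu : 0 ≤ u := by linarith
  have hb := poly_mul_exp_le_bump hu
  have hb0 := bump_nonneg hu
  have hE := Real.exp_pos (-u)
  have hE1 : Real.exp (-u) ≤ 1 := Real.exp_le_one_iff.mpr (by linarith)
  have huE : u * Real.exp (-u) ≤ 1 := by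
    rw [Real.exp_neg, ← div_eq_mul_inv, div_le_one (Real.exp_pos u)]
    linarith [Real.add_one_le_exp u]
  generalize bump u = φ at *
  generalize Real.exp (-u) = E at *
  generalize (1 - y) ^ N = P0 at *
  generalize (1 - y) ^ (N - 1) = P1 at *
  generalize (1 - y) ^ (N - 2) = P2 at *
  generalize (1 - y) ^ (N - 3) = P3 at *
  have e1 : 0 ≤ u * E := by positivity
  have e2 : 0 ≤ u ^ 2 * E := by positivity
  have e3 : 0 ≤ u ^ 3 * E := by positivity
  have e4 : 0 ≤ u ^ 4 * E := by positivity
  have b1 : u * E ≤ 720 * φ := by linarith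
  have b2 : u ^ 2 * E ≤ 720 * φ := by linarith
  have b3 : u ^ 3 * E ≤ 720 * φ := by linarith
  have b4 : u ^ 4 * E ≤ 720 * φ := by linarith
  -- Here 163 = 1 + 81 + 81 bounds the factor itself, without decay in u; it is affordable because
  -- it comes with y². All other errors carry y times the bump.
  have t1 : |(convQ seriesLin n - convQ seriesOne n) * (1 - P0 - u * P1) -
      limLin * (1 - (1 + u) * E)| ≤
      K1 * y ^ 2 * 163 + |limLin| * (y * (243 * 720 * φ)) := by
    refine abs_mul_sub_mul_le hK1 ?_ ?_
    · have h1 : 1 - P0 - u * P1 - (1 - (1 + u) * E) = -(P0 - E) - u * (P1 - E) := by ring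
      have h2 : |u * (P1 - E)| ≤ u * (81 * y * ((u + 1) * E)) := by
        rw [abs_mul, abs_of_nonneg hu]
        gcongr
      rw [h1]
      refine (abs_sub _ _).trans ?_
      rw [abs_neg]
      have h3 : y * (81 * (2 * (u * E) + u ^ 2 * E)) ≤ y * (81 * (3 * (720 * φ))) := by
        gcongr
        linarith
      linarith
    · have h2 : u * P1 ≤ u * (81 * E) := by gcongr
      have h3 : 0 ≤ u * P1 := by positivity
      rw [abs_le]
      constructor <;> linarith
  have t0 : |convQ seriesOne n * (u * P1)| ≤ K0 * y * (81 * 720 * φ) := by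
    rw [abs_mul, abs_of_nonneg (show 0 ≤ u * P1 by positivity)]
    have h2 : u * P1 ≤ u * (81 * E) := by gcongr
    have h3 : u * P1 ≤ 81 * 720 * φ := by linarith
    gcongr
  have hu1 : 0 ≤ u - y := by linarith
  have hu2 : 0 ≤ u - 2 * y := by linarith
  have t2 : |convQ seriesQuad n * (u * (u - y) * P2) - limQuad * (u ^ 2 * E)| ≤
      K2 * y * (81 * 720 * φ) + |limQuad| * (y * (244 * 720 * φ)) := by
    have h0 : u * (u - y) ≤ u ^ 2 := by nlinarith
    refine abs_mul_sub_mul_le hK2 ?_ ?_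
    · have h1 : u * (u - y) * P2 - u ^ 2 * E = u * (u - y) * (P2 - E) - y * (u * E) := by ring
      have h2 : |u * (u - y) * (P2 - E)| ≤ u ^ 2 * (81 * y * ((u + 2) * E)) := by
        rw [abs_mul, abs_of_nonneg (by positivity)]
        gcongr
      rw [h1]
      refine (abs_sub _ _).trans ?_
      rw [abs_of_nonneg (show 0 ≤ y * (u * E) by positivity)]
      have h3 : y * (81 * (u ^ 3 * E) + 162 * (u ^ 2 * E) + u * E) ≤
          y * (81 * (720 * φ) + 162 * (720 * φ) + 720 * φ) := by gcongr
      linarith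
    · rw [abs_of_nonneg (by positivity)]
      have : u * (u - y) * P2 ≤ u ^ 2 * (81 * E) := by gcongr
      linarith
  have t3 : |convQ seriesCub n * (u * ((u - y) * (u - 2 * y)) * P3) - limCub * (u ^ 3 * E)| ≤
      K3 * y * (81 * 720 * φ) + |limCub| * (y * (327 * 720 * φ)) := by
    have h00 : (u - y) * (u - 2 * y) ≤ u * u := by
      apply mul_le_mul <;> linarith
    have h0 : u * ((u - y) * (u - 2 * y)) ≤ u ^ 3 := by
      calc u * ((u - y) * (u - 2 * y)) ≤ u * (u * u) := by gcongr
        _ = u ^ 3 := by ring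
    refine abs_mul_sub_mul_le hK3 ?_ ?_
    · have h1 : u * ((u - y) * (u - 2 * y)) * P3 - u ^ 3 * E =
          u * ((u - y) * (u - 2 * y)) * (P3 - E) - y * ((3 * u - 2 * y) * (u * E)) := by ring
      have h2 : |u * ((u - y) * (u - 2 * y)) * (P3 - E)| ≤ u ^ 3 * (81 * y * ((u + 3) * E)) := by
        rw [abs_mul, abs_of_nonneg (by positivity)]
        gcongr
      rw [h1]
      refine (abs_sub _ _).trans ?_
      have h5 : 0 ≤ 3 * u - 2 * y := by linarith
      rw [abs_of_nonneg (show 0 ≤ y * ((3 * u - 2 * y) * (u * E)) by positivity)]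
      have h6 : y * ((3 * u - 2 * y) * (u * E)) ≤ y * (3 * u * (u * E)) := by
        gcongr
        linarith
      have h3 : y * (81 * (u ^ 4 * E) + 243 * (u ^ 3 * E) + 3 * (u ^ 2 * E)) ≤
          y * (81 * (720 * φ) + 243 * (720 * φ) + 3 * (720 * φ)) := by gcongr
      linarith
    · rw [abs_of_nonneg (by positivity)]
      have : u * ((u - y) * (u - 2 * y)) * P3 ≤ u ^ 3 * (81 * E) := by gcongr
      linarith
  have hsum : ∀ a b c d a' c' d' : ℝ, |a - b + c - d - (a' + c' - d')| ≤
      |a - a'| + |b| + |c - c'| + |d - d'| := by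
    intro a b c d a' c' d'
    have : a - b + c - d - (a' + c' - d') = (a - a') - b + (c - c') - (d - d') := by ring
    rw [this]
    exact (abs_sub _ _).trans (add_le_add_left ((abs_add_le _ _).trans
      (add_le_add_left (abs_sub _ _) _)) _)
  refine (hsum _ _ _ _ _ _ _).trans ?_
  have r1 : 0 ≤ y * φ := by positivity
  have r2 : 0 ≤ y ^ 2 := by positivity
  have c1 : 0 ≤ (|limLin| * (243 * 720) + K0 * (81 * 720) +
    (K2 * (81 * 720) + |limQuad| * (244 * 720)) + (K3 * (81 * 720) + |limCub| * (327 * 720))) *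
      y ^ 2 := by positivity
  have c2 : 0 ≤ 163 * K1 * (y * φ) := by positivity
  linarith

/-- The average number of 2-protected nodes is a linear function plus a dyadic sum of profiles, up
to a bounded error. -/
theorem exists_abs_averageProtected_sub_le :
    ∃ C : ℝ, ∀ N : ℕ, 4 ≤ N → Summable (fun n : ℕ => 2 ^ n * profile (N * (1 / 2) ^ n)) ∧
      |averageProtected N - N * baseConst - ∑' n : ℕ, 2 ^ n * profile (N * (1 / 2) ^ n)| ≤ C := by
  obtain ⟨C, hC, h⟩ := exists_abs_levelTerm_sub_profile_le
  refine ⟨C * 3, fun N hN => ?_⟩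
  have hb := summable_bump (x := N) (by positivity)
  have hs := (hb.add summable_geometric_two).mul_left C
  have hle : ∀ n : ℕ, ‖2 ^ n * levelTerm N n - 2 ^ n * profile (N * (1 / 2) ^ n)‖ ≤
      C * (bump (N * (1 / 2) ^ n) + (1 / 2) ^ n) := by
    intro n
    rw [← mul_sub, norm_mul, Real.norm_eq_abs, Real.norm_eq_abs, abs_of_pos (by positivity)]
    calc 2 ^ n * |levelTerm N n - profile (N * (1 / 2) ^ n)|
        ≤ 2 ^ n * ((1 / 2) ^ n * (C * (bump (N * (1 / 2) ^ n) + (1 / 2) ^ n))) := by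
          gcongr
          exact h N n hN
      _ = _ := by rw [← mul_assoc, two_pow_mul_half_pow, one_mul]
  have hd := Summable.of_norm_bounded hs hle
  have h1 := hasSum_levelTerm N
  have h2 := h1.sub hd.hasSum
  simp only [sub_sub_cancel] at h2
  refine ⟨h2.summable, ?_⟩
  rw [h2.tsum_eq, sub_sub_cancel]
  refine (tsum_of_norm_bounded hs.hasSum hle).trans ?_
  rw [tsum_mul_left, hb.tsum_add summable_geometric_two, tsum_geometric_two]
  have := tsum_bump_le (x := N) (by positivity)
  gcongr
  linarith

end DST

namespace DST

open MeasureTheory Set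
open scoped FourierTransform

/-! ### The Mellin transform of the profile -/

lemma hasMellin_pow_mul_exp (r : ℕ) {s : ℂ} (hs : 0 < (s + r).re) :
    HasMellin (fun u : ℝ => ((u ^ r * Real.exp (-u) : ℝ) : ℂ)) s (Complex.Gamma (s + r)) := by
  have h : ∀ u ∈ Ioi (0 : ℝ), (Real.exp (-u) : ℂ) * (u : ℂ) ^ (s + r - 1) =
      (u : ℂ) ^ (s - 1) • ((u ^ r * Real.exp (-u) : ℝ) : ℂ) := by
    intro u hu
    have hu0 : (u : ℂ) ≠ 0 := by exact_mod_cast (mem_Ioi.mp hu).ne'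
    rw [show s + r - 1 = (s - 1) + r by ring, Complex.cpow_add _ _ hu0, Complex.cpow_natCast,
      smul_eq_mul]
    push_cast
    ring
  constructor
  · exact (Complex.GammaIntegral_convergent hs).congr_fun h measurableSet_Ioi
  · rw [Complex.Gamma_eq_integral hs, Complex.GammaIntegral, mellin]
    exact (setIntegral_congr_fun measurableSet_Ioi h).symm

lemma one_sub_one_add_mul_exp_nonneg (u : ℝ) : 0 ≤ 1 - (1 + u) * Real.exp (-u) := by
  have h := Real.add_one_le_exp u
  have h1 : Real.exp u * Real.exp (-u) = 1 := by rw [← Real.exp_add]; simp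
  nlinarith [Real.exp_pos (-u)]

lemma one_sub_one_add_mul_exp_le_one {u : ℝ} (hu : 0 ≤ u) :
    1 - (1 + u) * Real.exp (-u) ≤ 1 := by
  have : 0 ≤ (1 + u) * Real.exp (-u) := by positivity
  linarith

lemma one_sub_one_add_mul_exp_le_sq {u : ℝ} (hu : 0 ≤ u) :
    1 - (1 + u) * Real.exp (-u) ≤ u ^ 2 := by
  have h := Real.add_one_le_exp (-u)
  nlinarith

lemma hasDerivAt_one_sub_one_add_mul_exp (u : ℝ) :
    HasDerivAt (fun u : ℝ => 1 - (1 + u) * Real.exp (-u)) (u * Real.exp (-u)) u := by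
  have h1 : HasDerivAt (fun u : ℝ => Real.exp (-u)) (Real.exp (-u) * -1) u :=
    (hasDerivAt_neg u).exp
  have h2 : HasDerivAt (fun u : ℝ => 1 + u) 1 u := (hasDerivAt_id u).const_add 1
  convert! (h2.mul h1).const_sub 1 using 1
  ring

/-- Integration by parts: the derivative is u e^{-u}, which leaves -1/s times the Gamma integral at
s+2. On the line Re s = -1 one has |u^s| = 1/u, so the boundary terms vanish because the function is
at most u² near 0 and at most 1 at infinity. -/
lemma hasMellin_one_sub_one_add_mul_exp {s : ℂ} (hs : s.re = -1) :
    HasMellin (fun u : ℝ => ((1 - (1 + u) * Real.exp (-u) : ℝ) : ℂ)) s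
      (-Complex.Gamma (s + 2) / s) := by
  have hs0 : s ≠ 0 := by
    rintro rfl
    norm_num at hs
  have hconv : MellinConvergent (fun u : ℝ => ((1 - (1 + u) * Real.exp (-u) : ℝ) : ℂ)) s := by
    refine mellinConvergent_of_isBigO_rpow (a := 0) (b := -2) ?_ ?_ ?_ ?_ ?_
    · exact (Continuous.continuousOn (by fun_prop)).locallyIntegrableOn measurableSet_Ioi
    · refine IsBigO.of_bound 1 ?_
      filter_upwards [eventually_ge_atTop 0] with u hu
      rw [Complex.norm_real, Real.norm_eq_abs, abs_of_nonneg (one_sub_one_add_mul_exp_nonneg u)]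
      simpa using one_sub_one_add_mul_exp_le_one hu
    · rw [hs]
      norm_num
    · refine IsBigO.of_bound 1 ?_
      filter_upwards [self_mem_nhdsWithin] with u hu
      rw [Complex.norm_real, Real.norm_eq_abs, abs_of_nonneg (one_sub_one_add_mul_exp_nonneg u)]
      simpa using one_sub_one_add_mul_exp_le_sq (mem_Ioi.mp hu).le
    · rw [hs]
      norm_num
  refine ⟨hconv, ?_⟩
  have hG := hasMellin_pow_mul_exp 2 (s := s) (by simp [hs])
  have hv : ∀ u ∈ Ioi (0 : ℝ), HasDerivAt (fun u : ℝ => (u : ℂ) ^ s / s) ((u : ℂ) ^ (s - 1)) u := by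
    intro u hu
    have h := hasDerivAt_ofReal_cpow_const' (x := u) (r := s - 1) (mem_Ioi.mp hu).ne'
      (by simpa [sub_eq_iff_eq_add] using hs0)
    simpa using h
  have hpow : ∀ u ∈ Ioi (0 : ℝ), (((u * Real.exp (-u) : ℝ) : ℂ)) * ((u : ℂ) ^ s / s) =
      ((u : ℂ) ^ (s - 1) • ((u ^ 2 * Real.exp (-u) : ℝ) : ℂ)) * s⁻¹ := by
    intro u hu
    have hu0 : (u : ℂ) ≠ 0 := by exact_mod_cast (mem_Ioi.mp hu).ne'
    rw [Complex.cpow_sub _ _ hu0, Complex.cpow_one, smul_eq_mul]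
    push_cast
    field_simp
  have hnorm : ∀ u : ℝ, 0 < u → ‖(u : ℂ) ^ s‖ = u⁻¹ := by
    intro u hu
    rw [Complex.norm_cpow_eq_rpow_re_of_pos hu, hs, Real.rpow_neg_one]
  have key := integral_Ioi_mul_deriv_eq_deriv_mul (a := 0) (a' := (0 : ℂ)) (b' := (0 : ℂ))
    (u := fun u : ℝ => ((1 - (1 + u) * Real.exp (-u) : ℝ) : ℂ))
    (u' := fun u : ℝ => ((u * Real.exp (-u) : ℝ) : ℂ)) (v := fun u : ℝ => (u : ℂ) ^ s / s)
    (v' := fun u : ℝ => (u : ℂ) ^ (s - 1))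
    (fun u _ => (hasDerivAt_one_sub_one_add_mul_exp u).ofReal_comp) hv ?_ ?_ ?_ ?_
  · rw [mellin]
    have h1 : ∫ u in Ioi (0 : ℝ), (((u * Real.exp (-u) : ℝ) : ℂ)) * ((u : ℂ) ^ s / s) =
        Complex.Gamma (s + 2) * s⁻¹ := by
      rw [setIntegral_congr_fun measurableSet_Ioi hpow, integral_mul_const]
      congr 1
      exact_mod_cast hG.2
    rw [h1, sub_zero, zero_sub] at key
    rw [neg_div, div_eq_mul_inv, ← key]
    refine setIntegral_congr_fun measurableSet_Ioi fun u _ => ?_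
    rw [smul_eq_mul, mul_comm]
  · refine hconv.congr_fun (fun u _ => ?_) measurableSet_Ioi
    simp only [smul_eq_mul, Pi.mul_apply]
    ring
  · refine IntegrableOn.congr_fun (hG.1.mul_const s⁻¹) (fun u hu => ?_) measurableSet_Ioi
    exact (hpow u hu).symm
  · rw [tendsto_zero_iff_norm_tendsto_zero]
    have h1 : Tendsto (fun u : ℝ => u * ‖s‖⁻¹) (𝓝[>] 0) (𝓝 (0 * ‖s‖⁻¹)) :=
      ((tendsto_id.mono_right nhdsWithin_le_nhds).mul_const _ : Tendsto _ (𝓝[>] (0 : ℝ)) _)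
    rw [zero_mul] at h1
    refine squeeze_zero' (Eventually.of_forall fun _ => norm_nonneg _) ?_ h1
    filter_upwards [self_mem_nhdsWithin] with u hu
    have hu' : 0 < u := hu
    rw [Pi.mul_apply, norm_mul, norm_div, hnorm u hu', Complex.norm_real, Real.norm_eq_abs,
      abs_of_nonneg (one_sub_one_add_mul_exp_nonneg u)]
    calc (1 - (1 + u) * Real.exp (-u)) * (u⁻¹ / ‖s‖) ≤ u ^ 2 * (u⁻¹ / ‖s‖) := by
          gcongr
          exact one_sub_one_add_mul_exp_le_sq hu'.le
      _ = u * ‖s‖⁻¹ := by field_simp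
  · rw [tendsto_zero_iff_norm_tendsto_zero]
    have h1 : Tendsto (fun u : ℝ => u⁻¹ * ‖s‖⁻¹) atTop (𝓝 (0 * ‖s‖⁻¹)) :=
      tendsto_inv_atTop_zero.mul_const _
    rw [zero_mul] at h1
    refine squeeze_zero' (Eventually.of_forall fun _ => norm_nonneg _) ?_ h1
    filter_upwards [eventually_gt_atTop 0] with u hu
    rw [Pi.mul_apply, norm_mul, norm_div, hnorm u hu, Complex.norm_real, Real.norm_eq_abs,
      abs_of_nonneg (one_sub_one_add_mul_exp_nonneg u), ← div_eq_mul_inv]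
    exact mul_le_of_le_one_left (by positivity) (one_sub_one_add_mul_exp_le_one hu.le)

/-- The Fourier coefficient in terms of `χ`, up to the factor `Γ(1 - χ) / log 2`. -/
def fourierFactor (χ : ℂ) : ℂ := limLin / (1 + χ) + limQuad - limCub * (1 - χ)

lemma mellin_profile {χ : ℂ} (hχ : χ.re = 0) :
    mellin (fun u : ℝ => (profile u : ℂ)) (-1 - χ) = Complex.Gamma (1 - χ) * fourierFactor χ := by
  have hre : (-1 - χ).re = -1 := by simp [hχ]
  have h0 := hasMellin_one_sub_one_add_mul_exp hre
  have h2 := hasMellin_pow_mul_exp 2 (s := -1 - χ) (by simp [hχ])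
  have h3 := hasMellin_pow_mul_exp 3 (s := -1 - χ) (by simp [hχ])
  have g0 := hasMellin_const_smul h0.1 (limLin : ℂ)
  have g2 := hasMellin_const_smul h2.1 (limQuad : ℂ)
  have g3 := hasMellin_const_smul h3.1 (limCub : ℂ)
  have g := hasMellin_sub (hasMellin_add g0.1 g2.1).1 g3.1
  rw [(hasMellin_add g0.1 g2.1).2, g0.2, g2.2, g3.2, h0.2, h2.2, h3.2] at g
  have e : (fun u : ℝ => (profile u : ℂ)) = fun t : ℝ =>
      (limLin : ℂ) • ((1 - (1 + t) * Real.exp (-t) : ℝ) : ℂ) +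
        (limQuad : ℂ) • ((t ^ 2 * Real.exp (-t) : ℝ) : ℂ) -
        (limCub : ℂ) • ((t ^ 3 * Real.exp (-t) : ℝ) : ℂ) := by
    funext t
    simp only [profile, smul_eq_mul]
    push_cast
    ring
  have hne : (1 : ℂ) - χ ≠ 0 := by
    intro h
    have := congrArg Complex.re h
    simp [hχ] at this
  have hne' : (1 : ℂ) + χ ≠ 0 := by
    intro h
    have := congrArg Complex.re h
    simp [hχ] at this
  have hne2 : (-1 : ℂ) - χ ≠ 0 := by
    intro h
    have := congrArg Complex.re h
    simp [hχ] at this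
  have e2 : (-1 - χ + 2 : ℂ) = 1 - χ := by ring
  have e3 : (-1 - χ + 3 : ℂ) = (1 - χ) + 1 := by ring
  rw [e, g.2, fourierFactor]
  push_cast
  rw [e2, e3, Complex.Gamma_add_one _ hne, show (-1 - χ : ℂ) = -(1 + χ) by ring, smul_eq_mul,
    smul_eq_mul, smul_eq_mul, neg_div_neg_eq]
  ring

/-! ### The periodic function -/

/-- The profile in logarithmic scale. -/
def wave (x : ℝ) : ℝ := Real.exp (-(x * Real.log 2)) * profile (Real.exp (x * Real.log 2))

lemma continuous_profile : Continuous profile := by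
  unfold profile
  fun_prop

lemma continuous_wave : Continuous wave := by
  unfold wave
  exact (by fun_prop : Continuous fun x : ℝ => Real.exp (-(x * Real.log 2))).mul
    (continuous_profile.comp (by fun_prop))

/-- The weights 1, 2! and 3! bound 1-(1+u)e^{-u}, u²e^{-u} and u³e^{-u} on u ≥ 0. -/
def profileBound : ℝ := |limLin| + 2 * |limQuad| + 6 * |limCub|

lemma profileBound_nonneg : 0 ≤ profileBound := by unfold profileBound; positivity

lemma abs_profile_le_of {u a : ℝ} (h0 : |1 - (1 + u) * Real.exp (-u)| ≤ a)
    (h2 : |u ^ 2 * Real.exp (-u)| ≤ 2 * a) (h3 : |u ^ 3 * Real.exp (-u)| ≤ 6 * a) :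
    |profile u| ≤ profileBound * a := by
  unfold profile profileBound
  refine (abs_sub _ _).trans ((add_le_add_left (abs_add_le _ _) _).trans ?_)
  rw [abs_mul limLin, abs_mul limQuad, abs_mul limCub]
  have e0 := mul_le_mul_of_nonneg_left h0 (abs_nonneg limLin)
  have e2 := mul_le_mul_of_nonneg_left h2 (abs_nonneg limQuad)
  have e3 := mul_le_mul_of_nonneg_left h3 (abs_nonneg limCub)
  linarith

lemma abs_profile_le {u : ℝ} (hu : 0 ≤ u) : |profile u| ≤ profileBound := by
  have h2 := Real.pow_div_factorial_le_exp u hu 2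
  have h3 := Real.pow_div_factorial_le_exp u hu 3
  have f2 : ((2 : ℕ).factorial : ℝ) = 2 := by norm_num [Nat.factorial]
  have f3 : ((3 : ℕ).factorial : ℝ) = 6 := by norm_num [Nat.factorial]
  rw [f2, div_le_iff₀ (by norm_num)] at h2
  rw [f3, div_le_iff₀ (by norm_num)] at h3
  have h := abs_profile_le_of (u := u) (a := 1) ?_ ?_ ?_
  · simpa using h
  · rw [abs_of_nonneg (one_sub_one_add_mul_exp_nonneg u)]
    exact one_sub_one_add_mul_exp_le_one hu
  · rw [abs_of_nonneg (by positivity), Real.exp_neg, ← div_eq_mul_inv, div_le_iff₀ (Real.exp_pos u)]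
    linarith
  · rw [abs_of_nonneg (by positivity), Real.exp_neg, ← div_eq_mul_inv, div_le_iff₀ (Real.exp_pos u)]
    linarith

lemma abs_profile_le_sq {u : ℝ} (hu : 0 ≤ u) : |profile u| ≤ profileBound * u ^ 2 := by
  have h1 := Real.exp_le_one_iff.mpr (neg_nonpos.mpr hu)
  have h2 : u * Real.exp (-u) ≤ 1 := by
    rw [Real.exp_neg, ← div_eq_mul_inv, div_le_one (Real.exp_pos u)]
    linarith [Real.add_one_le_exp u]
  have hsq := sq_nonneg u
  refine abs_profile_le_of ?_ ?_ ?_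
  · rw [abs_of_nonneg (one_sub_one_add_mul_exp_nonneg u)]
    exact one_sub_one_add_mul_exp_le_sq hu
  · rw [abs_of_nonneg (by positivity)]
    nlinarith
  · rw [abs_of_nonneg (by positivity)]
    nlinarith

/-- Boundedness of the profile gives the decay 2^{-x} to the right; its quadratic vanishing at 0
gives 2^{x} to the left. -/
lemma abs_wave_le (x : ℝ) : |wave x| ≤ profileBound * Real.exp (-(|x| * Real.log 2)) := by
  have hE := Real.exp_pos (x * Real.log 2)
  rw [wave, abs_mul, abs_of_pos (Real.exp_pos _)]
  rcases abs_cases x with ⟨h, _⟩ | ⟨h, _⟩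
  · rw [h, mul_comm]
    gcongr
    exact abs_profile_le hE.le
  · rw [h]
    calc Real.exp (-(x * Real.log 2)) * |profile (Real.exp (x * Real.log 2))|
        ≤ Real.exp (-(x * Real.log 2)) * (profileBound * Real.exp (x * Real.log 2) ^ 2) := by
          gcongr
          exact abs_profile_le_sq hE.le
      _ = profileBound * Real.exp (-(-x * Real.log 2)) := by
          have : Real.exp (-(x * Real.log 2)) * Real.exp (x * Real.log 2) = 1 := by
            rw [← Real.exp_add]
            simp
          rw [neg_mul, neg_neg]
          linear_combination profileBound * Real.exp (x * Real.log 2) * this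

lemma wave_isBigO :
    (fun x => (wave x : ℂ)) =O[cocompact ℝ] fun x : ℝ => |x| ^ (-2 : ℝ) := by
  refine IsBigO.of_bound (profileBound * 8) ?_
  have h0 : ∀ᶠ x : ℝ in cocompact ℝ, x ≠ 0 := by
    have := (Filter.hasBasis_cocompact (X := ℝ)).mem_of_mem (i := {0}) isCompact_singleton
    filter_upwards [this] with x hx
    simpa using hx
  filter_upwards [h0] with x hx
  rw [Complex.norm_real, Real.norm_eq_abs, mul_assoc]
  refine (abs_wave_le x).trans (mul_le_mul_of_nonneg_left ?_ profileBound_nonneg)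
  have hx' : 0 < |x| := abs_pos.mpr hx
  have h2 := Real.pow_div_factorial_le_exp (|x| * Real.log 2) (by positivity) 2
  have f2 : ((2 : ℕ).factorial : ℝ) = 2 := by norm_num [Nat.factorial]
  rw [f2, mul_pow] at h2
  have h3 : (1 / 4 : ℝ) ≤ Real.log 2 ^ 2 := by nlinarith [Real.log_two_gt_d9]
  rw [Real.norm_eq_abs, abs_of_pos (show 0 < |x| ^ (-2 : ℝ) by positivity), Real.rpow_neg hx'.le,
    Real.rpow_two,
    Real.exp_neg, ← div_eq_mul_inv, le_div_iff₀ (by positivity), inv_mul_le_iff₀ (Real.exp_pos _)]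
  have h4 : 0 < |x| ^ 2 := by positivity
  nlinarith

lemma chi_eq (k : ℤ) : chi k = ((2 * Real.pi * k / Real.log 2 : ℝ) : ℂ) * Complex.I := by
  rw [chi]
  push_cast
  ring

lemma chi_re (k : ℤ) : (chi k).re = 0 := by
  rw [chi_eq, Complex.re_ofReal_mul, Complex.I_re, mul_zero]

lemma chi_im (k : ℤ) : (chi k).im = 2 * Real.pi * k / Real.log 2 := by
  rw [chi_eq, Complex.im_ofReal_mul, Complex.I_im, mul_one]

/-- The Fourier coefficients, including the one of index zero. -/
def waveCoeff (k : ℤ) : ℂ :=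
  1 / (Real.log 2 : ℂ) * (Complex.Gamma (1 - chi k) * fourierFactor (chi k))

lemma log_two_pos : 0 < Real.log 2 := Real.log_pos (by norm_num)

/-- The substitution v = -x log 2 turns the Fourier integral at k into the Mellin integral of the
profile at -1 - χ_k, with Jacobian 1/log 2. -/
lemma fourier_wave (k : ℤ) : 𝓕 (fun x => (wave x : ℂ)) (k : ℝ) = waveCoeff k := by
  have hL := log_two_pos
  rw [waveCoeff, ← mellin_profile (chi_re k), mellin_eq_fourier]
  have h1 : (-1 - chi k).re = -1 := by simp [chi_re]
  have h2 : (-1 - chi k).im = -(2 * Real.pi * k / Real.log 2) := by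
    rw [Complex.sub_im, chi_im]
    simp
  rw [h1, h2, Real.fourier_real_eq_integral_exp_smul, Real.fourier_real_eq_integral_exp_smul]
  have h3 := Measure.integral_comp_mul_left (fun v : ℝ =>
    Complex.exp (↑(-2 * Real.pi * v * (-(2 * Real.pi * k / Real.log 2) / (2 * Real.pi))) *
      Complex.I) • (Real.exp (- -1 * v) • ((profile (Real.exp (-v)) : ℝ) : ℂ))) (-Real.log 2)
  rw [inv_neg, abs_neg, abs_of_pos (inv_pos.mpr hL)] at h3
  rw [one_div, ← Complex.ofReal_inv, ← Complex.real_smul, ← h3]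
  congr 1
  funext x
  have e1 : -2 * Real.pi * (-Real.log 2 * x) * (-(2 * Real.pi * k / Real.log 2) / (2 * Real.pi)) =
      -2 * Real.pi * x * k := by
    field_simp
  have e2 : - -1 * (-Real.log 2 * x) = -(x * Real.log 2) := by ring
  have e3 : -(-Real.log 2 * x) = x * Real.log 2 := by ring
  rw [e1, e2, e3, wave, Complex.real_smul]
  push_cast
  rfl

/-! ### The numbers `b_m` and the leading constant -/

/-- The right side is 1/log 2 times the derivative of S_m(1+κ) at κ = 0. The D and E part comes from
differentiating ρ^m and ρ^{m+1}, the rest from the polynomial factors. In B the logarithm is that of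
2^{-m}. -/
lemma b_eq (m : ℕ) : b m = -(m * coeffD m + (m + 1) * coeffE m) +
    (coeffF m + coeffG m + coeffH m + coeffI m) / Real.log 2 := by
  have hL := log_two_pos.ne'
  unfold b
  split_ifs with h
  · subst h
    simp only [coeffD, coeffE, coeffF, coeffG, coeffH, coeffI]
    norm_num
    field_simp
    ring
  · have h1 := half_pow_lt_one h
    have h2 : Real.log ((1 / 2) ^ m) = -(m * Real.log 2) := by
      rw [Real.log_pow, one_div, Real.log_inv]
      ring
    simp only [coeffD, coeffE, coeffF, coeffG, coeffH, coeffI, h, if_false, B, h2]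
    generalize (1 / 2 : ℝ) ^ m = x at *
    generalize Real.log 2 = L at *
    have e1 : x - 1 ≠ 0 := by linarith
    have e2 : x - 2 ≠ 0 := by linarith
    rw [show (1 : ℝ) - x = -(x - 1) by ring, show (1 : ℝ) - x / 2 = -(x - 2) / 2 by ring]
    field_simp
    ring

lemma abs_b_le (m : ℕ) : |b m| ≤ 16 * (m + 1) := by
  have hD := abs_le.mp (abs_coeffD_le m)
  have hE := abs_le.mp (abs_coeffE_le m)
  have hF := abs_le.mp (abs_coeffF_le m)
  have hG := abs_le.mp (abs_coeffG_le m)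
  have hH := abs_le.mp (abs_coeffH_le m)
  have hI := abs_le.mp (abs_coeffI_le m)
  have h1 : |(coeffF m + coeffG m + coeffH m + coeffI m) / Real.log 2| ≤ 8 := by
    rw [abs_div, abs_of_pos log_two_pos, div_le_iff₀ log_two_pos, abs_le]
    constructor <;> linarith [Real.log_two_gt_d9]
  have h2 := abs_le.mp h1
  have hm : (0 : ℝ) ≤ m := by positivity
  rw [b_eq, abs_le]
  constructor <;> nlinarith

lemma fast_eulerCoeff_mul_b : Fast fun m => eulerCoeff m * b m := by
  intro r
  refine Summable.of_norm_bounded ((fast_eulerCoeff.norm (2 * |r|)).mul_left 16) fun m => ?_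
  rw [norm_mul, norm_mul, norm_pow, Real.norm_eq_abs, Real.norm_eq_abs, Real.norm_eq_abs, mul_pow]
  have h : ((m : ℝ) + 1) ≤ 2 ^ m := by exact_mod_cast Nat.lt_two_pow_self
  calc |eulerCoeff m| * |b m| * |r| ^ m ≤ |eulerCoeff m| * (16 * 2 ^ m) * |r| ^ m := by
        gcongr
        exact (abs_b_le m).trans (by linarith)
    _ = _ := by ring

lemma summable_eulerCoeff_mul_b : Summable fun m => eulerCoeff m * b m :=
  fast_eulerCoeff_mul_b.summable

lemma tsum_coeff_eq :
    ∑' m, eulerCoeff m * (coeffF m + coeffG m + coeffH m + coeffI m) =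
      QInf * (limLin + limQuad - limCub) := by
  have hq := QInf_pos.ne'
  have h1 : QInf * (limLin + limQuad - limCub) =
      ∑' n, seriesLin n + ∑' n, seriesQuad n - ∑' n, seriesCub n := by
    rw [limLin, limQuad, limCub]
    field_simp
  rw [h1, tsum_seriesLin]
  have hs : Summable fun m => eulerCoeff m * (coeffF m + coeffG m) := by
    simpa [mul_add] using fast_F.summable.add fast_G.summable
  rw [← hs.tsum_add fast_seriesQuad.summable,
    ← (hs.add fast_seriesQuad.summable).tsum_sub fast_seriesCub.summable]
  refine tsum_congr fun m => ?_
  rw [seriesQuad, seriesCub]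
  ring

lemma Fast.natCast_mul {W : ℕ → ℝ} (h : Fast W) : Fast fun n => n * W n := by
  intro r
  refine Summable.of_norm_bounded (h.norm (2 * |r|)) fun n => ?_
  rw [norm_mul, norm_mul, norm_pow, Real.norm_eq_abs, Real.norm_eq_abs, Real.norm_eq_abs,
    Nat.abs_cast, mul_pow]
  have h : (n : ℝ) ≤ 2 ^ n := by exact_mod_cast Nat.lt_two_pow_self.le
  calc n * |W n| * |r| ^ n ≤ 2 ^ n * |W n| * |r| ^ n := by gcongr
    _ = _ := by ring

lemma tsum_natCast_mul_seriesOne :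
    ∑' n : ℕ, n * seriesOne n =
      ∑' m : ℕ, eulerCoeff m * (m * coeffD m + (m + 1) * coeffE m) := by
  have hE1 : Summable fun m : ℕ => ((m : ℝ) + 1) * (eulerCoeff m * coeffE m) := by
    simpa [add_mul] using fast_E.natCast_mul.summable.add fast_E.summable
  have h1 : HasSum (fun n : ℕ => shift (fun m => eulerCoeff m * coeffE m) n * (n : ℝ))
      (∑' m : ℕ, ((m : ℝ) + 1) * (eulerCoeff m * coeffE m)) := by
    refine hasSum_shift_mul (c := fun n : ℕ => (n : ℝ)) ?_
    refine hE1.hasSum.congr_fun fun m => ?_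
    push_cast
    ring
  have h2 := fast_D.natCast_mul.summable.hasSum.add h1
  rw [← fast_D.natCast_mul.summable.tsum_add hE1] at h2
  have h3 : ∀ n : ℕ, n * seriesOne n = n * (eulerCoeff n * coeffD n) +
      shift (fun m => eulerCoeff m * coeffE m) n * (n : ℝ) := by
    intro n
    rw [seriesOne]
    split_ifs with h
    · subst h
      simp
    · ring
  rw [tsum_congr h3, h2.tsum_eq]
  refine tsum_congr fun m => ?_
  ring

/-- The constant splits into the exponentially small corrections and the mean of the wave. -/
theorem leadingConstant_eq :
    leadingConstant = baseConst + (limLin + limQuad - limCub) / Real.log 2 := by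
  have hq := QInf_pos.ne'
  have hDE : Summable fun m : ℕ => eulerCoeff m * (m * coeffD m + (m + 1) * coeffE m) := by
    have := (fast_D.natCast_mul.summable.add fast_E.natCast_mul.summable).add fast_E.summable
    refine this.congr fun m => ?_
    ring
  have hFG : Summable fun m : ℕ => eulerCoeff m * (coeffF m + coeffG m + coeffH m + coeffI m) := by
    have := ((fast_F.summable.add fast_G.summable).add fast_H.summable).add fast_I.summable
    refine this.congr fun m => ?_
    ring
  have h1 : ∑' m, eulerCoeff m * b m =
      -(∑' m : ℕ, eulerCoeff m * (m * coeffD m + (m + 1) * coeffE m)) +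
        (∑' m, eulerCoeff m * (coeffF m + coeffG m + coeffH m + coeffI m)) / Real.log 2 := by
    rw [← tsum_neg, ← tsum_div_const, ← hDE.neg.tsum_add (hFG.div_const _)]
    refine tsum_congr fun m => ?_
    rw [b_eq]
    ring
  rw [leadingConstant, h1, tsum_coeff_eq, ← tsum_natCast_mul_seriesOne, baseConst]
  field_simp

/-! ### Numerical evaluation -/

lemma abs_sum_tail_le {f g : ℕ → ℝ} {s : ℝ} (hf : HasSum f s) (M : ℕ) (hfg : ∀ m, |f m| ≤ g m)
    (hg : ∀ m, M ≤ m → g (m + 1) ≤ g m / 2) : |s - ∑ m ∈ Finset.range M, f m| ≤ 2 * g M := by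
  have h1 : ∀ i, g (i + M) ≤ g M * (1 / 2) ^ i := by
    intro i
    induction i with
    | zero => simp
    | succ i ih =>
      have := hg (i + M) (by omega)
      rw [show i + 1 + M = i + M + 1 by ring, pow_succ]
      linarith
  have h2 := (hasSum_nat_add_iff' M).mpr hf
  rw [← h2.tsum_eq]
  have h3 := tsum_of_norm_bounded (f := fun i => f (i + M))
    (summable_geometric_two.hasSum.mul_left (g M)) fun i => (hfg _).trans (h1 i)
  rw [tsum_geometric_two, Real.norm_eq_abs] at h3
  linarith

lemma abs_eulerCoeff_succ_le {m : ℕ} (hm : 1 ≤ m) :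
    |eulerCoeff (m + 1)| ≤ |eulerCoeff m| / 3 := by
  have h : (4 : ℝ) ≤ 2 ^ (m + 1) := by
    calc (4 : ℝ) = 2 ^ 2 := by norm_num
      _ ≤ 2 ^ (m + 1) := pow_le_pow_right₀ (by norm_num) (by omega)
  rw [eulerCoeff_succ, abs_div, abs_neg, abs_of_pos (by linarith : (0 : ℝ) < 2 ^ (m + 1) - 1)]
  gcongr
  linarith

lemma abs_eulerCoeff_tail_le {c : ℕ → ℝ} {K : ℝ} (hc : ∀ m, |c m| ≤ K) {M : ℕ} (hM : 1 ≤ M) :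
    |∑' m, eulerCoeff m * c m - ∑ m ∈ Finset.range M, eulerCoeff m * c m| ≤
      2 * (|eulerCoeff M| * K) := by
  have hK : 0 ≤ K := (abs_nonneg _).trans (hc 0)
  refine abs_sum_tail_le (g := fun m => |eulerCoeff m| * K) (fast_mul hc).summable.hasSum M
    (fun m => ?_) fun m hm => ?_
  · rw [abs_mul]
    gcongr
    exact hc m
  · have h1 := abs_eulerCoeff_succ_le (hM.trans hm)
    have h2 : |eulerCoeff (m + 1)| ≤ |eulerCoeff m| / 2 := by linarith [abs_nonneg (eulerCoeff m)]
    calc |eulerCoeff (m + 1)| * K ≤ |eulerCoeff m| / 2 * K := by gcongr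
      _ = _ := by ring

lemma abs_eulerCoeff_mul_b_tail_le {M : ℕ} (hM : 1 ≤ M) :
    |∑' m, eulerCoeff m * b m - ∑ m ∈ Finset.range M, eulerCoeff m * b m| ≤
      2 * (|eulerCoeff M| * (16 * (M + 1))) := by
  refine abs_sum_tail_le (g := fun m => |eulerCoeff m| * (16 * (m + 1)))
    summable_eulerCoeff_mul_b.hasSum M (fun m => ?_) fun m hm => ?_
  · rw [abs_mul]
    gcongr
    exact abs_b_le m
  · have h1 := abs_eulerCoeff_succ_le (hM.trans hm)
    have h3 : (1 : ℝ) ≤ m := by exact_mod_cast hM.trans hm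
    push_cast
    calc |eulerCoeff (m + 1)| * (16 * (m + 1 + 1)) ≤
          |eulerCoeff m| / 3 * (16 * (m + 1 + 1)) := by gcongr
      _ ≤ |eulerCoeff m| * (16 * (m + 1)) / 2 := by
          have := abs_nonneg (eulerCoeff m)
          nlinarith

/-- The series of log((1+x)/(1-x)) at x = 1/3, whose terms shrink by a factor of at least 9. -/
lemma hasSum_log_two :
    HasSum (fun k : ℕ => 2 * (1 / (2 * (k : ℝ) + 1)) * (1 / 3) ^ (2 * k + 1)) (Real.log 2) := by
  have h := Real.hasSum_log_sub_log_of_abs_lt_one (x := 1 / 3) (by rw [abs_lt]; norm_num)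
  rw [← Real.log_div (by norm_num) (by norm_num)] at h
  norm_num at h
  simpa using h

lemma log_two_bounds : 0.693147180559945309417232121458 < Real.log 2 ∧
    Real.log 2 < 0.693147180559945309417232121459 := by
  have h := abs_le.mp (abs_sum_tail_le hasSum_log_two 31 (fun m => (abs_of_pos (by positivity)).le)
    fun m _ => ?_)
  · norm_num [Finset.sum_range_succ] at h
    constructor <;> linarith [h.1, h.2]
  · have h1 : 1 / (2 * ((m + 1 : ℕ) : ℝ) + 1) ≤ 1 / (2 * (m : ℝ) + 1) := by
      push_cast
      gcongr
      linarith
    have h2 : (1 / 3 : ℝ) ^ (2 * (m + 1) + 1) = (1 / 3) ^ (2 * m + 1) / 9 := by ring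
    rw [h2]
    have h3 : (0 : ℝ) < (1 / 3) ^ (2 * m + 1) := by positivity
    have h4 : (0 : ℝ) < 1 / (2 * (m : ℝ) + 1) := by positivity
    nlinarith

lemma eulerCoeff_two : eulerCoeff 2 = 1 / 3 := by
  rw [eulerCoeff_succ, eulerCoeff_one]; norm_num

lemma eulerCoeff_three : eulerCoeff 3 = -1 / 21 := by
  rw [eulerCoeff_succ, eulerCoeff_two]; norm_num

lemma eulerCoeff_four : eulerCoeff 4 = 1 / 315 := by
  rw [eulerCoeff_succ, eulerCoeff_three]; norm_num

lemma eulerCoeff_five : eulerCoeff 5 = -1 / 9765 := by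
  rw [eulerCoeff_succ, eulerCoeff_four]; norm_num

lemma eulerCoeff_six : eulerCoeff 6 = 1 / 615195 := by
  rw [eulerCoeff_succ, eulerCoeff_five]; norm_num

lemma eulerCoeff_seven : eulerCoeff 7 = -1 / 78129765 := by
  rw [eulerCoeff_succ, eulerCoeff_six]; norm_num

lemma eulerCoeff_eight : eulerCoeff 8 = 1 / 19923090075 := by
  rw [eulerCoeff_succ, eulerCoeff_seven]; norm_num

lemma eulerCoeff_nine : eulerCoeff 9 = -1 / 10180699028325 := by
  rw [eulerCoeff_succ, eulerCoeff_eight]; norm_num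

lemma eulerCoeff_ten : eulerCoeff 10 = 1 / 10414855105976475 := by
  rw [eulerCoeff_succ, eulerCoeff_nine]; norm_num

lemma eulerCoeff_eleven : eulerCoeff 11 = -1 / 21319208401933844325 := by
  rw [eulerCoeff_succ, eulerCoeff_ten]; norm_num

lemma eulerCoeff_twelve : eulerCoeff 12 = 1 / 87302158405919092510875 := by
  rw [eulerCoeff_succ, eulerCoeff_eleven]; norm_num

lemma eulerCoeff_thirteen : eulerCoeff 13 = -1 / 715091979502883286756577125 := by
  rw [eulerCoeff_succ, eulerCoeff_twelve]; norm_num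

lemma abs_eulerCoeff_fourteen_le : |eulerCoeff 14| ≤ 1 / 10 ^ 31 := by
  rw [eulerCoeff_succ, eulerCoeff_thirteen, abs_le]
  constructor <;> norm_num

lemma tsum_eulerCoeff : ∑' m, eulerCoeff m = QInf := by
  have h := (hasSum_eulerCoeff 0).tsum_eq
  simpa [Q_zero] using h

lemma QInf_bounds : 0.288788095086602421278899721928 < QInf ∧
    QInf < 0.288788095086602421278899721930 := by
  have h := abs_le.mp (abs_eulerCoeff_tail_le (c := fun _ => 1) (K := 1) (by simp)
    (M := 14) (by norm_num))
  simp only [mul_one, tsum_eulerCoeff] at h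
  norm_num [Finset.sum_range_succ, eulerCoeff_zero, eulerCoeff_one, eulerCoeff_two,
    eulerCoeff_three, eulerCoeff_four, eulerCoeff_five, eulerCoeff_six, eulerCoeff_seven,
    eulerCoeff_eight, eulerCoeff_nine, eulerCoeff_ten, eulerCoeff_eleven, eulerCoeff_twelve,
    eulerCoeff_thirteen] at h
  have h14 := abs_eulerCoeff_fourteen_le
  norm_num at h14
  constructor <;> linarith [h.1, h.2]

/-- By `b_eq` every partial sum is r + s/log 2 with r and s rational, so both can be evaluated
exactly and log 2 enters only once. -/
lemma sum_eulerCoeff_mul_b :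
    ∃ r s : ℝ, ∑ m ∈ Finset.range 14, eulerCoeff m * b m = r + s / Real.log 2 ∧
      -0.99616440923236437572382715664 < r ∧ r < -0.99616440923236437572382715663 ∧
      0.75195753294476183540208293026 < s ∧ s < 0.75195753294476183540208293027 := by
  refine ⟨∑ m ∈ Finset.range 14, eulerCoeff m * -(m * coeffD m + (m + 1) * coeffE m),
    ∑ m ∈ Finset.range 14, eulerCoeff m * (coeffF m + coeffG m + coeffH m + coeffI m), ?_, ?_⟩
  · rw [Finset.sum_div, ← Finset.sum_add_distrib]
    refine Finset.sum_congr rfl fun m _ => ?_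
    rw [b_eq]
    ring
  · norm_num [Finset.sum_range_succ, eulerCoeff_zero, eulerCoeff_one, eulerCoeff_two,
      eulerCoeff_three, eulerCoeff_four, eulerCoeff_five, eulerCoeff_six, eulerCoeff_seven,
      eulerCoeff_eight, eulerCoeff_nine, eulerCoeff_ten, eulerCoeff_eleven, eulerCoeff_twelve,
      eulerCoeff_thirteen, coeffD, coeffE, coeffF, coeffG, coeffH, coeffI]

theorem leadingConstant_bounds : (0.30707981393605921828549 : ℝ) ≤ leadingConstant ∧
    leadingConstant < (0.30707981393605921828550 : ℝ) := by
  obtain ⟨r, s, hrs, hr1, hr2, hs1, hs2⟩ := sum_eulerCoeff_mul_b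
  have h := abs_le.mp (abs_eulerCoeff_mul_b_tail_le (M := 14) (by norm_num))
  have h14 := abs_eulerCoeff_fourteen_le
  rw [hrs] at h
  obtain ⟨q1, q2⟩ := QInf_bounds
  obtain ⟨l1, l2⟩ := log_two_bounds
  have hq := QInf_pos
  have hl := log_two_pos
  have hs3 : s / Real.log 2 < 1.084845403738507224592419749 := by
    rw [div_lt_iff₀ hl]
    nlinarith
  have hs4 : 1.084845403738507224592419748 < s / Real.log 2 := by
    rw [lt_div_iff₀ hl]
    nlinarith
  norm_num at h h14
  have hlc : leadingConstant = (∑' m, eulerCoeff m * b m) / QInf := by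
    rw [leadingConstant]
    ring
  rw [hlc, le_div_iff₀ hq, div_lt_iff₀ hq]
  constructor
  · norm_num at *
    linarith [h.1, h.2]
  · norm_num at *
    linarith [h.1, h.2]

/-! ### Size of the Fourier coefficients -/

/-- |Γ(1-iy)|² = Γ(1-iy)Γ(1+iy) = iy Γ(iy)Γ(1-iy), and the reflection formula applies, with sin(iπy)
= i sinh(πy). -/
lemma norm_sq_Gamma_one_sub_mul_I {y : ℝ} (hy : y ≠ 0) :
    ‖Complex.Gamma (1 - y * Complex.I)‖ ^ 2 = Real.pi * y / Real.sinh (Real.pi * y) := by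
  have hz : (y * Complex.I : ℂ) ≠ 0 := by simp [hy]
  have h1 := Complex.Gamma_mul_Gamma_one_sub (y * Complex.I)
  have h2 := Complex.Gamma_add_one _ hz
  have h3 : (starRingEnd ℂ) (1 - y * Complex.I) = y * Complex.I + 1 := by
    simp
    ring
  have h4 : Complex.Gamma (1 - y * Complex.I) * (starRingEnd ℂ) (Complex.Gamma (1 - y * Complex.I)) =
      ((Real.pi * y / Real.sinh (Real.pi * y) : ℝ) : ℂ) := by
    rw [← Complex.Gamma_conj, h3, h2]
    have h5 : Complex.sin (Real.pi * (y * Complex.I)) =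
        ((Real.sinh (Real.pi * y) : ℝ) : ℂ) * Complex.I := by
      rw [← mul_assoc, Complex.sin_mul_I]
      push_cast
      rfl
    have hs : ((Real.sinh (Real.pi * y) : ℝ) : ℂ) ≠ 0 := by
      rw [Complex.ofReal_ne_zero, Ne, Real.sinh_eq_zero]
      exact mul_ne_zero Real.pi_ne_zero hy
    rw [h5] at h1
    calc Complex.Gamma (1 - y * Complex.I) * (y * Complex.I * Complex.Gamma (y * Complex.I))
        = y * Complex.I * (Complex.Gamma (y * Complex.I) * Complex.Gamma (1 - y * Complex.I)) := by
          ring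
      _ = _ := by
          rw [h1, Complex.ofReal_div, Complex.ofReal_mul]
          field_simp [Complex.I_ne_zero]
  rw [Complex.mul_conj, Complex.normSq_eq_norm_sq] at h4
  exact_mod_cast h4

/-- `π |Im χ_k|`. -/
def freq (k : ℤ) : ℝ := 2 * Real.pi ^ 2 * |(k : ℝ)| / Real.log 2

lemma pi_mul_abs_chi_im (k : ℤ) : Real.pi * |(chi k).im| = freq k := by
  rw [chi_im, freq, abs_div, abs_mul, abs_of_pos log_two_pos, abs_of_pos (by positivity)]
  ring

lemma chi_eq_im_mul_I (k : ℤ) : chi k = ((chi k).im : ℂ) * Complex.I := by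
  rw [chi_im]
  exact chi_eq k

lemma chi_im_ne_zero {k : ℤ} (hk : k ≠ 0) : (chi k).im ≠ 0 := by
  rw [chi_im]
  have h1 : (k : ℝ) ≠ 0 := by exact_mod_cast hk
  have h2 := log_two_pos.ne'
  have h3 := Real.pi_ne_zero
  positivity

lemma norm_sq_Gamma_one_sub_chi {k : ℤ} (hk : k ≠ 0) :
    ‖Complex.Gamma (1 - chi k)‖ ^ 2 = freq k / Real.sinh (freq k) := by
  rw [chi_eq_im_mul_I, norm_sq_Gamma_one_sub_mul_I (chi_im_ne_zero hk), ← pi_mul_abs_chi_im]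
  rcases abs_cases (chi k).im with ⟨h, _⟩ | ⟨h, _⟩
  · rw [h]
  · rw [h, mul_neg, Real.sinh_neg, neg_div_neg_eq]

lemma two_pi_sq_div_log_two_bounds :
    28.47 ≤ 2 * Real.pi ^ 2 / Real.log 2 ∧ 2 * Real.pi ^ 2 / Real.log 2 ≤ 28.48 := by
  have h1 := Real.pi_gt_d6
  have h2 := Real.pi_lt_d6
  have h3 := Real.log_two_gt_d9
  have h4 := Real.log_two_lt_d9
  have hL := log_two_pos
  constructor
  · rw [le_div_iff₀ hL]
    nlinarith
  · rw [div_le_iff₀ hL]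
    nlinarith

lemma freq_ge (k : ℤ) : 28.47 * |(k : ℝ)| ≤ freq k := by
  rw [freq, mul_div_right_comm]
  exact mul_le_mul_of_nonneg_right two_pi_sq_div_log_two_bounds.1 (abs_nonneg _)

lemma one_le_abs_intCast {k : ℤ} (hk : k ≠ 0) : (1 : ℝ) ≤ |(k : ℝ)| := by
  exact_mod_cast Int.one_le_abs hk

lemma limLin_bounds : 3.70 ≤ limLin ∧ limLin ≤ 3.71 := by
  have h := abs_le.mp (abs_eulerCoeff_tail_le (c := fun m => coeffF m + coeffG m) (K := 3)
    (fun m => (abs_add_le _ _).trans (by linarith [abs_coeffF_le m, abs_coeffG_le m]))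
    (M := 5) (by norm_num))
  rw [← tsum_seriesLin] at h
  norm_num [Finset.sum_range_succ, eulerCoeff_zero, eulerCoeff_one, eulerCoeff_two,
    eulerCoeff_three, eulerCoeff_four, eulerCoeff_five, coeffF, coeffG] at h
  obtain ⟨q1, q2⟩ := QInf_bounds
  rw [limLin, le_div_iff₀ QInf_pos, div_le_iff₀ QInf_pos]
  constructor <;> linarith [h.1, h.2]

lemma limQuad_bounds : -1.392 ≤ limQuad ∧ limQuad ≤ -1.389 := by
  have h := abs_le.mp (abs_eulerCoeff_tail_le abs_coeffH_le (M := 5) (by norm_num))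
  change _ ≤ ∑' m, seriesQuad m - _ ∧ ∑' m, seriesQuad m - _ ≤ _ at h
  norm_num [Finset.sum_range_succ, eulerCoeff_zero, eulerCoeff_one, eulerCoeff_two,
    eulerCoeff_three, eulerCoeff_four, eulerCoeff_five, coeffH] at h
  obtain ⟨q1, q2⟩ := QInf_bounds
  rw [limQuad, le_div_iff₀ QInf_pos, div_le_iff₀ QInf_pos]
  constructor <;> linarith [h.1, h.2]

lemma limCub_bounds : -0.2886 ≤ limCub ∧ limCub ≤ -0.2885 := by
  obtain ⟨q1, q2⟩ := QInf_bounds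
  rw [limCub, tsum_seriesCub, le_div_iff₀ QInf_pos, div_le_iff₀ QInf_pos]
  constructor <;> linarith

lemma fourierFactor_mul_I (y : ℝ) :
    fourierFactor (y * Complex.I) =
      ((limLin / (1 + y ^ 2) + limQuad - limCub : ℝ) : ℂ) +
        ((limCub * y - limLin * y / (1 + y ^ 2) : ℝ) : ℂ) * Complex.I := by
  have h1 : (1 : ℂ) + y * Complex.I ≠ 0 := by
    intro h
    have := congrArg Complex.re h
    simp at this
  have h2 : (1 : ℂ) + y ^ 2 ≠ 0 := by
    have : (1 : ℝ) + y ^ 2 ≠ 0 := by positivity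
    exact_mod_cast this
  have h3 : (1 : ℂ) / (1 + y * Complex.I) = (1 - y * Complex.I) / (1 + y ^ 2) := by
    rw [div_eq_div_iff h1 h2]
    linear_combination (y : ℂ) ^ 2 * Complex.I_sq
  rw [fourierFactor, div_eq_mul_one_div, h3]
  push_cast
  ring

lemma norm_fourierFactor_le (y : ℝ) : ‖fourierFactor (y * Complex.I)‖ ≤ 5.4 + 0.3 * |y| := by
  obtain ⟨a1, a2⟩ := limLin_bounds
  obtain ⟨b1, b2⟩ := limQuad_bounds
  obtain ⟨c1, c2⟩ := limCub_bounds
  have h1 : 1 ≤ ‖(1 : ℂ) + y * Complex.I‖ := by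
    have := Complex.abs_re_le_norm ((1 : ℂ) + y * Complex.I)
    simpa using this
  have e1 : ‖(limLin : ℂ) / (1 + y * Complex.I)‖ ≤ 3.71 := by
    rw [norm_div, Complex.norm_real, Real.norm_eq_abs, abs_of_pos (by linarith),
      div_le_iff₀ (by linarith)]
    linarith
  have e2 : ‖(limQuad : ℂ)‖ ≤ 1.392 := by
    rw [Complex.norm_real, Real.norm_eq_abs, abs_of_neg (by linarith)]
    linarith
  have e3 : ‖(limCub : ℂ) * (1 - y * Complex.I)‖ ≤ 0.2886 * (1 + |y|) := by
    rw [norm_mul, Complex.norm_real, Real.norm_eq_abs, abs_of_neg (by linarith)]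
    have : ‖(1 : ℂ) - y * Complex.I‖ ≤ 1 + |y| := by
      refine (norm_sub_le _ _).trans ?_
      simp
    gcongr
    linarith
  rw [fourierFactor]
  refine (norm_sub_le _ _).trans ((add_le_add_left (norm_add_le _ _) _).trans ?_)
  linarith [abs_nonneg y]

lemma norm_waveCoeff (k : ℤ) :
    ‖waveCoeff k‖ = ‖Complex.Gamma (1 - chi k)‖ * ‖fourierFactor (chi k)‖ / Real.log 2 := by
  rw [waveCoeff, norm_mul, norm_mul, norm_div, norm_one, Complex.norm_real, Real.norm_eq_abs,
    abs_of_pos log_two_pos]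
  ring

/-- With t = `freq k` ≥ 28.47|k|, the Gamma factor is at most 6e^{-7t/16} and the rational factor at
most 7e^{t/16}, so the product is at most 42e^{-3t/8}. Then 3·28.47/8 > 10, e^{-10} ≤ 1/20000 and
42/log 2 < 61. -/
lemma norm_waveCoeff_le {k : ℤ} (hk : k ≠ 0) :
    ‖waveCoeff k‖ ≤ 61 * (1 / 20000) ^ k.natAbs := by
  have hk1 := one_le_abs_intCast hk
  have hf := freq_ge k
  have hpi := pi_mul_abs_chi_im k
  have hG := norm_sq_Gamma_one_sub_chi hk
  have hF := norm_fourierFactor_le (chi k).im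
  rw [← chi_eq_im_mul_I] at hF
  set t := freq k with ht
  have ht1 : 28.47 ≤ t := by linarith
  have hy : |(chi k).im| ≤ t / 3 := by
    rw [← hpi]
    have := Real.pi_gt_three
    nlinarith [abs_nonneg (chi k).im]
  have hs : Real.exp t / 4 ≤ Real.sinh t := by
    rw [Real.sinh_eq]
    have h1 : Real.exp (-t) ≤ 1 := Real.exp_le_one_iff.mpr (by linarith)
    have h2 := Real.add_one_le_exp t
    linarith
  have hG2 : ‖Complex.Gamma (1 - chi k)‖ ≤ 6 * Real.exp (-(7 * t / 16)) := by
    refine le_of_sq_le_sq ?_ (by positivity)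
    rw [hG, mul_pow, ← Real.exp_nat_mul]
    have h1 := Real.add_one_le_exp (t / 8)
    have h2 : Real.exp (((2 : ℕ) : ℝ) * -(7 * t / 16)) = Real.exp (t / 8) / Real.exp t := by
      rw [← Real.exp_sub]
      congr 1
      push_cast
      ring
    have h3 : t / Real.sinh t ≤ t / (Real.exp t / 4) := by gcongr
    refine h3.trans ?_
    rw [h2, div_div_eq_mul_div, mul_div_assoc']
    refine div_le_div_of_nonneg_right ?_ (Real.exp_pos t).le
    linarith
  have hF2 : ‖fourierFactor (chi k)‖ ≤ 7 * Real.exp (t / 16) := by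
    have h1 := Real.add_one_le_exp (t / 16)
    linarith
  have h1 : ‖Complex.Gamma (1 - chi k)‖ * ‖fourierFactor (chi k)‖ ≤ 42 * Real.exp (-(3 * t / 8)) := by
    calc ‖Complex.Gamma (1 - chi k)‖ * ‖fourierFactor (chi k)‖
        ≤ (6 * Real.exp (-(7 * t / 16))) * (7 * Real.exp (t / 16)) := by gcongr
      _ = 42 * (Real.exp (-(7 * t / 16)) * Real.exp (t / 16)) := by ring
      _ = _ := by
        rw [← Real.exp_add]
        ring_nf
  have h2 : Real.exp (-(3 * t / 8)) ≤ (1 / 20000) ^ k.natAbs := by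
    have h3 : Real.exp (-10) ≤ 1 / 20000 := by
      rw [Real.exp_neg, inv_le_comm₀ (Real.exp_pos _) (by norm_num)]
      have h4 : Real.exp 10 = Real.exp 1 ^ 10 := by
        rw [← Real.exp_nat_mul]
        norm_num
      rw [h4]
      have h5 : (2.718 : ℝ) ≤ Real.exp 1 := by linarith [Real.exp_one_gt_d9]
      calc ((1 / 20000 : ℝ))⁻¹ ≤ 2.718 ^ 10 := by norm_num
        _ ≤ Real.exp 1 ^ 10 := by gcongr
    have h6 : (k.natAbs : ℝ) = |(k : ℝ)| := by
      rw [Nat.cast_natAbs, Int.cast_abs]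
    calc Real.exp (-(3 * t / 8)) ≤ Real.exp (k.natAbs * -10) := by
          rw [h6]
          gcongr
          linarith
      _ = Real.exp (-10) ^ k.natAbs := Real.exp_nat_mul _ _
      _ ≤ _ := by gcongr
  rw [norm_waveCoeff, div_le_iff₀ log_two_pos]
  have h7 : (0 : ℝ) ≤ (1 / 20000) ^ k.natAbs := by positivity
  nlinarith [Real.log_two_gt_d9]

/-- The geometric bound is too crude for k = ±1, which dominate δ. Two coefficients of size 2.4·10⁻⁵
leave room below 5·10⁻⁵ for all the others. -/
lemma norm_waveCoeff_le_of_natAbs_eq_one {k : ℤ} (hk : k.natAbs = 1) :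
    ‖waveCoeff k‖ ≤ 2.4 / 10 ^ 5 := by
  have hk0 : k ≠ 0 := by
    rintro rfl
    simp at hk
  have hkabs : |(k : ℝ)| = 1 := by
    rw [← Int.cast_abs, ← Nat.cast_natAbs, hk]
    simp
  have hG := norm_sq_Gamma_one_sub_chi hk0
  have hfreq : freq k = 2 * Real.pi ^ 2 / Real.log 2 := by rw [freq, hkabs, mul_one]
  obtain ⟨t1, t2⟩ := two_pi_sq_div_log_two_bounds
  rw [← hfreq] at t1 t2
  have hexp : (2.28 : ℝ) * 10 ^ 12 ≤ Real.exp (freq k) := by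
    have h1 : Real.exp (28 + 0.47) ≤ Real.exp (freq k) := by
      gcongr
      norm_num at *
      linarith
    refine le_trans ?_ h1
    have h2 : Real.exp 28 = Real.exp 1 ^ 28 := by
      rw [← Real.exp_nat_mul]
      norm_num
    have h3 := Real.quadratic_le_exp_of_nonneg (x := 0.47) (by norm_num)
    have h4 : (2.71828 : ℝ) ≤ Real.exp 1 := by linarith [Real.exp_one_gt_d9]
    rw [Real.exp_add, h2]
    calc (2.28 : ℝ) * 10 ^ 12 ≤ 2.71828 ^ 28 * (1 + 0.47 + 0.47 ^ 2 / 2) := by norm_num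
      _ ≤ Real.exp 1 ^ 28 * Real.exp 0.47 := by gcongr
  have hsinh : (1.139 : ℝ) * 10 ^ 12 ≤ Real.sinh (freq k) := by
    rw [Real.sinh_eq]
    have h1 : Real.exp (-freq k) ≤ 1 := Real.exp_le_one_iff.mpr (by linarith)
    linarith
  have hG2 : ‖Complex.Gamma (1 - chi k)‖ ≤ 5.05 / 10 ^ 6 := by
    refine le_of_sq_le_sq ?_ (by positivity)
    rw [hG, div_le_iff₀ (by linarith)]
    nlinarith
  have hy1 : |(chi k).im| = 2 * Real.pi / Real.log 2 := by
    rw [chi_im, abs_div, abs_mul, hkabs, abs_of_pos log_two_pos, abs_of_pos (by positivity),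
      mul_one]
  have hy2 : 9.06 ≤ |(chi k).im| ∧ |(chi k).im| ≤ 9.07 := by
    rw [hy1, le_div_iff₀ log_two_pos, div_le_iff₀ log_two_pos]
    constructor <;> linarith [Real.pi_gt_d6, Real.pi_lt_d6, Real.log_two_gt_d9, Real.log_two_lt_d9]
  -- Real and imaginary parts are treated separately, since `limQuad` and `limCub` partly cancel in
  -- the real part; the triangle inequality of `norm_fourierFactor_le` would give about 8.
  have hF : ‖fourierFactor (chi k)‖ ≤ 3.25 := by
    obtain ⟨a1, a2⟩ := limLin_bounds
    obtain ⟨b1, b2⟩ := limQuad_bounds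
    obtain ⟨c1, c2⟩ := limCub_bounds
    rw [chi_eq_im_mul_I, fourierFactor_mul_I]
    refine le_of_sq_le_sq ?_ (by norm_num)
    rw [← Complex.normSq_eq_norm_sq, Complex.normSq_add_mul_I]
    have hsq : (chi k).im ^ 2 = |(chi k).im| ^ 2 := (sq_abs _).symm
    set y := (chi k).im
    have ysq1 : 82 ≤ y ^ 2 := by rw [hsq]; nlinarith
    have ysq2 : y ^ 2 ≤ 82.3 := by rw [hsq]; nlinarith
    have d1 : 0.044 ≤ limLin / (1 + y ^ 2) := by
      rw [le_div_iff₀ (by positivity)]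
      linarith
    have d2 : limLin / (1 + y ^ 2) ≤ 0.045 := by
      rw [div_le_iff₀ (by positivity)]
      linarith
    have e1 : (limCub * y - limLin * y / (1 + y ^ 2)) ^ 2 =
        (-limCub + limLin / (1 + y ^ 2)) ^ 2 * y ^ 2 := by ring
    rw [e1]
    generalize limLin / (1 + y ^ 2) = p at *
    have r1 : (p + limQuad - limCub) ^ 2 ≤ 1.07 ^ 2 := by
      rw [sq_le_sq, abs_of_neg (by linarith), abs_of_pos (by norm_num)]
      linarith
    have r2 : (-limCub + p) ^ 2 ≤ 0.3336 ^ 2 := by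
      rw [sq_le_sq, abs_of_pos (by linarith), abs_of_pos (by norm_num)]
      linarith
    have r3 : (-limCub + p) ^ 2 * y ^ 2 ≤ 0.3336 ^ 2 * 82.3 := by gcongr
    norm_num at *
    linarith
  rw [norm_waveCoeff, div_le_iff₀ log_two_pos]
  calc ‖Complex.Gamma (1 - chi k)‖ * ‖fourierFactor (chi k)‖ ≤ 5.05 / 10 ^ 6 * 3.25 := by gcongr
    _ ≤ 2.4 / 10 ^ 5 * 0.6931471803 := by norm_num
    _ ≤ 2.4 / 10 ^ 5 * Real.log 2 := by
      gcongr
      exact Real.log_two_gt_d9.le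

/-- A majorant of the Fourier coefficients. -/
def coeffBound (n : ℕ) : ℝ :=
  if n = 0 then 0 else if n = 1 then 2.4 / 10 ^ 5 else 61 * (1 / 20000) ^ n

/-- The Fourier coefficients of the periodic function. -/
def periodicCoeff (k : ℤ) : ℂ := if k = 0 then 0 else waveCoeff k

lemma norm_periodicCoeff_le (k : ℤ) : ‖periodicCoeff k‖ ≤ coeffBound k.natAbs := by
  unfold periodicCoeff coeffBound
  by_cases h : k = 0
  · simp [h]
  · rw [if_neg h, if_neg (by simpa using h)]
    split_ifs with h1
    · exact norm_waveCoeff_le_of_natAbs_eq_one h1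
    · exact norm_waveCoeff_le h

lemma hasSum_coeffBound_succ :
    HasSum (fun n => coeffBound (n + 1)) (2.4 / 10 ^ 5 + 61 * (1 / 20000) ^ 2 * (20000 / 19999)) := by
  rw [← hasSum_nat_add_iff' 1]
  have h := (hasSum_geometric_of_lt_one (r := (1 / 20000 : ℝ)) (by norm_num) (by norm_num)).mul_left
    (61 * (1 / 20000) ^ 2)
  convert! h using 1
  · funext n
    simp only [coeffBound]
    rw [if_neg (by omega), if_neg (by omega)]
    ring
  · norm_num [coeffBound]

lemma hasSum_coeffBound :
    HasSum coeffBound (2.4 / 10 ^ 5 + 61 * (1 / 20000) ^ 2 * (20000 / 19999)) := by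
  rw [← hasSum_nat_add_iff' 1]
  simpa [coeffBound] using hasSum_coeffBound_succ

lemma hasSum_coeffBound_int : HasSum (fun k : ℤ => coeffBound k.natAbs)
    ((2.4 / 10 ^ 5 + 61 * (1 / 20000) ^ 2 * (20000 / 19999)) +
      (2.4 / 10 ^ 5 + 61 * (1 / 20000) ^ 2 * (20000 / 19999))) := by
  refine HasSum.of_nat_of_neg_add_one (f := fun k : ℤ => coeffBound k.natAbs) ?_ ?_
  · simpa using hasSum_coeffBound
  · refine hasSum_coeffBound_succ.congr_fun fun n => ?_
    congr 1

lemma summable_norm_periodicCoeff : Summable fun k : ℤ => ‖periodicCoeff k‖ :=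
  Summable.of_nonneg_of_le (fun _ => norm_nonneg _) norm_periodicCoeff_le
    hasSum_coeffBound_int.summable

lemma tsum_norm_periodicCoeff_lt : ∑' k : ℤ, ‖periodicCoeff k‖ < 5 / 10 ^ 5 := by
  refine lt_of_le_of_lt (summable_norm_periodicCoeff.tsum_le_tsum norm_periodicCoeff_le
    hasSum_coeffBound_int.summable) ?_
  rw [hasSum_coeffBound_int.tsum_eq]
  norm_num

lemma summable_waveCoeff : Summable waveCoeff := by
  have h : Summable periodicCoeff := summable_norm_periodicCoeff.of_norm
  have h2 : Summable fun k : ℤ => if k = 0 then waveCoeff 0 else 0 :=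
    (hasSum_ite_eq (0 : ℤ) (waveCoeff 0)).summable
  refine (h.add h2).congr fun k => ?_
  unfold periodicCoeff
  split_ifs with hk
  · simp [hk]
  · simp

end DST

namespace DST

open scoped FourierTransform

/-! ### The Fourier series of the periodic function -/

lemma summable_half_pow_natAbs : Summable fun n : ℤ => (1 / 2 : ℝ) ^ n.natAbs := by
  rw [summable_int_iff_summable_nat_and_neg]
  constructor <;> simpa using summable_geometric_two

lemma exp_neg_natCast_mul_log_two (n : ℕ) : Real.exp (-(n * Real.log 2)) = (1 / 2) ^ n := by
  rw [Real.exp_neg, mul_comm, Real.exp_mul, Real.exp_log (by norm_num), Real.rpow_natCast,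
    one_div, inv_pow]

lemma summable_wave (x : ℝ) : Summable fun n : ℤ => wave (x + n) := by
  refine Summable.of_norm_bounded (summable_half_pow_natAbs.mul_left
    (profileBound * Real.exp (|x| * Real.log 2))) fun n => (abs_wave_le _).trans ?_
  rw [mul_assoc, ← exp_neg_natCast_mul_log_two, ← Real.exp_add]
  refine mul_le_mul_of_nonneg_left (Real.exp_le_exp.mpr ?_) profileBound_nonneg
  have h1 : ((n.natAbs : ℕ) : ℝ) = |(n : ℝ)| := by rw [Nat.cast_natAbs, Int.cast_abs]
  have h2 : |(n : ℝ)| ≤ |x + n| + |x| := by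
    have := abs_sub (x + n) x
    rwa [add_sub_cancel_left] at this
  rw [h1]
  nlinarith [log_two_pos]

/-- The mean of the periodized wave. -/
def waveMean : ℝ := (limLin + limQuad - limCub) / Real.log 2

lemma waveCoeff_zero : waveCoeff 0 = waveMean := by
  have h : chi 0 = 0 := by simp [chi]
  rw [waveCoeff, h, waveMean, fourierFactor]
  push_cast
  simp
  ring

/-- The periodized wave. -/
def waveSum (x : ℝ) : ℝ := ∑' n : ℤ, wave (x + n)

lemma norm_exp_two_pi_mul (k : ℤ) (x : ℝ) :
    ‖Complex.exp (2 * Real.pi * Complex.I * k * x)‖ = 1 := by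
  have h : (2 * Real.pi * Complex.I * k * x : ℂ) = ((2 * Real.pi * k * x : ℝ) : ℂ) * Complex.I := by
    push_cast
    ring
  rw [h, Complex.norm_exp_ofReal_mul_I]

/-- Poisson summation, justified by the decay of the wave and the summability of its Fourier
transform at the integers. -/
lemma hasSum_waveSum (x : ℝ) :
    HasSum (fun k : ℤ => waveCoeff k * Complex.exp (2 * Real.pi * Complex.I * k * x))
      (waveSum x : ℂ) := by
  have hs : Summable fun k : ℤ => waveCoeff k * Complex.exp (2 * Real.pi * Complex.I * k * x) := by
    refine Summable.of_norm ?_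
    simp only [norm_mul, norm_exp_two_pi_mul, mul_one]
    exact summable_waveCoeff.norm
  have hF : (fun n : ℤ => 𝓕 (Complex.ofReal ∘ wave) (n : ℝ)) = waveCoeff := funext fourier_wave
  have h := Real.tsum_eq_tsum_fourier_of_rpow_decay_of_summable
    (Complex.continuous_ofReal.comp continuous_wave) one_lt_two wave_isBigO
    (by rw [hF]; exact summable_waveCoeff) x
  have h2 : ∀ k : ℤ, 𝓕 (Complex.ofReal ∘ wave) (k : ℝ) * fourier k (x : UnitAddCircle) =
      waveCoeff k * Complex.exp (2 * Real.pi * Complex.I * k * x) := by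
    intro k
    rw [congrFun hF k, fourier_coe_apply]
    simp
  rw [tsum_congr h2] at h
  rw [waveSum, Complex.ofReal_tsum]
  exact h ▸ hs.hasSum

/-- The periodic fluctuation. -/
def fluctuation (x : ℝ) : ℝ := waveSum x - waveMean

lemma fluctuation_periodic : Function.Periodic fluctuation 1 := by
  intro x
  unfold fluctuation waveSum
  congr 1
  rw [← (Equiv.addLeft (1 : ℤ)).tsum_eq fun n : ℤ => wave (x + n)]
  refine tsum_congr fun n => ?_
  simp [add_assoc]

lemma hasSum_fluctuation (x : ℝ) :
    HasSum (fun k : ℤ => periodicCoeff k * Complex.exp (2 * Real.pi * Complex.I * k * x))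
      (fluctuation x : ℂ) := by
  have h := (hasSum_waveSum x).sub (hasSum_ite_eq (0 : ℤ) (waveMean : ℂ))
  rw [fluctuation, Complex.ofReal_sub]
  refine h.congr_fun fun k => ?_
  unfold periodicCoeff
  split_ifs with hk
  · subst hk
    simp [waveCoeff_zero]
  · simp

lemma abs_fluctuation_lt (x : ℝ) : |fluctuation x| < 5 / 10 ^ 5 := by
  refine lt_of_le_of_lt ?_ tsum_norm_periodicCoeff_lt
  rw [← Real.norm_eq_abs, ← Complex.norm_real, ← (hasSum_fluctuation x).tsum_eq]
  refine tsum_of_norm_bounded summable_norm_periodicCoeff.hasSum fun k => ?_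
  rw [norm_mul, norm_exp_two_pi_mul, mul_one]

/-! ### The asymptotic expansion -/

lemma exp_logb_mul_log {N : ℕ} (hN : 0 < N) :
    Real.exp (Real.logb 2 N * Real.log 2) = N := by
  rw [Real.logb, div_mul_cancel₀ _ log_two_pos.ne', Real.exp_log (by exact_mod_cast hN)]

lemma natCast_mul_wave_sub {N : ℕ} (hN : 0 < N) (n : ℕ) :
    N * wave (Real.logb 2 N + -(n : ℝ)) = 2 ^ n * profile (N * (1 / 2) ^ n) := by
  have h0 : (N : ℝ) ≠ 0 := by exact_mod_cast hN.ne'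
  have h1 : Real.exp ((Real.logb 2 N + -(n : ℝ)) * Real.log 2) = N * (1 / 2) ^ n := by
    rw [add_mul, Real.exp_add, exp_logb_mul_log hN, neg_mul, exp_neg_natCast_mul_log_two]
  rw [wave, Real.exp_neg, h1, ← mul_assoc]
  congr 1
  rw [one_div, inv_pow]
  field_simp

lemma natCast_mul_abs_wave_add_le {N : ℕ} (hN : 0 < N) (n : ℕ) :
    N * |wave (Real.logb 2 N + n)| ≤ profileBound * (1 / 2) ^ n := by
  have h0 : (0 : ℝ) < N := by exact_mod_cast hN
  have h1 : Real.exp (-((Real.logb 2 N + n) * Real.log 2)) = (1 / 2) ^ n / N := by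
    rw [add_mul, neg_add, Real.exp_add, exp_neg_natCast_mul_log_two, Real.exp_neg,
      exp_logb_mul_log hN]
    ring
  rw [wave, abs_mul, abs_of_pos (Real.exp_pos _), h1]
  have h2 := abs_profile_le (Real.exp_pos ((Real.logb 2 N + n) * Real.log 2)).le
  calc N * ((1 / 2) ^ n / N * |profile (Real.exp ((Real.logb 2 N + n) * Real.log 2))|)
      = |profile (Real.exp ((Real.logb 2 N + n) * Real.log 2))| * (1 / 2) ^ n := by field_simp
    _ ≤ _ := by gcongr

/-- Levels n ≥ 0 of the dyadic sum are the terms wave(log_2 N - n). The remaining terms wave(log_2 N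
+ n) with n ≥ 1 are at most `profileBound`·2^{-n} after multiplication by N. -/
lemma abs_waveSum_sub_le {N : ℕ} (hN : 0 < N) :
    |N * waveSum (Real.logb 2 N) - ∑' n : ℕ, 2 ^ n * profile (N * (1 / 2) ^ n)| ≤
      profileBound := by
  set x := Real.logb 2 N with hx
  have hs := summable_wave x
  have hneg : Summable fun n : ℤ => wave (x + ((-n : ℤ) : ℝ)) :=
    (Equiv.neg ℤ).summable_iff.mpr hs
  have hsum : waveSum x = ∑' n : ℤ, wave (x + ((-n : ℤ) : ℝ)) :=
    ((Equiv.neg ℤ).tsum_eq fun n : ℤ => wave (x + n)).symm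
  have h1 : Summable fun n : ℕ => wave (x + ((-(n : ℤ) : ℤ) : ℝ)) :=
    hneg.comp_injective Nat.cast_injective
  have h2 : Summable fun n : ℕ => wave (x + ((-(-((n : ℤ) + 1)) : ℤ) : ℝ)) :=
    hneg.comp_injective (i := fun n : ℕ => -((n : ℤ) + 1)) fun a b hab => by
      simpa using hab
  rw [hsum, tsum_of_nat_of_neg_add_one (f := fun n : ℤ => wave (x + ((-n : ℤ) : ℝ))) h1 h2]
  have h3 : ∑' n : ℕ, 2 ^ n * profile (N * (1 / 2) ^ n) =
      N * ∑' n : ℕ, wave (x + ((-(n : ℤ) : ℤ) : ℝ)) := by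
    rw [← tsum_mul_left]
    refine tsum_congr fun n => ?_
    rw [← natCast_mul_wave_sub hN]
    simp [hx]
  rw [h3, mul_add, add_sub_cancel_left, ← tsum_mul_left]
  have hb : HasSum (fun n : ℕ => profileBound * (1 / 2 : ℝ) ^ n / 2) profileBound := by
    have := (hasSum_geometric_two.mul_left profileBound).div_const 2
    rwa [mul_div_cancel_right₀ _ two_ne_zero] at this
  rw [← Real.norm_eq_abs]
  refine tsum_of_norm_bounded hb fun n => ?_
  have h4 := natCast_mul_abs_wave_add_le hN (n + 1)
  rw [norm_mul, Real.norm_eq_abs, Real.norm_eq_abs, Nat.abs_cast]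
  push_cast at h4 ⊢
  rw [neg_neg]
  refine h4.trans (le_of_eq ?_)
  ring

theorem averageProtected_isBigO :
    (fun N : ℕ => averageProtected N
        - ((N : ℝ) * leadingConstant + (N : ℝ) * fluctuation (Real.logb 2 N)))
      =O[atTop] (fun _ : ℕ => (1 : ℝ)) := by
  obtain ⟨C, hC⟩ := exists_abs_averageProtected_sub_le
  refine IsBigO.of_bound (C + profileBound) ?_
  filter_upwards [eventually_ge_atTop 4] with N hN
  have h1 := (hC N hN).2
  have h2 := abs_waveSum_sub_le (show 0 < N by omega)
  have h3 : averageProtected N -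
      ((N : ℝ) * leadingConstant + (N : ℝ) * fluctuation (Real.logb 2 N)) =
      (averageProtected N - N * baseConst - ∑' n : ℕ, 2 ^ n * profile (N * (1 / 2) ^ n)) -
        (N * waveSum (Real.logb 2 N) - ∑' n : ℕ, 2 ^ n * profile (N * (1 / 2) ^ n)) := by
    rw [leadingConstant_eq, fluctuation, waveMean]
    ring
  rw [h3, norm_one, mul_one]
  exact (norm_sub_le _ _).trans (add_le_add h1 h2)

/-! ### The limits defining `b_m` and the Fourier coefficients -/

lemma two_cpow_eq_exp (w : ℂ) : (2 : ℂ) ^ w = Complex.exp (w * Real.log 2) := by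
  rw [Complex.cpow_def_of_ne_zero two_ne_zero, mul_comm, Complex.ofReal_log (by norm_num)]
  norm_num

lemma hasDerivAt_two_cpow_neg (κ : ℂ) :
    HasDerivAt (fun κ : ℂ => (2 : ℂ) ^ (-κ)) (-(Real.log 2 * 2 ^ (-κ))) κ := by
  simp only [two_cpow_eq_exp]
  have h1 : HasDerivAt (fun κ : ℂ => -κ * (Real.log 2 : ℂ)) (-1 * (Real.log 2 : ℂ)) κ :=
    (hasDerivAt_neg κ).mul_const _
  convert! h1.cexp using 1
  ring

lemma hasDerivAt_innerPoly (m : ℕ) :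
    HasDerivAt (fun κ : ℂ => innerPoly m (2 ^ (-κ)) κ) ((Real.log 2 * b m : ℝ) : ℂ) 0 := by
  have hρ := hasDerivAt_two_cpow_neg 0
  have hid := hasDerivAt_id (0 : ℂ)
  have hm := hρ.pow m
  have hm1 := hρ.pow (m + 1)
  have h := (((((hm.sub_const 1).const_mul (coeffD m : ℂ)).add
    ((hm1.sub_const 1).const_mul (coeffE m : ℂ))).add
    (hid.mul ((hm.const_mul (coeffF m : ℂ)).add (hm1.const_mul (coeffG m : ℂ))))).add
    ((hid.mul (hid.add_const 1)).mul (hm.const_mul (coeffH m : ℂ)))).sub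
    (((hid.pow 3).sub hid).mul (hm.const_mul (coeffI m : ℂ)))
  convert! h using 1
  have hL := log_two_pos.ne'
  have hb : Real.log 2 * b m = -(Real.log 2 * (m * coeffD m + (m + 1) * coeffE m)) +
      (coeffF m + coeffG m + coeffH m + coeffI m) := by
    rw [b_eq]
    field_simp
  rw [hb]
  simp
  ring

lemma tendsto_div_of_hasDerivAt {f g : ℂ → ℂ} {f' g' a : ℂ} (hf : HasDerivAt f f' a)
    (hg : HasDerivAt g g' a) (hf0 : f a = 0) (hg0 : g a = 0) (hg' : g' ≠ 0) :
    Tendsto (fun z => f z / g z) (𝓝[≠] a) (𝓝 (f' / g')) := by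
  have h1 := hasDerivAt_iff_tendsto_slope.mp hf
  have h2 := hasDerivAt_iff_tendsto_slope.mp hg
  refine (h1.div h2 hg').congr' ?_
  filter_upwards [self_mem_nhdsWithin] with z hz
  have hz' : z - a ≠ 0 := sub_ne_zero.mpr hz
  simp only [Pi.div_apply, slope_def_field, hf0, hg0, sub_zero]
  field_simp

lemma two_cpow_one_sub (z : ℂ) : (2 : ℂ) ^ (1 - z) = 2 ^ (-(z - 1)) := by
  congr 1
  ring

lemma hasDerivAt_one_sub_two_cpow {z : ℂ} (hz : (2 : ℂ) ^ (1 - z) = 1) :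
    HasDerivAt (fun z : ℂ => 1 - (2 : ℂ) ^ (1 - z)) (Real.log 2) z := by
  have h1 := (hasDerivAt_two_cpow_neg (z - 1)).comp_sub_const z 1
  rw [← two_cpow_one_sub, hz] at h1
  simp only [two_cpow_one_sub]
  convert! h1.const_sub 1 using 1
  ring

lemma log_two_ofReal_ne_zero : (Real.log 2 : ℂ) ≠ 0 := by
  exact_mod_cast log_two_pos.ne'

lemma QInf_ofReal_ne_zero : (QInf : ℂ) ≠ 0 := by
  exact_mod_cast QInf_pos.ne'

lemma continuous_two_cpow_one_sub : Continuous fun z : ℂ => (2 : ℂ) ^ (1 - z) := by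
  simp only [two_cpow_eq_exp]
  fun_prop

lemma tendsto_QInf_div_eulerSeries {z : ℂ} (hz : (2 : ℂ) ^ (1 - z) = 1) :
    Tendsto (fun z : ℂ => (QInf : ℂ) / eulerSeries (2 ^ (1 - z))) (𝓝[≠] z) (𝓝 1) := by
  have h1 := ((continuous_eulerSeries.comp continuous_two_cpow_one_sub).tendsto z).mono_left
    (nhdsWithin_le_nhds (s := {z}ᶜ))
  simp only [Function.comp, hz, ← QInf_eq_eulerSeries] at h1
  have h2 := (tendsto_const_nhds (x := (QInf : ℂ))).div h1 QInf_ofReal_ne_zero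
  rwa [div_self QInf_ofReal_ne_zero] at h2

/-- Both S_m(z) and 1 - 2^{1-z} vanish at z = 1, with derivatives (log 2)·b_m and log 2, while
Q_∞/Q(2^{1-z}) tends to 1. -/
theorem tendsto_b (m : ℕ) : Tendsto
    (fun z : ℂ => (QInf : ℂ) / QFun (2 ^ (1 - z)) / (1 - 2 ^ (1 - z)) * innerSum m z)
    (𝓝[≠] 1) (𝓝 (b m : ℂ)) := by
  have h0 : (2 : ℂ) ^ (1 - (1 : ℂ)) = 1 := by simp
  have hd : HasDerivAt (fun z : ℂ => innerSum m z) ((Real.log 2 * b m : ℝ) : ℂ) 1 := by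
    have h := (hasDerivAt_innerPoly m)
    rw [← sub_self (1 : ℂ)] at h
    have h2 := h.comp_sub_const 1 1
    convert! h2 using 2 with z
    rw [← innerSum_eq_innerPoly, add_sub_cancel]
  have hv : innerSum m 1 = 0 := by
    have := innerSum_eq_innerPoly m 0
    rw [add_zero] at this
    rw [this]
    simp [innerPoly]
  have h1 := tendsto_div_of_hasDerivAt hd (hasDerivAt_one_sub_two_cpow h0) hv (by simp)
    log_two_ofReal_ne_zero
  have h2 := (tendsto_QInf_div_eulerSeries h0).mul h1
  rw [Complex.ofReal_mul, mul_div_cancel_left₀ _ log_two_ofReal_ne_zero, one_mul] at h2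
  refine h2.congr fun z => ?_
  rw [QFun_eq_eulerSeries]
  ring

/-! ### Residues of Γ(-z)ψ(z) at 1 + χ_k -/

lemma Fast.continuous_powerSum {W : ℕ → ℝ} (h : Fast W) : Continuous (powerSum W) := by
  rw [continuous_iff_continuousAt]
  intro x
  have h : ContinuousOn (powerSum W) (Metric.ball 0 (‖x‖ + 1)) := by
    refine continuousOn_tsum (u := fun m => |W m| * (‖x‖ + 1) ^ m)
      (fun m => by fun_prop) (h.norm _) fun m y hy => ?_
    rw [mem_ball_zero_iff] at hy
    rw [norm_mul, norm_pow, Complex.norm_real, Real.norm_eq_abs]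
    gcongr
  exact h.continuousAt (Metric.isOpen_ball.mem_nhds (by simp))

lemma continuous_innerTotal :
    Continuous fun z : ℂ => innerTotal ((2 : ℂ) ^ (1 - z)) (z - 1) := by
  have hc := continuous_two_cpow_one_sub
  have h1 := fast_seriesOne.continuous_powerSum.comp hc
  have h2 := fast_seriesLin.continuous_powerSum.comp hc
  have h3 := fast_seriesQuad.continuous_powerSum.comp hc
  have h4 := fast_seriesCub.continuous_powerSum.comp hc
  unfold innerTotal
  simp only [Function.comp_def] at h1 h2 h3 h4
  fun_prop

lemma two_cpow_neg_chi (k : ℤ) : (2 : ℂ) ^ (1 - (1 + chi k)) = 1 := by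
  rw [two_cpow_eq_exp, Complex.exp_eq_one_iff]
  refine ⟨-k, ?_⟩
  rw [chi]
  have := log_two_ofReal_ne_zero
  push_cast
  field_simp
  ring

lemma innerTotal_one (χ : ℂ) :
    innerTotal 1 χ = QInf * (χ * limLin + χ * (χ + 1) * limQuad + (χ ^ 3 - χ) * limCub) := by
  have := QInf_ofReal_ne_zero
  rw [innerTotal, powerSum_one, powerSum_one, powerSum_one, powerSum_one, tsum_seriesOne, limLin,
    limQuad, limCub]
  push_cast
  field_simp
  ring

/-- Two steps of the functional equation give Γ(1-χ) = χ(1+χ)Γ(-1-χ), and χ(1+χ) clears the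
denominator of `fourierFactor`. -/
lemma waveCoeff_eq {k : ℤ} (hk : k ≠ 0) :
    waveCoeff k = 1 / Real.log 2 * Complex.Gamma (-(1 + chi k)) *
      (chi k * limLin + chi k * (chi k + 1) * limQuad + (chi k ^ 3 - chi k) * limCub) := by
  have h0 : chi k ≠ 0 := by
    intro h
    exact chi_im_ne_zero hk (by rw [h, Complex.zero_im])
  have h1 : 1 + chi k ≠ 0 := by
    intro h
    have := congrArg Complex.re h
    simp [chi_re] at this
  have h2 := Complex.Gamma_add_one (-(1 + chi k)) (neg_ne_zero.mpr h1)
  have h3 := Complex.Gamma_add_one (-chi k) (neg_ne_zero.mpr h0)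
  rw [show -(1 + chi k) + 1 = -chi k by ring] at h2
  rw [waveCoeff, show 1 - chi k = -chi k + 1 by ring, h3, h2, fourierFactor]
  field_simp
  ring

/-- For k ≠ 0 the point -(1+χ_k) is not real, so Γ(-z) is regular there. The possible pole comes
from 1/(1 - 2^{1-z}), split off from 1/Q(2^{2-z}). Because ρ = 1 at this point, the part from
`seriesOne` drops out of the total. -/
theorem tendsto_residue {k : ℤ} (hk : k ≠ 0) : Tendsto
    (fun z : ℂ => (z - (1 + chi k)) * (Complex.Gamma (-z) * psi z))
    (𝓝[≠] (1 + chi k)) (𝓝 (waveCoeff k)) := by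
  have h0 := two_cpow_neg_chi k
  have h1 := tendsto_div_of_hasDerivAt ((hasDerivAt_id (1 + chi k)).sub_const (1 + chi k))
    (hasDerivAt_one_sub_two_cpow h0) (by simp)
    (by simp only [h0, sub_self]) log_two_ofReal_ne_zero
  have hG : ContinuousAt (fun z : ℂ => Complex.Gamma (-z)) (1 + chi k) := by
    have : ContinuousAt Complex.Gamma (-(1 + chi k)) := by
      refine (Complex.differentiableAt_Gamma _ fun m h => ?_).continuousAt
      have h2 := congrArg Complex.im h
      simp at h2
      exact chi_im_ne_zero hk h2
    exact this.comp continuous_neg.continuousAt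
  have h2 := hG.tendsto.mono_left (nhdsWithin_le_nhds (s := {1 + chi k}ᶜ))
  have h3 := tendsto_QInf_div_eulerSeries h0
  have h4 := (continuous_innerTotal.tendsto (1 + chi k)).mono_left
    (nhdsWithin_le_nhds (s := {1 + chi k}ᶜ))
  rw [h0, add_sub_cancel_left, innerTotal_one] at h4
  have h5 := (((h1.mul h2).mul h3).mul (h4.const_mul (1 / (QInf : ℂ))))
  have h6 : (1 / (Real.log 2 : ℂ) * Complex.Gamma (-(1 + chi k)) * 1 * (1 / (QInf : ℂ) *
      (QInf * (chi k * limLin + chi k * (chi k + 1) * limQuad + (chi k ^ 3 - chi k) * limCub)))) =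
      waveCoeff k := by
    have := QInf_ofReal_ne_zero
    rw [waveCoeff_eq hk]
    field_simp
  rw [h6] at h5
  refine h5.congr fun z => ?_
  have h7 : ∑' m, (eulerCoeff m : ℂ) * innerSum m z = innerTotal (2 ^ (1 - z)) (z - 1) := by
    have := (hasSum_innerSum (z - 1)).tsum_eq
    rwa [add_sub_cancel, ← two_cpow_one_sub] at this
  have h8 : (2 : ℂ) ^ (2 - z) / 2 = 2 ^ (1 - z) := by
    rw [show 2 - z = (1 - z) + 1 by ring, Complex.cpow_add _ _ two_ne_zero, Complex.cpow_one,
      mul_div_cancel_right₀ _ two_ne_zero]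
  rw [psi, h7, QFun_eq_eulerSeries, eulerSeries_half (2 ^ (2 - z)), h8, div_mul_eq_div_div, id]
  ring

end DST

end

theorem theorem2 :
    -- the constant: its series converges, its terms come from the stated limits, and its value
    Summable (fun m : ℕ => DST.eulerCoeff m * DST.b m) ∧
    (∀ m : ℕ, Tendsto
      (fun z : ℂ => (DST.QInf : ℂ) / DST.QFun (2 ^ (1 - z)) / (1 - 2 ^ (1 - z)) * DST.innerSum m z)
      (𝓝[≠] 1) (𝓝 (DST.b m : ℂ))) ∧
    (0.30707981393605921828549 : ℝ) ≤ DST.leadingConstant ∧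
    DST.leadingConstant < (0.30707981393605921828550 : ℝ) ∧
    -- the periodic function, its Fourier expansion from the poles at `1 + χ_k`, its size, and
    -- the asymptotic expansion
    ∃ (δ : ℝ → ℝ) (c : ℤ → ℂ),
      Function.Periodic δ 1 ∧
      c 0 = 0 ∧
      (∀ k : ℤ, k ≠ 0 → Tendsto
        (fun z : ℂ => (z - (1 + DST.chi k)) * (Complex.Gamma (-z) * DST.psi z))
        (𝓝[≠] (1 + DST.chi k)) (𝓝 (c k))) ∧
      Summable (fun k : ℤ => ‖c k‖) ∧
      (∀ x : ℝ, HasSum (fun k : ℤ => c k * Complex.exp (2 * Real.pi * Complex.I * k * x))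
        (δ x : ℂ)) ∧
      (∀ x : ℝ, |δ x| < 5 / 10 ^ 5) ∧
      (fun N : ℕ => DST.averageProtected N
          - ((N : ℝ) * DST.leadingConstant + (N : ℝ) * δ (Real.logb 2 N)))
        =O[atTop] (fun _ : ℕ => (1 : ℝ)) := by
  refine ⟨DST.summable_eulerCoeff_mul_b, DST.tendsto_b, DST.leadingConstant_bounds.1,
    DST.leadingConstant_bounds.2, DST.fluctuation, DST.periodicCoeff, DST.fluctuation_periodic,
    by simp [DST.periodicCoeff], fun k hk => ?_, DST.summable_norm_periodicCoeff,
    DST.hasSum_fluctuation, DST.abs_fluctuation_lt, DST.averageProtected_isBigO⟩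
  rw [DST.periodicCoeff, if_neg hk]
  exact DST.tendsto_residue hk
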